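/- Throughout, $\mathscr S(\mathfrak A)$ and $\mathscr P(\mathfrak A)$ denote the state space and the pure state space of a unital $C^*$-algebra $\mathfrak A$, with the weak$^*$ topology, and $I=[0,1]$. For $\omega\in\mathscr S(\mathfrak A)$ and $A\in\mathfrak A$ with $\omega(A^*A)\neq 0$, let $A\cdot\omega$ be the state $(A\cdot\omega)(B)=\omega(A^*BA)/\omega(A^*A)$. A UHF algebra is a unital $C^*$-algebra which is the closure of the union of an increasing sequence of unital $*$-subalgebras, each $*$-isomorphic to a full matrix algebra $M_k(\mathbb C)$, $k\geq 1$. (1) Let $\mathfrak A$ be a UHF algebra. Then $\mathfrak A\cong\bigotimes_{i\in\mathbb N}M_{k_i}(\mathbb C)$ for some integers $k_i\ge 1$, i.e. $\mathfrak A$ is generated by unital, pairwise commuting copies of the algebras $M_{k_i}(\mathbb C)$. Given any such factorization, there is a pure state $\omega_0$ of $\mathfrak A$ (the product state) with $\omega_0(a_0\otimes\cdots\otimes a_{n-1})=\prod_{i<n}\langle e_1,a_ie_1\rangle$ for all $n$ and all $a_i\in M_{k_i}(\mathbb C)$, where $e_1$ is the first standard basis vector, and the following holds. For every weak$^*$-continuous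 loop $\omega\colon I\to\mathscr S(\mathfrak A)$ based at $\omega_0$ there are a norm-continuous map $A\colon I\times[0,1)\to\mathfrak A$ and a homotopy $H\colon I\times I\to\mathscr S(\mathfrak A)$, relative to the endpoints, from $H(\cdot,0)=\omega$ to the constant loop $H(\cdot,1)=\omega_0$, such that $\omega_t(A_{t,s}^*A_{t,s})\ne 0$ and $H(t,s)=A_{t,s}\cdot\omega_t$ for all $t\in I$ and $s<1$. Moreover $\pi_1(\mathscr P(\mathfrak A),\omega_0)=0$. (2) The pure state space $\mathscr P(\mathfrak A)$ of every UHF algebra $\mathfrak A$ is simply connected. (3) Let $\Gamma$ be a countable set and $\mathcal H\neq 0$ a finite-dimensional complex Hilbert space. Let $\mathscr P_\Gamma(\mathcal H)=\mathscr P(\mathfrak A_\Gamma(\mathcal H))$ be the pure state space of the quasi-local algebra $\mathfrak A_\Gamma(\mathcal H)=\bigotimes_{v\in\Gamma}\mathcal B(\mathcal H)$, the $C^*$-colimit of the algebras $\bigotimes_{v\in\Lambda}\mathcal B(\mathcal H)$ over the finite $\Lambda\subset\Gamma$. Then $\mathscr P_\Gamma(\mathcal H)$ is simply connected. (4) Let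 in addition $u\in\mathcal H$ be a unit vector and let $f_i\colon\mathcal H^{\otimes i}\to\mathcal H^{\otimes(i+1)}$, $f_i(x)=x\otimes u$. There are maps $\mathscr P_\Gamma(f_i)\colon\mathscr P_\Gamma(\mathcal H^{\otimes i})\to\mathscr P_\Gamma(\mathcal H^{\otimes (i+1)})$, uniquely determined by $\mathscr P_\Gamma(f_i)(\omega)\bigl(\bigotimes_{v\in\Lambda}B_v\bigr)=\omega\bigl(\bigotimes_{v\in\Lambda}f_i^*B_vf_i\bigr)$ for all finite $\Lambda\subset\Gamma$, and the colimit $\mathscr P_\Gamma(\mathcal H^{\otimes\infty})=\operatorname{colim}_{i\ge 0}\mathscr P_\Gamma(\mathcal H^{\otimes i})$ of topological spaces along these maps is simply connected. -/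

import Mathlib

open scoped ComplexOrder TensorProduct

/-! ### States and pure states -/

section States

variable {A : Type*} [CStarAlgebra A]

/-- Positivity of a functional on a unital C⋆-algebra. -/
def IsPositiveFunctional (φ : WeakDual ℂ A) : Prop := ∀ a : A, 0 ≤ φ (star a * a)

variable (A) in
/-- The state space `𝒮(A)`: positive functionals with `φ 1 = 1`, with the weak-* topology
(the subspace topology from `WeakDual ℂ A`). -/
abbrev StateSpace : Type _ := {φ : WeakDual ℂ A // IsPositiveFunctional φ ∧ φ 1 = 1}

/-- A state `ω` is pure if every positive functional `φ ≤ ω` is `t ω` for some `t ∈ [0,1]`. -/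
def IsPureState (ω : StateSpace A) : Prop :=
  ∀ φ : WeakDual ℂ A, IsPositiveFunctional φ →
    (∀ a : A, φ (star a * a) ≤ ω.1 (star a * a)) →
    ∃ t : ℝ, 0 ≤ t ∧ t ≤ 1 ∧ φ = (t : ℂ) • ω.1

variable (A) in
/-- The pure state space `𝒫(A)` with the weak-* topology. -/
abbrev PureStateSpace : Type _ := {ω : StateSpace A // IsPureState ω}

/-- The Gelfand ideal `𝔑_ω = {a | ω(a⋆a) = 0}`. -/
def gelfandIdeal (ω : StateSpace A) : Set A := {a | ω.1 (star a * a) = 0}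

/-- The functional `b ↦ ω(a⋆ b a) / ω(a⋆ a)`. -/
noncomputable def conjFunctional (a : A) (ω : StateSpace A) : WeakDual ℂ A :=
  StrongDual.toWeakDual
    ((ω.1 (star a * a))⁻¹ • (WeakDual.toStrongDual ω.1).comp
      ((ContinuousLinearMap.mul ℂ A (star a)).comp ((ContinuousLinearMap.mul ℂ A).flip a)))

theorem conjFunctional_apply (a : A) (ω : StateSpace A) (b : A) :
    conjFunctional a ω b = ω.1 (star a * b * a) / ω.1 (star a * a) := by
  rw [div_eq_inv_mul, mul_assoc]
  rfl

/-- The state `a · ω`, `(a · ω)(b) = ω(a⋆ b a) / ω(a⋆ a)`, defined for `a ∉ 𝔑_ω`. -/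
noncomputable def actOnState (a : A) (ω : StateSpace A) (ha : a ∉ gelfandIdeal ω) :
    StateSpace A :=
  ⟨conjFunctional a ω, by
    refine ⟨fun b => ?_, ?_⟩
    · rw [conjFunctional_apply]
      have h := ω.2.1 (b * a)
      rw [star_mul, show star a * star b * (b * a) = star a * (star b * b) * a by
        simp only [mul_assoc]] at h
      rw [div_eq_mul_inv]
      exact mul_nonneg h (inv_nonneg.2 (ω.2.1 a))
    · rw [conjFunctional_apply, mul_one]
      exact div_self ha⟩

end States

/-! ### UHF algebras -/

section UHF

variable {A : Type*} [CStarAlgebra A]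

variable (A) in
/-- A unital C⋆-algebra is UHF if it is the closure of an increasing sequence of unital
⋆-subalgebras, each ⋆-isomorphic to a full matrix algebra `M_k(ℂ)`, `k ≥ 1`. -/
def IsUHF : Prop :=
  ∃ B : ℕ → StarSubalgebra ℂ A, Monotone B ∧
    (∀ n, ∃ k : ℕ, 0 < k ∧ Nonempty (B n ≃⋆ₐ[ℂ] Matrix (Fin k) (Fin k) ℂ)) ∧
    Dense (⋃ n, (B n : Set A))

variable (A) in
/-- A presentation of `A` as the infinite tensor product `⨂ᵢ M_{kᵢ}(ℂ)`: unital copies of the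
algebras `M_{kᵢ}(ℂ)` in `A` that commute with each other and together generate `A`. -/
structure TensorFactorization where
  k : ℕ → ℕ
  k_pos : ∀ i, 0 < k i
  ι : ∀ i, Matrix (Fin (k i)) (Fin (k i)) ℂ →⋆ₐ[ℂ] A
  commute : ∀ i j, i ≠ j → ∀ a b, Commute (ι i a) (ι j b)
  dense : Dense (StarAlgebra.adjoin ℂ (⋃ i, Set.range (ι i)) : Set A)

/-- `ω` is the product state given by the first standard basis vector in each tensor factor:
`ω(a₀ ⊗ ⋯ ⊗ aₙ₋₁) = ∏ᵢ ⟨e₁, aᵢ e₁⟩`. -/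
def TensorFactorization.IsProductState (F : TensorFactorization A) (ω : StateSpace A) : Prop :=
  ∀ (n : ℕ) (a : ∀ i, Matrix (Fin (F.k i)) (Fin (F.k i)) ℂ),
    ω.1 (((List.range n).map fun i => F.ι i (a i)).prod) =
      ((List.range n).map fun i => a i ⟨0, F.k_pos i⟩ ⟨0, F.k_pos i⟩).prod

end UHF

/-! ### The quasi-local algebra

For a matrix `M` and a site `v`, `siteMatrix v M` is `M` acting at the site `v` on the Hilbert
space `ℓ²(Γ → n)` of all configurations. The operators of the different sites commute, and those of
a finite set `Λ` of sites generate a faithful copy of `⨂_{v ∈ Λ} M_n(ℂ)`; the inclusions tensor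
with identities. So the norm closure of the local operators is the C⋆-colimit over the finite `Λ`.
-/

section QuasiLocal

variable {Γ n : Type*} [Fintype n]

/-- The Hilbert space `ℓ²(Γ → n)`. -/
abbrev ConfigSpace (Γ n : Type*) : Type _ := lp (fun _ : Γ → n => ℂ) 2

open Classical in
/-- `(M f)(σ) = ∑ j, M (σ v) j * f (σ with the value j at v)`. -/
noncomputable def siteFun (v : Γ) (M : Matrix n n ℂ) (f : (Γ → n) → ℂ) : (Γ → n) → ℂ :=
  fun σ => ∑ j, M (σ v) j * f (Function.update σ v j)

open Classical in
theorem siteFun_split (v : Γ) (M : Matrix n n ℂ) (f : (Γ → n) → ℂ) (i : n)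
    (ρ : {w // w ≠ v} → n) :
    siteFun v M f ((Equiv.funSplitAt v n).symm (i, ρ)) =
      ∑ j, M i j * f ((Equiv.funSplitAt v n).symm (j, ρ)) := by
  unfold siteFun
  refine Finset.sum_congr rfl fun j _ => ?_
  congr 2
  · simp
  · ext w
    by_cases hw : w = v
    · subst hw; simp
    · simp [Function.update, hw]

open Classical in
theorem memℓp_siteFun (v : Γ) (M : Matrix n n ℂ) (f : ConfigSpace Γ n) :
    Memℓp (E := fun _ : Γ → n => ℂ) (siteFun v M f) 2 := by
  have hf : Summable fun σ : Γ → n => ‖f σ‖ ^ 2 := by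
    have := (lp.memℓp f).summable (by norm_num)
    simpa using this
  refine memℓp_gen ?_
  simp only [ENNReal.toReal_ofNat, Real.rpow_ofNat]
  rw [← (Equiv.funSplitAt v n).symm.summable_iff]
  have hρ : ∀ j : n, Summable fun ρ : {w // w ≠ v} → n =>
      ‖f ((Equiv.funSplitAt v n).symm (j, ρ))‖ ^ 2 := fun j =>
    hf.comp_injective ((Equiv.funSplitAt v n).symm.injective.comp (Prod.mk_right_injective j))
  refine (summable_prod_of_nonneg (fun _ => sq_nonneg _)).2 ⟨fun i => ?_, Summable.of_finite⟩
  have hs : Summable fun ρ : {w // w ≠ v} → n =>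
      (∑ j, ‖M i j‖ ^ 2) * ∑ j, ‖f ((Equiv.funSplitAt v n).symm (j, ρ))‖ ^ 2 :=
    (summable_sum fun j _ => hρ j).mul_left _
  refine hs.of_nonneg_of_le (fun _ => sq_nonneg _) fun ρ => ?_
  change ‖siteFun v M f ((Equiv.funSplitAt v n).symm (i, ρ))‖ ^ 2 ≤ _
  rw [siteFun_split]
  calc ‖∑ j, M i j * f ((Equiv.funSplitAt v n).symm (j, ρ))‖ ^ 2
      ≤ (∑ j, ‖M i j‖ * ‖f ((Equiv.funSplitAt v n).symm (j, ρ))‖) ^ 2 := by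
        gcongr
        exact (norm_sum_le _ _).trans_eq (by simp)
    _ ≤ _ := Finset.sum_mul_sq_le_sq_mul_sq _ _ _

/-- The linear map `siteFun v M` on `ℓ²(Γ → n)`. -/
noncomputable def siteLin (v : Γ) (M : Matrix n n ℂ) : ConfigSpace Γ n →ₗ[ℂ] ConfigSpace Γ n where
  toFun f := ⟨siteFun v M f, memℓp_siteFun v M f⟩
  map_add' f g := by
    ext σ
    change siteFun v M (⇑f + ⇑g) σ = siteFun v M f σ + siteFun v M g σ
    simp [siteFun, mul_add, Finset.sum_add_distrib]
  map_smul' c f := by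
    ext σ
    change siteFun v M (c • ⇑f) σ = c * siteFun v M f σ
    simp [siteFun, Finset.mul_sum, mul_left_comm]

theorem siteLin_apply (v : Γ) (M : Matrix n n ℂ) (f : ConfigSpace Γ n) (σ : Γ → n) :
    siteLin v M f σ = siteFun v M f σ := rfl

theorem continuous_coord {Γ n : Type*} (σ : Γ → n) : Continuous fun f : ConfigSpace Γ n => f σ :=
  (lp.evalCLM ℂ (fun _ : Γ → n => ℂ) 2 σ).continuous

/-- The bounded operator `siteFun v M` on `ℓ²(Γ → n)`. -/
noncomputable def siteOp (v : Γ) (M : Matrix n n ℂ) : ConfigSpace Γ n →L[ℂ] ConfigSpace Γ n where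
  toLinearMap := siteLin v M
  cont := by
    refine (siteLin v M).continuous_of_seq_closed_graph fun u x y hu hTu => ?_
    ext σ
    have h1 := ((continuous_coord σ).tendsto y).comp hTu
    have h2 : Continuous fun f : ConfigSpace Γ n => siteLin v M f σ := by
      simp only [siteLin_apply, siteFun]
      exact continuous_finsetSum _ fun j _ => continuous_const.mul (continuous_coord _)
    exact tendsto_nhds_unique h1 ((h2.tendsto x).comp hu)

theorem siteOp_apply (v : Γ) (M : Matrix n n ℂ) (f : ConfigSpace Γ n) (σ : Γ → n) :
    siteOp v M f σ = siteFun v M f σ := rfl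

open Classical in
theorem inner_siteOp (v : Γ) (M : Matrix n n ℂ) (f g : ConfigSpace Γ n) :
    inner ℂ (siteOp v (star M) f) g = inner ℂ f (siteOp v M g) := by
  rw [lp.inner_eq_tsum, lp.inner_eq_tsum]
  have h1 := lp.summable_inner (𝕜 := ℂ) (siteOp v (star M) f) g
  have h2 := lp.summable_inner (𝕜 := ℂ) f (siteOp v M g)
  let e : ({w // w ≠ v} → n) × n ≃ (Γ → n) := (Equiv.prodComm _ _).trans (Equiv.funSplitAt v n).symm
  rw [← e.tsum_eq, ← e.tsum_eq (fun σ => inner ℂ (f σ) (siteOp v M g σ))]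
  refine (e.summable_iff.2 h1).tsum_prod.trans (Eq.trans ?_ (e.summable_iff.2 h2).tsum_prod.symm)
  refine tsum_congr fun ρ => ?_
  simp only [tsum_fintype, siteOp_apply, Function.comp]
  have he : ∀ i, e (ρ, i) = (Equiv.funSplitAt v n).symm (i, ρ) := fun _ => rfl
  simp only [he, siteFun_split, RCLike.inner_apply, map_sum, map_mul, Finset.mul_sum,
    Finset.sum_mul]
  rw [Finset.sum_comm]
  refine Finset.sum_congr rfl fun i _ => Finset.sum_congr rfl fun j _ => ?_
  simp [Matrix.star_apply]
  ring

/-- The representation of `M_n(ℂ)` at the site `v`. -/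
noncomputable def siteMatrix [DecidableEq n] (v : Γ) :
    Matrix n n ℂ →⋆ₐ[ℂ] (ConfigSpace Γ n →L[ℂ] ConfigSpace Γ n) where
  toFun := siteOp v
  map_one' := by
    ext f σ
    simp [siteOp_apply, siteFun, Matrix.one_apply]
  map_mul' M N := by
    ext f σ
    change siteFun v (M * N) f σ = siteFun v M (siteFun v N f) σ
    simp only [siteFun, Matrix.mul_apply, Finset.sum_mul, Finset.mul_sum, Function.update_self, Function.update_idem]
    rw [Finset.sum_comm]
    simp only [mul_assoc]
  map_zero' := by
    ext f σ
    simp [siteOp_apply, siteFun]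
  map_add' M N := by
    ext f σ
    simp [siteOp_apply, siteFun, add_mul, Finset.sum_add_distrib]
  commutes' c := by
    ext f σ
    simp [siteOp_apply, siteFun, Matrix.one_apply, Algebra.algebraMap_eq_smul_one]
  map_star' M := by
    rw [ContinuousLinearMap.star_eq_adjoint, ContinuousLinearMap.eq_adjoint_iff]
    exact inner_siteOp v M

theorem siteMatrix_commute [DecidableEq n] {v w : Γ} (h : v ≠ w) (M N : Matrix n n ℂ) :
    Commute (siteMatrix v M) (siteMatrix w N) := by
  classical
  ext f σ
  change siteFun v M (siteFun w N f) σ = siteFun w N (siteFun v M f) σ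
  simp only [siteFun, Finset.mul_sum, Function.update_of_ne h, Function.update_of_ne h.symm]
  rw [Finset.sum_comm]
  refine Finset.sum_congr rfl fun i _ => Finset.sum_congr rfl fun j _ => ?_
  rw [Function.update_comm h.symm]
  ring

variable (Γ : Type*) (H : Type*) [NormedAddCommGroup H] [InnerProductSpace ℂ H]
  [FiniteDimensional ℂ H]

/-- The ⋆-algebra `ℬ(H)` of operators on the finite-dimensional Hilbert space `H` (with the adjoint
as star), placed at the site `v`. -/
noncomputable def siteRep (v : Γ) : (H →ₗ[ℂ] H) →⋆ₐ[ℂ]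
    (ConfigSpace Γ (Fin (Module.finrank ℂ H)) →L[ℂ] ConfigSpace Γ (Fin (Module.finrank ℂ H))) :=
  (siteMatrix v).comp
    (LinearMap.toMatrixOrthonormal (stdOrthonormalBasis ℂ H) : (H →ₗ[ℂ] H) →⋆ₐ[ℂ] _)

/-- The quasi-local algebra `𝔄_Γ(H) = ⨂_{v ∈ Γ} ℬ(H)`: the norm closure of the local algebra, which
is generated by the operators at the single sites. -/
noncomputable def quasiLocalSubalgebra : StarSubalgebra ℂ
    (ConfigSpace Γ (Fin (Module.finrank ℂ H)) →L[ℂ] ConfigSpace Γ (Fin (Module.finrank ℂ H))) :=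
  (StarAlgebra.adjoin ℂ (⋃ v : Γ, Set.range (siteRep Γ H v))).topologicalClosure

/-- The quasi-local algebra as a type. -/
def QuasiLocalAlgebra : Type _ := quasiLocalSubalgebra Γ H

noncomputable instance : CStarAlgebra (QuasiLocalAlgebra Γ H) :=
  StarSubalgebra.cstarAlgebra (quasiLocalSubalgebra Γ H)
    (h_closed := StarSubalgebra.isClosed_topologicalClosure _)

variable {Γ H} in
/-- The copy of `B ∈ ℬ(H)` at the site `v`, as an element of `𝔄_Γ(H)`. -/
noncomputable def siteElement (v : Γ) (B : H →ₗ[ℂ] H) : QuasiLocalAlgebra Γ H :=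
  ⟨siteRep Γ H v B, StarSubalgebra.le_topologicalClosure _
    (StarAlgebra.subset_adjoin ℂ _ (Set.mem_iUnion.2 ⟨v, B, rfl⟩))⟩

/-- The space `𝒫_Γ(H)` of pure states of the quasi-local algebra. -/
abbrev LatticePureStates : Type _ := PureStateSpace (QuasiLocalAlgebra Γ H)

/-- For an isometry `f : H → K`, the state `ω'` on `𝔄_Γ(K)` is `𝒫_Γ(f)(ω) = ω ∘ 𝔄_Γ(f)`, where
`𝔄_Γ(f)` sends `⨂_{v ∈ Λ} B_v` to `⨂_{v ∈ Λ} f⋆ B_v f` for all finite `Λ ⊆ Γ`. The finite sets `Λ`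
are given by lists without repetition; since the sites commute, the order is irrelevant, and since
the elementary tensors span a dense subspace, `ω'` is determined by this. -/
def IsPushforwardState {Γ : Type*} {H K : Type*} [NormedAddCommGroup H] [InnerProductSpace ℂ H]
    [FiniteDimensional ℂ H] [NormedAddCommGroup K] [InnerProductSpace ℂ K]
    [FiniteDimensional ℂ K] (f : H →ₗᵢ[ℂ] K) (ω : LatticePureStates Γ H)
    (ω' : LatticePureStates Γ K) : Prop :=
  ∀ (Λ : List Γ), Λ.Nodup → ∀ B : Γ → (K →ₗ[ℂ] K),
    ω'.1.1 ((Λ.map fun v => siteElement v (B v)).prod) =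
      ω.1.1 ((Λ.map fun v => siteElement v
        (LinearMap.adjoint f.toLinearMap ∘ₗ B v ∘ₗ f.toLinearMap)).prod)

end QuasiLocal

/-! ### Tensor powers and the stable space `𝒫_Γ(H^{⊗∞})` -/

section Stable

universe u

/-- A finite-dimensional complex Hilbert space. -/
structure FinHilb : Type (u + 1) where
  carrier : Type u
  [normedAddCommGroup : NormedAddCommGroup carrier]
  [innerProductSpace : InnerProductSpace ℂ carrier]
  [finiteDimensional : FiniteDimensional ℂ carrier]

attribute [instance] FinHilb.normedAddCommGroup FinHilb.innerProductSpace
  FinHilb.finiteDimensional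

variable (H : Type u) [NormedAddCommGroup H] [InnerProductSpace ℂ H] [FiniteDimensional ℂ H]

/-- The tensor power `H^{⊗i}`, with `H^{⊗0} = ℂ` and `H^{⊗(i+1)} = H^{⊗i} ⊗ H`. -/
noncomputable def tensorPower : ℕ → FinHilb.{u}
  | 0 => ⟨EuclideanSpace ℂ PUnit.{u + 1}⟩
  | i + 1 => ⟨(tensorPower i).carrier ⊗[ℂ] H⟩

variable {H} in
/-- The isometry `x ↦ x ⊗ u` from `H^{⊗i}` to `H^{⊗(i+1)}`. -/
noncomputable def tensorRight (u : H) (hu : ‖u‖ = 1) (i : ℕ) :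
    (tensorPower H i).carrier →ₗᵢ[ℂ] (tensorPower H (i + 1)).carrier where
  toLinearMap := ((TensorProduct.mk ℂ (tensorPower H i).carrier H).flip u :
    (tensorPower H i).carrier →ₗ[ℂ] (tensorPower H i).carrier ⊗[ℂ] H)
  norm_map' x := by
    change ‖x ⊗ₜ[ℂ] u‖ = ‖x‖
    rw [TensorProduct.norm_tmul, hu, mul_one]

/-- One step of the identifications in a sequential colimit. -/
inductive SeqColimitRel {X : ℕ → Type*} (f : ∀ i, X i → X (i + 1)) :
    (Σ i, X i) → (Σ i, X i) → Prop
  | step (i : ℕ) (x : X i) : SeqColimitRel f ⟨i, x⟩ ⟨i + 1, f i x⟩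

/-- The colimit of a sequence of topological spaces `X 0 → X 1 → ⋯`, with the quotient topology of
the disjoint union. -/
def SeqColimit {X : ℕ → Type*} (f : ∀ i, X i → X (i + 1)) : Type _ := Quot (SeqColimitRel f)

instance {X : ℕ → Type*} [∀ i, TopologicalSpace (X i)] (f : ∀ i, X i → X (i + 1)) :
    TopologicalSpace (SeqColimit f) :=
  inferInstanceAs (TopologicalSpace (Quot (SeqColimitRel f)))

end Stable

/-! Let `P n` project onto `e₁` in the first `n` tensor factors. For an elementary tensor `d` and
large `n`, `P n * d * P n` is a multiple of `P n`, so only one state, the product state `ω₀`, has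
the value one on all `P n`, and it is pure. To contract a loop `ω` of states at `ω₀` it suffices to
find algebra elements `a (t, s)`, continuous in both variables and outside the Gelfand ideal `N` of
`ω t`, that fix `ω₀` and carry `ω t` into the support of `P n` for ever larger `n` as `s → 1`. Near
`s = 1` the value of the state on each elementary tensor is then constant, which is weak-*
continuity.

The step from `n` to `n + 1` multiplies the current element `W t` on the left by `P (n + 1) + ∑ c j
• z j`, where the `z j` move the other basis vectors of the new factor to `e₁`. As `N` is a left
ideal, the bad parameters `c` at a given `t` form a proper complex affine subspace, whose complement
is path connected; such open conditions over an interval have continuous sections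
(`exists_continuous_section`). The segment from the old to the new element also avoids `N`
(`exists_step`). Since `a · ω` is pure whenever `ω` is (`IsPureState.actOnState`), the same homotopy
contracts loops of pure states, and constant paths give path connectedness.

A UHF algebra factorizes because a matrix algebra is generated by a matrix subalgebra and its
commutant, which is again a matrix algebra.

For the stable space, an isometry `f : H → K` induces a closed embedding of pure state spaces
(`Transfer.exists_isClosedEmbedding`): pushforward and pullback of states are both built from
positive functionals on algebraic tensor products, plus compactness, and are mutually inverse
between the pure states over `H` and those over `K` supported on `f f⋆` at every site. Loops in a
sequential colimit of closed embeddings of T1 spaces have compact image, hence lie in one stage,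
where they contract. -/

/-! ### Positive functionals -/

section PositiveFunctionals

variable {A : Type*} [CStarAlgebra A]

attribute [local instance] CStarAlgebra.spectralOrder CStarAlgebra.spectralOrderedRing

/-- A positive functional as a positive linear map for the spectral order. -/
noncomputable def IsPositiveFunctional.toPositiveLinearMap {φ : WeakDual ℂ A}
    (hφ : IsPositiveFunctional φ) : A →ₚ[ℂ] ℂ :=
  PositiveLinearMap.mk₀ (WeakDual.toStrongDual φ).toLinearMap fun a ha => by
    obtain ⟨b, rfl⟩ := CStarAlgebra.nonneg_iff_eq_star_mul_self.1 ha
    exact hφ b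

theorem IsPositiveFunctional.map_star {φ : WeakDual ℂ A} (hφ : IsPositiveFunctional φ) (a : A) :
    φ (star a) = star (φ a) :=
  StarHomClass.map_star hφ.toPositiveLinearMap a

theorem IsPositiveFunctional.cauchy_schwarz {φ : WeakDual ℂ A} (hφ : IsPositiveFunctional φ)
    (a b : A) : ‖φ (star a * b)‖ ^ 2 ≤ (φ (star a * a)).re * (φ (star b * b)).re := by
  let f := hφ.toPositiveLinearMap
  have h := norm_inner_le_norm (𝕜 := ℂ) (f.toPreGNS a) (f.toPreGNS b)
  rw [PositiveLinearMap.preGNS_inner_def, PositiveLinearMap.preGNS_norm_def,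
    PositiveLinearMap.preGNS_norm_def] at h
  replace h := h.trans_eq (Real.sqrt_mul (hφ a).1 _).symm
  exact (Real.le_sqrt (norm_nonneg _) (mul_nonneg (hφ a).1 (hφ b).1)).1 h

theorem IsPositiveFunctional.map_one_nonneg {φ : WeakDual ℂ A} (hφ : IsPositiveFunctional φ) :
    0 ≤ φ 1 := by
  simpa using hφ 1

theorem IsPositiveFunctional.conj_le {φ : WeakDual ℂ A} (hφ : IsPositiveFunctional φ)
    (a b : A) : φ (star (a * b) * (a * b)) ≤ ((‖a‖ ^ 2 : ℝ) : ℂ) * φ (star b * b) := by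
  let f := hφ.toPositiveLinearMap
  have h1 : star b * (star a * a) * b ≤ ‖star a * a‖ • (star b * b) :=
    CStarAlgebra.star_left_conjugate_le_norm_smul
  have h2 : f (star b * (star a * a) * b) ≤ f (‖star a * a‖ • (star b * b)) :=
    OrderHomClass.mono f h1
  rw [PositiveLinearMap.map_smul_of_tower, CStarRing.norm_star_mul_self, ← sq,
    Complex.real_smul] at h2
  rw [star_mul, show star b * star a * (a * b) = star b * (star a * a) * b by
    simp only [mul_assoc]]
  exact h2

/-- Cauchy–Schwarz against the unit, together with `a⋆ a ≤ ‖a‖²`. -/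
theorem IsPositiveFunctional.norm_le {φ : WeakDual ℂ A} (hφ : IsPositiveFunctional φ) (a : A) :
    ‖φ a‖ ≤ ‖a‖ * (φ 1).re := by
  have h := hφ.cauchy_schwarz 1 a
  have h2 := hφ.conj_le a 1
  simp only [star_one, one_mul, mul_one] at h h2
  have h3 := (Complex.le_def.1 h2).1
  rw [Complex.re_ofReal_mul] at h3
  have h1 : 0 ≤ (φ 1).re := hφ.map_one_nonneg.1
  refine abs_le_of_sq_le_sq' ?_ (by positivity) |>.2
  nlinarith [mul_le_mul_of_nonneg_left h3 h1]

theorem IsPositiveFunctional.apply_mul_eq_zero {φ : WeakDual ℂ A} (hφ : IsPositiveFunctional φ)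
    (a : A) {b : A} (hb : φ (star b * b) = 0) : φ (a * b) = 0 := by
  have h := hφ.cauchy_schwarz (star a) b
  rw [star_star, hb, Complex.zero_re, mul_zero] at h
  exact norm_eq_zero.1 (pow_eq_zero_iff two_ne_zero |>.1 (le_antisymm h (sq_nonneg _)))

theorem IsPositiveFunctional.apply_star_mul_eq_zero {φ : WeakDual ℂ A}
    (hφ : IsPositiveFunctional φ) (a : A) {b : A} (hb : φ (star b * b) = 0) :
    φ (star b * a) = 0 := by
  have h := hφ.map_star (star a * b)
  rwa [hφ.apply_mul_eq_zero _ hb, star_zero, star_mul, star_star] at h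

/-- If all the mass of `φ` sits on `p`, then `1 - p` is a null vector, so `p` may be inserted or
removed on either side of an argument. All later uses of supports rest on this. -/
theorem IsPositiveFunctional.compl_null {φ : WeakDual ℂ A} {p : A}
    (hp : IsStarProjection p) (h : φ p = φ 1) : φ (star (1 - p) * (1 - p)) = 0 := by
  rw [hp.one_sub.isSelfAdjoint.star_eq, hp.one_sub.isIdempotentElem.eq, map_sub, h, sub_self]

theorem IsPositiveFunctional.apply_mul_proj {φ : WeakDual ℂ A} (hφ : IsPositiveFunctional φ)
    {p : A} (hp : IsStarProjection p) (h : φ p = φ 1) (a : A) : φ (a * p) = φ a := by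
  have := hφ.apply_mul_eq_zero a (IsPositiveFunctional.compl_null hp h)
  rw [mul_sub, mul_one, map_sub, sub_eq_zero] at this
  exact this.symm

theorem IsPositiveFunctional.apply_proj_mul {φ : WeakDual ℂ A} (hφ : IsPositiveFunctional φ)
    {p : A} (hp : IsStarProjection p) (h : φ p = φ 1) (a : A) : φ (p * a) = φ a := by
  have := hφ.apply_star_mul_eq_zero a (IsPositiveFunctional.compl_null hp h)
  rw [hp.one_sub.isSelfAdjoint.star_eq, sub_mul, one_mul, map_sub, sub_eq_zero] at this
  exact this.symm

theorem IsPositiveFunctional.eq_zero {φ : WeakDual ℂ A} (hφ : IsPositiveFunctional φ)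
    (h : φ 1 = 0) : φ = 0 := by
  refine DFunLike.ext _ _ fun a => ?_
  have := hφ.norm_le a
  rw [h, Complex.zero_re, mul_zero] at this
  exact norm_le_zero_iff.1 this

/-- A norm-one functional that is one at the unit is positive. -/
theorem isPositiveFunctional_of_norm_le {φ : WeakDual ℂ A}
    (hφ : ∀ a, ‖φ a‖ ≤ ‖a‖) (h1 : φ 1 = 1) : IsPositiveFunctional φ := by
  intro a
  set b := star a * a with hb
  have hsa : IsSelfAdjoint b := .star_mul_self a
  have him : (φ b).im = 0 := by
    by_contra hne
    -- Shifting `b` by `i l` moves the imaginary part by `l` but raises the squared norm only by `l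
    -- ^ 2`; this fails for large `l` of the right sign if the imaginary part of `φ b` is not zero.
    have key : ∀ l : ℝ, ((φ b).im + l) ^ 2 ≤ ‖b‖ ^ 2 + l ^ 2 := by
      intro l
      have h2 : φ (b + (Complex.I * l) • (1 : A)) = φ b + Complex.I * l := by
        rw [map_add, map_smul, h1, smul_eq_mul, mul_one]
      have h3 : ‖b + (Complex.I * l) • (1 : A)‖ ^ 2 ≤ ‖b‖ ^ 2 + l ^ 2 := by
        rw [sq, ← CStarRing.norm_star_mul_self, star_add, star_smul, star_one, hsa.star_eq]
        have : (b + star (Complex.I * (l : ℂ)) • (1 : A)) * (b + (Complex.I * l) • 1)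
            = b * b + ((l ^ 2 : ℝ) : ℂ) • (1 : A) := by
          simp only [add_mul, mul_add, smul_mul_assoc, one_mul, mul_smul_comm, mul_one]
          have e1 : star (Complex.I * (l : ℂ)) = -(Complex.I * l) := by simp
          have e2 : Complex.I * (l : ℂ) * (-(Complex.I * l)) = ((l ^ 2 : ℝ) : ℂ) := by
            push_cast
            linear_combination (-(l : ℂ) ^ 2) * Complex.I_sq
          rw [e1, smul_add, smul_smul, e2, neg_smul]
          abel
        rw [this]
        refine (norm_add_le _ _).trans (add_le_add ((norm_mul_le _ _).trans_eq (sq _).symm) ?_)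
        rcases subsingleton_or_nontrivial A with _ | _
        · rw [Subsingleton.elim (((l ^ 2 : ℝ) : ℂ) • (1 : A)) 0, norm_zero]; positivity
        · rw [norm_smul, CStarRing.norm_one, mul_one, Complex.norm_real, Real.norm_eq_abs,
            abs_of_nonneg (sq_nonneg l)]
      have h4 := hφ (b + (Complex.I * l) • (1 : A))
      rw [h2] at h4
      have h5 : |(φ b + Complex.I * l).im| ≤ _ := (Complex.abs_im_le_norm _).trans h4
      have h6 : (φ b + Complex.I * l).im = (φ b).im + l := by simp
      rw [h6] at h5
      calc _ = |(φ b).im + l| ^ 2 := (sq_abs _).symm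
        _ ≤ _ := pow_le_pow_left₀ (abs_nonneg _) h5 2
        _ ≤ _ := h3
    -- With this `l` the cross term is `2 ‖b‖ ^ 2`, which exceeds the available `‖b‖ ^ 2`.
    have := key (‖b‖ ^ 2 / (φ b).im)
    have e : (φ b).im * (‖b‖ ^ 2 / (φ b).im) = ‖b‖ ^ 2 := by field_simp
    have hpos : 0 < (φ b).im ^ 2 := by positivity
    nlinarith [sq_nonneg ‖b‖]
  have hb0 : 0 ≤ b := star_mul_self_nonneg a
  have hre : 0 ≤ (φ b).re := by
    -- As `0 ≤ b ≤ ‖b‖`, the element `‖b‖ - b` has norm at most `‖b‖`, so `φ b` lies within `‖b‖` of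
    -- `‖b‖`.
    have h2 : ‖((‖b‖ : ℝ) : ℂ) • (1 : A) - b‖ ≤ ‖b‖ := by
      have hle : b ≤ ((‖b‖ : ℝ) : ℂ) • (1 : A) := by
        simpa [Algebra.algebraMap_eq_smul_one] using hsa.le_algebraMap_norm_self
      refine CStarAlgebra.norm_le_iff_le_algebraMap _ (norm_nonneg _) (sub_nonneg.2 hle) |>.2 ?_
      rw [Algebra.algebraMap_eq_smul_one]
      exact sub_le_self _ hb0
    have h3 := (hφ _).trans h2
    rw [map_sub, map_smul, h1, smul_eq_mul, mul_one] at h3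
    have h4 := (Complex.abs_re_le_norm _).trans h3
    have h5 := (abs_le.1 h4).2
    simp at h5
    exact h5
  exact Complex.nonneg_iff.2 ⟨hre, him.symm⟩

end PositiveFunctionals

/-! ### The state space -/

section StateSpaceTopology

variable {A : Type*} [CStarAlgebra A]

theorem StateSpace.norm_apply_le (ω : StateSpace A) (a : A) : ‖ω.1 a‖ ≤ ‖a‖ := by
  simpa [ω.2.2] using ω.2.1.norm_le a

/-- Evaluation is jointly continuous for the weak-* topology on states and the norm topology. -/
theorem StateSpace.continuous_eval : Continuous fun x : StateSpace A × A => x.1.1 x.2 := by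
  rw [continuous_iff_continuousAt]
  rintro ⟨ω, a⟩
  have h1 : Filter.Tendsto (fun x : StateSpace A × A => x.1.1 (x.2 - a)) (nhds (ω, a)) (nhds 0) := by
    refine squeeze_zero_norm (a := fun x => ‖x.2 - a‖) (fun x => x.1.norm_apply_le _) ?_
    have : Continuous fun x : StateSpace A × A => ‖x.2 - a‖ := by fun_prop
    simpa using this.tendsto (ω, a)
  have h2 : Continuous fun x : StateSpace A × A => x.1.1 a :=
    (WeakDual.eval_continuous a).comp (continuous_subtype_val.comp continuous_fst)
  have := h1.add (h2.tendsto (ω, a))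
  simpa [ContinuousAt] using this

theorem StateSpace.continuous_apply {X : Type*} [TopologicalSpace X] {f : X → StateSpace A}
    {g : X → A} (hf : Continuous f) (hg : Continuous g) : Continuous fun x => (f x).1 (g x) :=
  StateSpace.continuous_eval.comp (hf.prodMk hg)

theorem weakDual_ext_of_dense_span {D : Set A} (hD : Dense (Submodule.span ℂ D : Set A))
    {φ ψ : WeakDual ℂ A} (h : ∀ d ∈ D, φ d = ψ d) : φ = ψ := by
  have h1 : Set.EqOn (WeakDual.toStrongDual φ) (WeakDual.toStrongDual ψ)
      (Submodule.span ℂ D : Set A) := fun x hx =>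
    LinearMap.eqOn_span (f := (WeakDual.toStrongDual φ).toLinearMap)
      (g := (WeakDual.toStrongDual ψ).toLinearMap) h hx
  have h2 := Continuous.ext_on hD (WeakDual.toStrongDual φ).continuous
    (WeakDual.toStrongDual ψ).continuous h1
  exact DFunLike.ext _ _ fun a => congrFun h2 a

/-- A map to the state space is continuous at a point if it is so after evaluation at the elements
of a set with dense span. -/
theorem StateSpace.tendsto_of_dense_span {X : Type*} {l : Filter X} {f : X → StateSpace A}
    {ω : StateSpace A} {D : Set A} (hD : Dense (Submodule.span ℂ D : Set A))
    (h : ∀ d ∈ D, Filter.Tendsto (fun x => (f x).1 d) l (nhds (ω.1 d))) :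
    Filter.Tendsto f l (nhds ω) := by
  rw [tendsto_subtype_rng, tendsto_iff_forall_eval_tendsto_topDualPairing]
  intro a
  change Filter.Tendsto (fun x => (f x).1 a) l (nhds (ω.1 a))
  have hs : ∀ d ∈ Submodule.span ℂ D, Filter.Tendsto (fun x => (f x).1 d) l (nhds (ω.1 d)) := by
    intro d hd
    induction hd using Submodule.span_induction with
    | mem d hd => exact h d hd
    | zero => simpa using tendsto_const_nhds
    | add x y _ _ hx hy => simpa using hx.add hy
    | smul c x _ hx => simpa using hx.const_mul c
  -- States are contractions, so approximating `a` by `d` costs at most `‖a - d‖` at every `x`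
  -- simultaneously: an `ε / 3` argument.
  rw [Metric.tendsto_nhds]
  intro ε hε
  obtain ⟨d, hd, hda⟩ := Metric.dense_iff.1 hD a (ε / 3) (by positivity)
  have h1 := Metric.tendsto_nhds.1 (hs d hda) (ε / 3) (by positivity)
  filter_upwards [h1] with x hx
  rw [Metric.mem_ball, dist_comm, dist_eq_norm] at hd
  have e1 : dist ((f x).1 a) ((f x).1 d) ≤ ‖a - d‖ := by
    rw [dist_eq_norm, ← map_sub]; exact (f x).norm_apply_le _
  have e2 : dist (ω.1 d) (ω.1 a) ≤ ‖a - d‖ := by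
    rw [dist_comm, dist_eq_norm, ← map_sub]; exact ω.norm_apply_le _
  have := dist_triangle4 ((f x).1 a) ((f x).1 d) (ω.1 d) (ω.1 a)
  linarith

theorem StateSpace.continuous_of_dense_span {X : Type*} [TopologicalSpace X] {f : X → StateSpace A}
    {D : Set A} (hD : Dense (Submodule.span ℂ D : Set A))
    (h : ∀ d ∈ D, Continuous fun x => (f x).1 d) : Continuous f :=
  continuous_iff_continuousAt.2 fun x =>
    StateSpace.tendsto_of_dense_span hD fun d hd => (h d hd).tendsto x

theorem StateSpace.isClosed_range :
    IsClosed {φ : WeakDual ℂ A | IsPositiveFunctional φ ∧ φ 1 = 1} := by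
  have h1 : IsClosed {φ : WeakDual ℂ A | IsPositiveFunctional φ} := by
    have : {φ : WeakDual ℂ A | IsPositiveFunctional φ} =
        ⋂ a : A, {φ : WeakDual ℂ A | 0 ≤ φ (star a * a)} := by
      ext φ; simp [IsPositiveFunctional]
    rw [this]
    exact isClosed_iInter fun a => isClosed_le continuous_const (WeakDual.eval_continuous _)
  exact h1.inter (isClosed_eq (WeakDual.eval_continuous _) continuous_const)

instance StateSpace.compactSpace : CompactSpace (StateSpace A) := by
  refine isCompact_iff_compactSpace.1 ?_
  refine (WeakDual.isCompact_closedBall (𝕜 := ℂ) (0 : StrongDual ℂ A) 1).of_isClosed_subset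
    StateSpace.isClosed_range fun φ hφ => ?_
  rw [Set.mem_preimage, mem_closedBall_zero_iff]
  refine ContinuousLinearMap.opNorm_le_bound _ zero_le_one fun a => ?_
  rw [one_mul]
  exact StateSpace.norm_apply_le ⟨φ, hφ⟩ a

/-- Every nonzero projection has value one in some state. -/
theorem StateSpace.exists_apply_eq_one {p : A} (hp : IsStarProjection p) (h0 : p ≠ 0) :
    ∃ ω : StateSpace A, ω.1 p = 1 := by
  have hn : ‖p‖ = 1 := by
    have h := CStarRing.norm_star_mul_self (x := p)
    rw [hp.isSelfAdjoint.star_eq, hp.isIdempotentElem.eq] at h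
    have := norm_ne_zero_iff.2 h0
    field_simp at h
    exact h.symm
  -- A norming functional of `p` turns out to be a state; only `f 1 = 1` is in question.
  obtain ⟨f, hf1, hf2⟩ := exists_dual_vector ℂ p (norm_ne_zero_iff.2 h0)
  rw [hn, RCLike.ofReal_one] at hf2
  have hle : ∀ a, ‖f a‖ ≤ ‖a‖ := fun a => by simpa [hf1] using f.le_opNorm a
  -- For a phase `u` the element `p + u (1 - p)` is an isometry, of norm at most one. Choosing `u`
  -- with `u f (1 - p) = |f (1 - p)|` gives `1 + |f (1 - p)| ≤ 1`.
  have hcompl : f (1 - p) = 0 := by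
    by_contra hne
    set z := f (1 - p) with hz
    set u : ℂ := star z / ‖z‖ with hu
    have hzn : (‖z‖ : ℂ) ≠ 0 := by simpa using hne
    have huz : u * z = ‖z‖ := by
      rw [hu, div_mul_eq_mul_div, div_eq_iff hzn, ← sq]
      exact Complex.conj_mul' z
    have hun : star u * u = 1 := by
      have : ‖u‖ = 1 := by
        rw [hu, norm_div, norm_star, Complex.norm_real, norm_norm]
        exact div_self (norm_ne_zero_iff.2 hne)
      have h2 := Complex.conj_mul' u
      rw [this] at h2
      simpa using h2
    have hnu : ‖p + u • (1 - p)‖ ≤ 1 := by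
      have e : star (p + u • (1 - p)) * (p + u • (1 - p)) = 1 := by
        rw [star_add, star_smul, hp.isSelfAdjoint.star_eq, hp.one_sub.isSelfAdjoint.star_eq]
        simp only [add_mul, mul_add, smul_mul_assoc, mul_smul_comm, smul_smul,
          hp.isIdempotentElem.eq, hp.one_sub.isIdempotentElem.eq,
          hp.isIdempotentElem.mul_one_sub_self, hp.isIdempotentElem.one_sub_mul_self, smul_zero,
          add_zero, zero_add, hun, one_smul, mul_comm u (star u)]
        abel
      have h3 := CStarRing.norm_star_mul_self (x := p + u • (1 - p))
      rw [e] at h3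
      have : Nontrivial A := ⟨p, 0, h0⟩
      rw [CStarRing.norm_one] at h3
      nlinarith [norm_nonneg (p + u • (1 - p))]
    have h4 := (hle (p + u • (1 - p))).trans hnu
    rw [map_add, map_smul, smul_eq_mul, hf2, ← hz, huz] at h4
    have h5 : ‖(1 : ℂ) + ‖z‖‖ = 1 + ‖z‖ := by
      rw [← Complex.ofReal_one, ← Complex.ofReal_add, Complex.norm_real, Real.norm_eq_abs,
        abs_of_nonneg (by positivity)]
    rw [h5] at h4
    exact hne (norm_le_zero_iff.1 (by linarith))
  have hone : f 1 = 1 := by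
    rw [map_sub, sub_eq_zero, hf2] at hcompl
    exact hcompl
  exact ⟨⟨StrongDual.toWeakDual f, isPositiveFunctional_of_norm_le hle hone, hone⟩, hf2⟩

end StateSpaceTopology

/-! ### Purity of the states `a · ω` -/

section Purity

variable {A : Type*} [CStarAlgebra A]

attribute [local instance] CStarAlgebra.spectralOrder CStarAlgebra.spectralOrderedRing

open UniformSpace

/-- The class of `b` in the GNS space. -/
noncomputable def gnsClass (f : A →ₚ[ℂ] ℂ) : A →ₗ[ℂ] f.GNS :=
  (Completion.toComplL : f.PreGNS →L[ℂ] f.GNS).toLinearMap ∘ₗ f.toPreGNS.toLinearMap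

theorem inner_gnsClass (f : A →ₚ[ℂ] ℂ) (a b : A) :
    inner ℂ (gnsClass f a) (gnsClass f b) = f (star a * b) :=
  Completion.inner_coe _ _

theorem gnsStarAlgHom_gnsClass (f : A →ₚ[ℂ] ℂ) (a b : A) :
    f.gnsStarAlgHom a (gnsClass f b) = gnsClass f (a * b) :=
  f.gnsNonUnitalStarAlgHom_apply_coe

theorem inner_gnsStarAlgHom_left (f : A →ₚ[ℂ] ℂ) (a : A) (x y : f.GNS) :
    inner ℂ (f.gnsStarAlgHom a x) y = inner ℂ x (f.gnsStarAlgHom (star a) y) := by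
  rw [map_star, ContinuousLinearMap.star_eq_adjoint, ContinuousLinearMap.adjoint_inner_right]

/-- If `g ≤ f(a⋆ · a)`, then some contraction of the GNS spaces intertwines the representations and
takes the class of `b a` to the class of `b`. -/
theorem exists_gns_intertwiner (f g : A →ₚ[ℂ] ℂ) (a : A)
    (h : ∀ b : A, g (star b * b) ≤ f (star (b * a) * (b * a))) :
    ∃ T : f.GNS →L[ℂ] g.GNS, (∀ x, ‖T x‖ ≤ ‖x‖) ∧ (∀ b, T (gnsClass f (b * a)) = gnsClass g b) ∧
      ∀ b x, T (f.gnsStarAlgHom b x) = g.gnsStarAlgHom b (T x) := by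
  let e : A →ₗ[ℂ] f.GNS := gnsClass f ∘ₗ LinearMap.mulRight ℂ a
  have he : ∀ b, e b = gnsClass f (b * a) := fun b => rfl
  -- `K` is the closed invariant subspace of the classes of `b a`. The hypothesis makes `[b a] ↦
  -- [b]` a well-defined contraction on it, and `T` is this map after the orthogonal projection,
  -- which intertwines because `Kᗮ` is invariant too.
  let K : Submodule ℂ f.GNS := (LinearMap.range e).topologicalClosure
  have hK : IsClosed (K : Set f.GNS) := Submodule.isClosed_topologicalClosure _
  have : CompleteSpace K := hK.completeSpace_coe
  have heK : ∀ b, e b ∈ K := fun b => Submodule.le_topologicalClosure _ ⟨b, rfl⟩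
  let e' : A →ₗ[ℂ] K := e.codRestrict K heK
  have hdense : DenseRange e' := by
    intro k
    rw [closure_subtype]
    have hk : (k : f.GNS) ∈ closure (Set.range e) := k.2
    convert! hk using 2
    ext y
    constructor
    · rintro ⟨_, ⟨b, rfl⟩, rfl⟩; exact ⟨b, rfl⟩
    · rintro ⟨b, rfl⟩; exact ⟨e' b, ⟨b, rfl⟩, rfl⟩
  have hnorm : ∀ b, ‖gnsClass g b‖ ≤ 1 * ‖e' b‖ := by
    intro b
    rw [one_mul]
    change _ ≤ ‖e b‖
    rw [he, ← sq_le_sq₀ (norm_nonneg _) (norm_nonneg _), ← Complex.real_le_real]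
    have h1 := inner_self_eq_norm_sq_to_K (𝕜 := ℂ) (gnsClass g b)
    have h2 := inner_self_eq_norm_sq_to_K (𝕜 := ℂ) (gnsClass f (b * a))
    rw [inner_gnsClass] at h1 h2
    have := h b
    rw [h1, h2] at this
    simpa using this
  let S : K →L[ℂ] g.GNS := (gnsClass g).extendOfNorm e'
  have hS : ∀ b, S (e' b) = gnsClass g b := LinearMap.extendOfNorm_eq hdense ⟨1, hnorm⟩
  have hSn : ∀ k, ‖S k‖ ≤ 1 * ‖k‖ := LinearMap.norm_extendOfNorm_apply_le hdense 1 hnorm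
  have hKinv : ∀ b, ∀ k ∈ K, f.gnsStarAlgHom b k ∈ K := by
    intro b k hk
    have hk' : k ∈ closure (Set.range e) := hk
    have := map_mem_closure (f.gnsStarAlgHom b).continuous hk' (t := Set.range e) (by
      rintro _ ⟨c, rfl⟩
      refine ⟨b * c, ?_⟩
      rw [he, he, gnsStarAlgHom_gnsClass, mul_assoc])
    exact this
  refine ⟨S ∘L K.orthogonalProjectionOnto, fun x => ?_, fun b => ?_, fun b x => ?_⟩
  · refine (hSn _).trans ?_
    rw [one_mul]
    exact K.norm_orthogonalProjectionOnto_apply_le x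
  · have := K.orthogonalProjectionOnto_mem_subspace_eq_self (e' b)
    change S (K.orthogonalProjectionOnto (e' b : f.GNS)) = _
    rw [this, hS]
  · have key : ∀ k : K, S ⟨f.gnsStarAlgHom b k, hKinv b k k.2⟩ = g.gnsStarAlgHom b (S k) := by
      intro k
      induction k using hdense.induction_on with
      | hp =>
        refine isClosed_eq (S.continuous.comp ?_) (by fun_prop)
        exact Continuous.subtype_mk ((f.gnsStarAlgHom b).continuous.comp continuous_subtype_val) _
      | ih c =>
        have : (⟨f.gnsStarAlgHom b (e' c : f.GNS), hKinv b _ (e' c).2⟩ : K) = e' (b * c) := by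
          apply Subtype.ext
          change f.gnsStarAlgHom b (e c) = e (b * c)
          rw [he, he, gnsStarAlgHom_gnsClass, mul_assoc]
        rw [this, hS, hS, gnsStarAlgHom_gnsClass]
    obtain ⟨y, hy, z, hz, rfl⟩ := K.exists_add_mem_mem_orthogonal x
    have hz' : f.gnsStarAlgHom b z ∈ Kᗮ := by
      rw [Submodule.mem_orthogonal']
      intro k hk
      rw [inner_gnsStarAlgHom_left]
      exact (Submodule.mem_orthogonal' _ _).1 hz _ (hKinv _ k hk)
    have e1 := K.orthogonalProjectionOnto_mem_subspace_eq_self ⟨y, hy⟩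
    have e2 := K.orthogonalProjectionOnto_mem_subspace_eq_self ⟨_, hKinv b y hy⟩
    simp only at e1 e2
    simp only [ContinuousLinearMap.comp_apply, map_add,
      K.orthogonalProjectionOnto_apply_of_mem_orthogonal hz,
      K.orthogonalProjectionOnto_apply_of_mem_orthogonal hz', e1, e2, add_zero, map_zero]
    exact key ⟨y, hy⟩

/-- Pull `φ` back along the intertwining contraction `T`: `ψ b = ⟨T [1], T [b]⟩` is positive and
below `ω`, so purity gives `ψ = t ω`. Since `T [b a] = [b]`, evaluating `ψ` at `a⋆ b a` recovers `φ
b`. -/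
theorem IsPureState.exists_eq_smul_conj {ω : StateSpace A} (hω : IsPureState ω)
    {φ : WeakDual ℂ A} (hφ : IsPositiveFunctional φ) (a : A)
    (h : ∀ b : A, φ (star b * b) ≤ ω.1 (star (b * a) * (b * a))) :
    ∃ t : ℝ, 0 ≤ t ∧ ∀ b, φ b = t * ω.1 (star a * (b * a)) := by
  let f := ω.2.1.toPositiveLinearMap
  let g := hφ.toPositiveLinearMap
  obtain ⟨T, hT1, hT2, hT3⟩ := exists_gns_intertwiner f g a h
  let ψ : WeakDual ℂ A := StrongDual.toWeakDual
    ((innerSL ℂ (T (gnsClass f 1))) ∘L T ∘L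
      ⟨(gnsClass f), by
        have hc : Continuous f.gnsStarAlgHom := map_continuous f.gnsStarAlgHom
        have : ⇑(gnsClass f) = fun b => f.gnsStarAlgHom b (gnsClass f 1) := by
          ext b
          rw [gnsStarAlgHom_gnsClass, mul_one]
        change Continuous ⇑(gnsClass f)
        rw [this]
        fun_prop⟩)
  have hψ : ∀ b c, ψ (star b * c) = inner ℂ (T (gnsClass f b)) (T (gnsClass f c)) := by
    intro b c
    have h1 : ∀ d, T (gnsClass f d) = g.gnsStarAlgHom d (T (gnsClass f 1)) := fun d => by
      rw [← hT3, gnsStarAlgHom_gnsClass, mul_one]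
    change inner ℂ (T (gnsClass f 1)) (T (gnsClass f (star b * c))) = _
    rw [h1 b, h1 (star b * c), inner_gnsStarAlgHom_left, map_mul, h1 c]
    rfl
  have hnsq : ∀ b, ψ (star b * b) = ((‖T (gnsClass f b)‖ ^ 2 : ℝ) : ℂ) := by
    intro b
    rw [hψ, inner_self_eq_norm_sq_to_K]
    simp
  have hωsq : ∀ b, ω.1 (star b * b) = ((‖gnsClass f b‖ ^ 2 : ℝ) : ℂ) := by
    intro b
    have := inner_self_eq_norm_sq_to_K (𝕜 := ℂ) (gnsClass f b)
    rw [inner_gnsClass] at this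
    refine Eq.trans this ?_
    simp
  obtain ⟨t, ht0, -, ht⟩ := hω ψ (fun b => by
    rw [hnsq]; exact Complex.zero_le_real.2 (sq_nonneg _)) (fun b => by
    rw [hnsq, hωsq]
    exact_mod_cast pow_le_pow_left₀ (norm_nonneg _) (hT1 _) 2)
  refine ⟨t, ht0, fun b => ?_⟩
  have h1 : ψ (star (1 * a) * (b * a)) = φ b := by
    rw [hψ, hT2, hT2, inner_gnsClass, star_one, one_mul]
    rfl
  rw [← h1, ht, one_mul]
  rfl

theorem IsPureState.actOnState {ω : StateSpace A} (hω : IsPureState ω) (a : A)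
    (ha : a ∉ gelfandIdeal ω) : IsPureState (actOnState a ω ha) := by
  intro φ hφ hle
  obtain ⟨r, hr0, hr⟩ : ∃ r : ℝ, 0 < r ∧ ω.1 (star a * a) = r := by
    obtain ⟨h1, h2⟩ := Complex.nonneg_iff.1 (ω.2.1 a)
    have he : ω.1 (star a * a) = ((ω.1 (star a * a)).re : ℂ) :=
      Complex.ext rfl (by simpa using h2.symm)
    refine ⟨_, lt_of_le_of_ne h1 fun h0 => ha ?_, he⟩
    change ω.1 (star a * a) = 0
    rw [he, ← h0, Complex.ofReal_zero]
  have hrc : (r : ℂ) ≠ 0 := by exact_mod_cast hr0.ne'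
  -- Rescaling `a` absorbs the denominator: `a · ω` becomes `b ↦ ω ((c a)⋆ b (c a))`.
  let c : ℂ := ((Real.sqrt r)⁻¹ : ℝ)
  have hc : star c * c = (r : ℂ)⁻¹ := by
    simp only [c, Complex.star_def, Complex.conj_ofReal]
    rw [← Complex.ofReal_mul, ← mul_inv, Real.mul_self_sqrt hr0.le, Complex.ofReal_inv]
  have hs : ∀ x, ω.1 (star (c • a) * (x * (c • a))) = ω.1 (star a * x * a) / r := by
    intro x
    rw [star_smul, mul_smul_comm, smul_mul_assoc, mul_smul_comm, smul_smul, map_smul, smul_eq_mul,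
      hc, mul_assoc (star a), div_eq_inv_mul]
  obtain ⟨t, ht0, ht⟩ := hω.exists_eq_smul_conj hφ (c • a) (fun b => by
    have h1 := hle b
    change _ ≤ conjFunctional a ω (star b * b) at h1
    rw [conjFunctional_apply, hr] at h1
    rw [star_mul, mul_assoc, ← mul_assoc (star b), hs]
    exact h1)
  have heq : φ = (t : ℂ) • (_root_.actOnState a ω ha).1 := by
    refine DFunLike.ext _ _ fun b => ?_
    rw [ht, hs]
    change _ = (t : ℂ) * conjFunctional a ω b
    rw [conjFunctional_apply, hr]
  refine ⟨t, ht0, ?_, heq⟩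
  have h1 := hle 1
  rw [heq] at h1
  change (t : ℂ) * (_root_.actOnState a ω ha).1 (star 1 * 1) ≤ _ at h1
  rw [star_one, one_mul, (_root_.actOnState a ω ha).2.2, mul_one] at h1
  exact_mod_cast h1

end Purity

/-! ### Continuous sections over the unit interval -/

section Selection

open unitInterval

/-- An open subset of `I × E` whose fibres over `I` are path connected has a continuous section. -/
theorem exists_continuous_section {E : Type*} [TopologicalSpace E] {U : Set (I × E)}
    (hU : IsOpen U) (hne : ∀ t, ∃ z, (t, z) ∈ U)
    (hjoin : ∀ t z₀ z₁, (t, z₀) ∈ U → (t, z₁) ∈ U → JoinedIn {z | (t, z) ∈ U} z₀ z₁) :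
    ∃ f : C(I, E), ∀ t, (t, f t) ∈ U := by
  -- By compactness the interval splits into finitely many pieces over each of which one constant
  -- `z` lies in all fibres. The section is extended piece by piece.
  obtain ⟨τ, hτ0, hmono, ⟨N, hN⟩, hsub⟩ := exists_monotone_Icc_subset_open_cover_unitInterval
    (c := fun z : E => {t : I | (t, z) ∈ U})
    (fun z => hU.preimage (by fun_prop : Continuous fun t : I => (t, z)))
    (fun t _ => Set.mem_iUnion.2 (hne t))
  suffices h : ∀ n, ∃ f : C(I, E), ∀ t ≤ τ n, (t, f t) ∈ U by
    obtain ⟨f, hf⟩ := h N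
    exact ⟨f, fun t => hf t (by rw [hN N le_rfl]; exact le_one')⟩
  intro n
  induction n with
  | zero =>
    obtain ⟨z, hz⟩ := hne 0
    refine ⟨.const I z, fun t ht => ?_⟩
    rw [hτ0] at ht
    rw [le_antisymm ht nonneg']
    exact hz
  | succ n ih =>
    obtain ⟨f, hf⟩ := ih
    obtain ⟨z, hz⟩ := hsub n
    have hzn : (τ n, z) ∈ U := hz ⟨le_rfl, hmono n.le_succ⟩
    -- At the subdivision point the old value is joined to the new constant inside the fibre. By the
    -- tube lemma the whole path stays in the fibres over a neighbourhood `V`, where it is run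
    -- through before the constant takes over.
    have hγ := hjoin (τ n) (f (τ n)) z (hf _ le_rfl) hzn
    obtain ⟨γ, hγ⟩ := hγ
    have hopen : IsOpen {x : I × I | (x.1, γ x.2) ∈ U} := hU.preimage (by fun_prop)
    obtain ⟨V, W, hV, -, hτV, hW, hVW⟩ := generalized_tube_lemma (isCompact_singleton (x := τ n))
      (isCompact_univ (X := I)) hopen (by
        rintro ⟨x, y⟩ ⟨hx, -⟩
        rw [Set.mem_singleton_iff] at hx
        subst hx
        exact hγ y)
    obtain ⟨δ, hδ, hball⟩ := Metric.isOpen_iff.1 hV (τ n) (hτV rfl)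
    -- With `δ / 2` the path is finished while `t` is still within distance `δ` of `τ n`, hence in
    -- `V`.
    let s : I → I := fun t => Set.projIcc 0 1 zero_le_one (((t : ℝ) - τ n) / (δ / 2))
    have hs : Continuous s := by
      refine continuous_projIcc.comp ?_
      fun_prop
    have hs0 : ∀ t, t ≤ τ n → s t = 0 := fun t ht => by
      refine Set.projIcc_of_le_left _ (div_nonpos_of_nonpos_of_nonneg ?_ (by positivity))
      exact sub_nonpos.2 ht
    let g : I → E := fun t => if t ≤ τ n then f t else γ (s t)
    have hg : Continuous g := by
      refine Continuous.if_le f.continuous (γ.continuous.comp hs) continuous_id continuous_const ?_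
      intro t ht
      rw [hs0 t ht.le, γ.source]
      exact congrArg f ht
    refine ⟨⟨g, hg⟩, fun t ht => ?_⟩
    by_cases htn : t ≤ τ n
    · have : g t = f t := if_pos htn
      change (t, g t) ∈ U
      rw [this]
      exact hf t htn
    · have e : g t = γ (s t) := if_neg htn
      change (t, g t) ∈ U
      rw [e]
      rw [not_le] at htn
      by_cases htδ : (t : ℝ) - τ n < δ
      · have : t ∈ V := hball (by
          rw [Metric.mem_ball, Subtype.dist_eq, Real.dist_eq, abs_of_pos (sub_pos.2 (Subtype.coe_lt_coe.2 htn))]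
          exact htδ)
        exact hVW (Set.mk_mem_prod this (hW (Set.mem_univ (s t))))
      · have : s t = 1 := by
          refine Set.projIcc_of_right_le _ ?_
          rw [le_div_iff₀ (by positivity)]
          linarith
        rw [this, γ.target]
        exact hz ⟨htn.le, ht⟩

/-- A complex line minus at most one parameter is path connected. -/
theorem joinedIn_of_subsingleton_compl {E : Type*} [AddCommGroup E] [Module ℂ E]
    [TopologicalSpace E] [ContinuousAdd E] [ContinuousSMul ℂ E] {S : Set E} {z₀ z₁ : E}
    (h₀ : z₀ ∈ S) (h₁ : z₁ ∈ S)
    (h : {l : ℂ | z₀ + l • (z₁ - z₀) ∉ S}.Subsingleton) : JoinedIn S z₀ z₁ := by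
  have hp := Set.Countable.isPathConnected_compl_of_one_lt_rank
    (by rw [Complex.rank_real_complex]; norm_num) h.countable
  have hj := hp.joinedIn 0 (by simpa using h₀) 1 (by simpa using h₁)
  have := (hj.map (f := fun l : ℂ => z₀ + l • (z₁ - z₀)) (by fun_prop))
  simp only [zero_smul, add_zero, one_smul, add_sub_cancel] at this
  refine this.mono ?_
  rintro _ ⟨l, hl, rfl⟩
  simpa using hl

end Selection

/-! ### Joining a sequence by segments over the half-line -/

section Interpolation

variable {T A : Type*} [TopologicalSpace T] [AddCommGroup A] [Module ℝ A]

/-- The piecewise linear interpolation of a sequence, as a function of `r ≥ 0`. -/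
noncomputable def interpolate (W : ℕ → A) (r : ℝ) : A :=
  W 0 + ∑ n ∈ Finset.range ⌈r⌉₊, (max 0 (min 1 (r - n))) • (W (n + 1) - W n)

/-- The upper summation bound in `interpolate` jumps with `r`. The extra terms vanish, so near a
given `r` it can be replaced by a constant, which gives continuity. -/
theorem interpolate_eq_of_le (W : ℕ → A) {r : ℝ} {N : ℕ} (h : r ≤ N) :
    interpolate W r =
      W 0 + ∑ n ∈ Finset.range N, (max 0 (min 1 (r - n))) • (W (n + 1) - W n) := by
  rw [interpolate]
  congr 1
  refine Finset.sum_subset (Finset.range_mono (Nat.ceil_le.2 h)) fun n _ hn => ?_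
  rw [Finset.mem_range, not_lt, Nat.ceil_le] at hn
  have : max 0 (min 1 (r - n)) = 0 :=
    max_eq_left ((min_le_right _ _).trans (sub_nonpos.2 hn))
  rw [this, zero_smul]

theorem interpolate_eq (W : ℕ → A) {r : ℝ} {n : ℕ} (h₀ : n ≤ r) (h₁ : r ≤ n + 1) :
    interpolate W r = (1 - (r - n)) • W n + (r - n) • W (n + 1) := by
  rw [interpolate_eq_of_le W (N := n + 1) (by exact_mod_cast h₁), Finset.sum_range_succ]
  have h : ∀ m ∈ Finset.range n, (max 0 (min 1 (r - m))) • (W (m + 1) - W m) = W (m + 1) - W m := by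
    intro m hm
    have hm' : ((m : ℝ) + 1) ≤ n := by exact_mod_cast Finset.mem_range.1 hm
    rw [min_eq_left (by linarith), max_eq_right zero_le_one, one_smul]
  rw [Finset.sum_congr rfl h, Finset.sum_range_sub, min_eq_right (by linarith),
    max_eq_right (by linarith)]
  module

theorem continuous_interpolate [TopologicalSpace A] [ContinuousSMul ℝ A]
    [IsTopologicalAddGroup A] {W : ℕ → T → A} (hW : ∀ n, Continuous (W n)) :
    Continuous fun x : T × ℝ => interpolate (fun n => W n x.1) x.2 := by
  rw [continuous_iff_continuousAt]
  rintro ⟨t, r⟩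
  obtain ⟨N, hN⟩ := exists_nat_gt r
  have hc : Continuous fun x : T × ℝ => W 0 x.1 + ∑ n ∈ Finset.range N,
      (max 0 (min 1 (x.2 - n))) • (W (n + 1) x.1 - W n x.1) := by
    have := hW
    fun_prop
  refine hc.continuousAt.congr ?_
  have : ∀ᶠ x : T × ℝ in nhds (t, r), x.2 < N :=
    (isOpen_lt continuous_snd continuous_const).mem_nhds hN
  filter_upwards [this] with x hx
  exact (interpolate_eq_of_le (fun n => W n x.1) hx.le).symm

end Interpolation

/-! ### Towers of projections -/

section Tower

variable {A : Type*} [CStarAlgebra A]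

/-- The Gelfand ideal as a submodule. -/
def gelfandSubmodule (ω : StateSpace A) : Submodule ℂ A where
  carrier := gelfandIdeal ω
  zero_mem' := by simp [gelfandIdeal]
  add_mem' {a b} ha hb := by
    change ω.1 (star (a + b) * (a + b)) = 0
    rw [mul_add, map_add, ω.2.1.apply_mul_eq_zero _ ha, ω.2.1.apply_mul_eq_zero _ hb, add_zero]
  smul_mem' c a ha := by
    change ω.1 (star (c • a) * (c • a)) = 0
    rw [mul_smul_comm, map_smul, ω.2.1.apply_mul_eq_zero _ ha, smul_zero]

theorem mem_gelfandSubmodule {ω : StateSpace A} {a : A} :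
    a ∈ gelfandSubmodule ω ↔ a ∈ gelfandIdeal ω := Iff.rfl

theorem mul_mem_gelfandSubmodule {ω : StateSpace A} (b : A) {a : A}
    (ha : a ∈ gelfandSubmodule ω) : b * a ∈ gelfandSubmodule ω := by
  change ω.1 (star (b * a) * (b * a)) = 0
  rw [← mul_assoc]
  exact ω.2.1.apply_mul_eq_zero _ ha

theorem one_notMem_gelfandIdeal (ω : StateSpace A) : 1 ∉ gelfandIdeal ω := by
  simp [gelfandIdeal, ω.2.2]

variable (A) in
/-- A decreasing sequence of projections, each a finite sum of subprojections of its successor up to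
equivalence, which compress every element of a set with dense span to scalars eventually. -/
structure ProjectionTower where
  P : ℕ → A
  isStarProjection : ∀ n, IsStarProjection (P n)
  P_zero : P 0 = 1
  mul_succ : ∀ n, P n * P (n + 1) = P (n + 1)
  J : ℕ → ℕ
  z : ∀ n, Fin (J n) → A
  mul_z : ∀ n j, P (n + 1) * z n j = z n j
  z_mul_succ : ∀ n j, z n j * P (n + 1) = 0
  sum_z : ∀ n, ∑ j, star (z n j) * z n j = P n - P (n + 1)
  D : Set A
  dense_span : Dense (Submodule.span ℂ D : Set A)
  compress : ∀ d ∈ D, ∃ N, ∃ c : ℂ, ∀ n, N ≤ n → P n * d * P n = c • P n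

namespace ProjectionTower

variable (T : ProjectionTower A)

theorem P_mul_self (n : ℕ) : T.P n * T.P n = T.P n := (T.isStarProjection n).isIdempotentElem.eq

theorem mul_of_le {m n : ℕ} (h : m ≤ n) : T.P m * T.P n = T.P n := by
  induction n, h using Nat.le_induction with
  | base => exact T.P_mul_self m
  | succ n _ ih => rw [← T.mul_succ n, ← mul_assoc, ih]

/-- `P n - P (n + 1)` is built from elements `z` that factor through `P (n + 1)`, so `P (n + 1) = 0`
would force `P n = 0`. -/
theorem P_ne_zero [Nontrivial A] (n : ℕ) : T.P n ≠ 0 := by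
  induction n with
  | zero => rw [T.P_zero]; exact one_ne_zero
  | succ n ih =>
    intro h
    have hz : ∀ j, T.z n j = 0 := fun j => by rw [← T.mul_z, h, zero_mul]
    have := T.sum_z n
    simp only [hz, mul_zero, Finset.sum_const_zero, h, sub_zero] at this
    exact ih this.symm

/-- The states that are one on all the projections of the tower. -/
def IsBase (ω : StateSpace A) : Prop := ∀ n, ω.1 (T.P n) = 1

variable {T}

/-- A state concentrated on `P n` sees only the compression of `d` by `P n`. -/
theorem apply_eq_of_compress {ω : StateSpace A} {n : ℕ} (h : ω.1 (T.P n) = 1) {d : A} {c : ℂ}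
    (hc : T.P n * d * T.P n = c • T.P n) : ω.1 d = c := by
  have h1 : ω.1 (T.P n) = ω.1 1 := by rw [h, ω.2.2]
  rw [← ω.2.1.apply_proj_mul (T.isStarProjection n) h1,
    ← ω.2.1.apply_mul_proj (T.isStarProjection n) h1, hc, map_smul, h, smul_eq_mul, mul_one]

variable (T) in
theorem exists_isBase [Nontrivial A] : ∃ ω : StateSpace A, T.IsBase ω := by
  -- The states with value one on `P n` form nonempty closed sets, decreasing in `n`, in a compact
  -- space.
  have hcl : ∀ n, IsClosed {ω : StateSpace A | ω.1 (T.P n) = 1} := fun n =>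
    isClosed_eq (StateSpace.continuous_apply continuous_id continuous_const) continuous_const
  have := IsCompact.nonempty_iInter_of_sequence_nonempty_isCompact_isClosed
    (fun n => {ω : StateSpace A | ω.1 (T.P n) = 1}) (fun n ω hω => ?_)
    (fun n => StateSpace.exists_apply_eq_one (T.isStarProjection n) (T.P_ne_zero n))
    (hcl 0).isCompact hcl
  · obtain ⟨ω, hω⟩ := this
    exact ⟨ω, fun n => Set.mem_iInter.1 hω n⟩
  · change ω.1 (T.P n) = 1
    have hω' : ω.1 (T.P (n + 1)) = 1 := hω
    rw [← ω.2.1.apply_mul_proj (T.isStarProjection (n + 1)) (by rw [hω', ω.2.2]), T.mul_succ, hω']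

/-- A positive functional below `ω` vanishes on every `1 - P n`, so it is concentrated on all `P n`;
compression then makes it `φ 1` times `ω` on a set with dense span. -/
theorem IsBase.isPureState {ω : StateSpace A} (hω : T.IsBase ω) : IsPureState ω := by
  intro φ hφ hle
  have h1 : ∀ n, φ (T.P n) = φ 1 := by
    intro n
    have hp := (T.isStarProjection n).one_sub
    have := hle (1 - T.P n)
    rw [hp.isSelfAdjoint.star_eq, hp.isIdempotentElem.eq, map_sub ω.1, hω n, ω.2.2, sub_self] at this
    have h0 := hφ (1 - T.P n)
    rw [hp.isSelfAdjoint.star_eq, hp.isIdempotentElem.eq] at h0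
    have := le_antisymm this h0
    rw [map_sub, sub_eq_zero] at this
    exact this.symm
  have hre : φ 1 = ((φ 1).re : ℂ) :=
    Complex.ext rfl (by simpa using (Complex.nonneg_iff.1 hφ.map_one_nonneg).2.symm)
  refine ⟨(φ 1).re, hφ.map_one_nonneg.1, ?_, weakDual_ext_of_dense_span T.dense_span fun d hd => ?_⟩
  · have := hle 1
    rw [star_one, one_mul, ω.2.2] at this
    simpa using (Complex.le_def.1 this).1
  · obtain ⟨N, c, hc⟩ := T.compress d hd
    rw [← hre, ← hφ.apply_proj_mul (T.isStarProjection N) (h1 N),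
      ← hφ.apply_mul_proj (T.isStarProjection N) (h1 N), hc N le_rfl, map_smul, h1]
    change _ = φ 1 * ω.1 d
    rw [apply_eq_of_compress (hω N) (hc N le_rfl), smul_eq_mul, mul_comm]

/-- One step of the deformation: from elements supported on `P n` to elements supported on
`P (n + 1)`. -/
theorem exists_step (ω : C(unitInterval, StateSpace A)) (n : ℕ) (W : C(unitInterval, A))
    (hW : ∀ t, W t ∉ gelfandIdeal (ω t)) (hPW : ∀ t, T.P n * W t = W t)
    (hWP : ∀ t, W t * T.P n = T.P n) :
    ∃ W' : C(unitInterval, A), (∀ t, W' t ∉ gelfandIdeal (ω t)) ∧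
      (∀ t, T.P (n + 1) * W' t = W' t) ∧ (∀ t, W' t * T.P (n + 1) = T.P (n + 1)) ∧
      ∀ t (s : ℝ), (1 - s) • W t + s • W' t ∉ gelfandIdeal (ω t) := by
  -- The new element will be `Y (c t) * W t`. Every `Y c` maps into the range of `P (n + 1)` and
  -- restricts to the identity there, so only avoiding the Gelfand ideal constrains `c`.
  let Y : (Fin (T.J n) → ℂ) → A := fun c => T.P (n + 1) + ∑ j, c j • T.z n j
  have hY : Continuous Y := by fun_prop
  have hPY : ∀ c, T.P (n + 1) * Y c = Y c := fun c => by
    simp only [Y, mul_add, Finset.mul_sum, mul_smul_comm, T.mul_z, T.P_mul_self]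
  have hYP : ∀ c, Y c * T.P (n + 1) = T.P (n + 1) := fun c => by
    simp only [Y, add_mul, Finset.sum_mul, smul_mul_assoc, T.z_mul_succ, T.P_mul_self, smul_zero,
      Finset.sum_const_zero, add_zero]
  let q : unitInterval × (Fin (T.J n) → ℂ) → ℂ := fun x =>
    (ω x.1).1 (star (Y x.2 * W x.1) * (Y x.2 * W x.1))
  have hq : Continuous q := by
    refine StateSpace.continuous_apply (ω.continuous.comp continuous_fst) ?_
    fun_prop
  have hq' : ∀ t c, q (t, c) ≠ 0 ↔ Y c * W t ∉ gelfandSubmodule (ω t) := fun t c => Iff.rfl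
  -- If every `c` failed, the left ideal would contain `P (n + 1) * W t` and all `z j * W t`, hence
  -- `(P n - P (n + 1)) * W t` by `sum_z`, and so `P n * W t = W t`.
  have hne : ∀ t, ∃ c, (t, c) ∈ {x | q x ≠ 0} := fun t => by
    by_contra hcon
    push Not at hcon
    have hall : ∀ c, Y c * W t ∈ gelfandSubmodule (ω t) := fun c => by
      by_contra h
      exact hcon c h
    set N := gelfandSubmodule (ω t) with hN
    have h0 : T.P (n + 1) * W t ∈ N := by simpa [Y] using hall 0
    have hz : ∀ j, T.z n j * W t ∈ N := fun j => by
      have h := N.sub_mem (hall (Pi.single j 1)) h0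
      rw [← sub_mul] at h
      simpa [Y, Pi.single_apply] using h
    have h1 : (T.P n - T.P (n + 1)) * W t ∈ N := by
      rw [← T.sum_z, Finset.sum_mul]
      refine N.sum_mem fun j _ => ?_
      rw [mul_assoc]
      exact mul_mem_gelfandSubmodule _ (hz j)
    have h2 := N.add_mem h1 h0
    rw [sub_mul, sub_add_cancel, hPW] at h2
    exact hW t h2
  -- `Y` is affine. Two bad points on the line through `c₀` and `c₁` would put the direction, and
  -- then the value at `c₀` itself, into the ideal.
  have hjoin : ∀ t c₀ c₁, (t, c₀) ∈ {x | q x ≠ 0} → (t, c₁) ∈ {x | q x ≠ 0} →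
      JoinedIn {c | (t, c) ∈ {x | q x ≠ 0}} c₀ c₁ := fun t c₀ c₁ h₀ h₁ => by
    refine joinedIn_of_subsingleton_compl h₀ h₁ fun l hl m hm => ?_
    by_contra hlm
    replace hl : Y _ * W t ∈ gelfandSubmodule (ω t) := not_not.1 hl
    replace hm : Y _ * W t ∈ gelfandSubmodule (ω t) := not_not.1 hm
    have hYl : ∀ l : ℂ, Y (c₀ + l • (c₁ - c₀)) = Y c₀ + l • (Y c₁ - Y c₀) := fun l => by
      simp only [Y, add_sub_add_left_eq_sub, ← Finset.sum_sub_distrib, Finset.smul_sum, add_assoc,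
        ← Finset.sum_add_distrib, Pi.add_apply, Pi.smul_apply, Pi.sub_apply]
      congr 1
      refine Finset.sum_congr rfl fun j _ => ?_
      rw [smul_eq_mul]
      module
    rw [hYl, add_mul, smul_mul_assoc] at hl hm
    set N := gelfandSubmodule (ω t) with hN
    have h1 := N.sub_mem hl hm
    rw [add_sub_add_left_eq_sub, ← sub_smul] at h1
    have h2 := (N.smul_mem_iff (sub_ne_zero.2 hlm)).1 h1
    have h3 := N.sub_mem hl (N.smul_mem l h2)
    rw [add_sub_cancel_right] at h3
    exact (hq' t c₀).1 h₀ h3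
  obtain ⟨c, hc⟩ := exists_continuous_section (isOpen_ne_fun hq continuous_const) hne hjoin
  let W' : C(unitInterval, A) := ⟨fun t => Y (c t) * W t, by fun_prop⟩
  have hW' : ∀ t, W' t ∉ gelfandIdeal (ω t) := hc
  refine ⟨W', hW', fun t => ?_, fun t => ?_, fun t s hmem => ?_⟩
  · change T.P (n + 1) * (Y (c t) * W t) = Y (c t) * W t
    rw [← mul_assoc, hPY]
  · change Y (c t) * W t * T.P (n + 1) = T.P (n + 1)
    rw [mul_assoc, ← T.mul_succ, ← mul_assoc (W t), hWP, T.mul_succ, hYP]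
  · rw [← mem_gelfandSubmodule] at hmem
    have hW'N : W' t ∉ gelfandSubmodule (ω t) := hW' t
    have hWN : W t ∉ gelfandSubmodule (ω t) := hW t
    by_cases hs : s = 1
    · rw [hs, sub_self, zero_smul, one_smul, zero_add] at hmem
      exact hW'N hmem
    set N := gelfandSubmodule (ω t) with hN
    have hPW' : T.P (n + 1) * W' t = W' t := by
      change T.P (n + 1) * (Y (c t) * W t) = Y (c t) * W t
      rw [← mul_assoc, hPY]
    have hs' : ((1 - s : ℝ) : ℂ) ≠ 0 := by
      exact_mod_cast sub_ne_zero.2 (Ne.symm hs)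
    -- The projection `1 - P (n + 1)` annihilates `W' t` and isolates a multiple of its product with
    -- `W t`. Then each `z j * W t` is in the ideal, so `W' t` agrees with `P (n + 1) * W t` modulo
    -- it, and the other part of `W t` follows.
    have h1 : (1 - T.P (n + 1)) * W t ∈ N := by
      have h := mul_mem_gelfandSubmodule (1 - T.P (n + 1)) hmem
      rw [mul_add, mul_smul_comm, mul_smul_comm, sub_mul _ _ (W' t), hPW', one_mul, sub_self,
        smul_zero, add_zero, ← Complex.coe_smul] at h
      exact (N.smul_mem_iff hs').1 h
    have hz : ∀ j, T.z n j * W t ∈ N := fun j => by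
      have h := mul_mem_gelfandSubmodule (T.z n j) h1
      rwa [← mul_assoc, mul_sub, T.z_mul_succ, mul_one, sub_zero] at h
    have h2 : W' t - T.P (n + 1) * W t ∈ N := by
      have : W' t - T.P (n + 1) * W t = ∑ j, c t j • (T.z n j * W t) := by
        change Y (c t) * W t - _ = _
        simp only [Y, add_mul, Finset.sum_mul, smul_mul_assoc, add_sub_cancel_left]
      rw [this]
      exact N.sum_mem fun j _ => N.smul_mem _ (hz j)
    have h3 : T.P (n + 1) * W t ∈ N := by
      have h := mul_mem_gelfandSubmodule (T.P (n + 1)) hmem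
      rw [mul_add, mul_smul_comm, mul_smul_comm, hPW'] at h
      have h4 := N.sub_mem h (N.smul_mem (s : ℂ) h2)
      have e : (1 - s) • (T.P (n + 1) * W t) + s • W' t
          - (s : ℂ) • (W' t - T.P (n + 1) * W t) = T.P (n + 1) * W t := by
        rw [Complex.coe_smul]
        module
      rwa [e] at h4
    refine hWN ?_
    have h5 := N.add_mem h1 h3
    rwa [sub_mul, one_mul, sub_add_cancel] at h5

end ProjectionTower

end Tower

/-! ### Deformation of paths of states to the base state -/

section Deformation

variable {A : Type*} [CStarAlgebra A]

theorem actOnState_apply (a : A) (ω : StateSpace A) (ha : a ∉ gelfandIdeal ω) (b : A) :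
    (actOnState a ω ha).1 b = ω.1 (star a * b * a) / ω.1 (star a * a) :=
  conjFunctional_apply a ω b

theorem actOnState_apply_proj {a p : A} {ω : StateSpace A} (ha : a ∉ gelfandIdeal ω)
    (hpa : p * a = a) : (actOnState a ω ha).1 p = 1 := by
  rw [actOnState_apply, mul_assoc, hpa]
  exact div_self ha

theorem actOnState_one (ω : StateSpace A) (h : 1 ∉ gelfandIdeal ω) : actOnState 1 ω h = ω := by
  refine Subtype.ext (DFunLike.ext _ _ fun b => ?_)
  rw [actOnState_apply, star_one, one_mul, mul_one, one_mul, ω.2.2, div_one]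

/-- If `a p = p` for a projection `p` with `ω p = 1`, then `a` fixes `ω`. -/
theorem actOnState_eq_self {a p : A} {ω : StateSpace A} (ha : a ∉ gelfandIdeal ω)
    (hp : IsStarProjection p) (hωp : ω.1 p = 1) (hap : a * p = p) : actOnState a ω ha = ω := by
  have h1 : ω.1 p = ω.1 1 := by rw [hωp, ω.2.2]
  have hpa : p * star a = p := by
    have := congrArg star hap
    rwa [star_mul, hp.isSelfAdjoint.star_eq] at this
  have key : ∀ b, ω.1 (star a * b * a) = ω.1 b := fun b => by
    rw [← ω.2.1.apply_mul_proj hp h1, ← ω.2.1.apply_proj_mul hp h1,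
      show p * (star a * b * a * p) = (p * star a) * (b * (a * p)) by simp only [mul_assoc],
      hpa, hap, ω.2.1.apply_proj_mul hp h1, ω.2.1.apply_mul_proj hp h1]
  refine Subtype.ext (DFunLike.ext _ _ fun b => ?_)
  have h2 := key 1
  rw [mul_one] at h2
  rw [actOnState_apply, key, h2, ω.2.2, div_one]

namespace ProjectionTower

variable {T : ProjectionTower A}

theorem exists_sequence (ω : C(unitInterval, StateSpace A)) :
    ∃ W : ℕ → C(unitInterval, A), W 0 = 1 ∧ (∀ n t, T.P n * W n t = W n t) ∧
      (∀ n t, W n t * T.P n = T.P n) ∧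
      ∀ n t (s : ℝ), (1 - s) • W n t + s • W (n + 1) t ∉ gelfandIdeal (ω t) := by
  let Good : ℕ → C(unitInterval, A) → Prop := fun n W =>
    (∀ t, W t ∉ gelfandIdeal (ω t)) ∧ (∀ t, T.P n * W t = W t) ∧ ∀ t, W t * T.P n = T.P n
  have hstep : ∀ n (W : {W // Good n W}), ∃ W' : {W // Good (n + 1) W},
      ∀ t (s : ℝ), (1 - s) • W.1 t + s • W'.1 t ∉ gelfandIdeal (ω t) := by
    rintro n ⟨W, h1, h2, h3⟩
    obtain ⟨W', h1', h2', h3', h4⟩ := exists_step ω n W h1 h2 h3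
    exact ⟨⟨W', h1', h2', h3'⟩, h4⟩
  choose next hnext using hstep
  let W₀ : {W // Good 0 W} := ⟨1, fun t => one_notMem_gelfandIdeal _, fun t => by simp [T.P_zero],
    fun t => by simp⟩
  let W : ∀ n, {W // Good n W} := fun n => Nat.rec W₀ (fun n W => next n W) n
  exact ⟨fun n => (W n).1, rfl, fun n => (W n).2.2.1, fun n => (W n).2.2.2,
    fun n => hnext n (W n)⟩

/-- The countably many steps are run over `s ∈ [0, 1)` along the piecewise linear interpolation of
the `W n`. Only continuity at `s = 1` is delicate; it is tested on the elements of `D`, whose values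
are constant near `s = 1`, uniformly in `t`. -/
theorem exists_deformation {ω₀ : StateSpace A} (hω₀ : T.IsBase ω₀)
    (ω : C(unitInterval, StateSpace A)) :
    ∃ (a : C(unitInterval × Set.Ico (0 : ℝ) 1, A)) (H : C(unitInterval × unitInterval, StateSpace A)),
      (∀ t, H (0, t) = ω t) ∧ (∀ t, H (1, t) = ω₀) ∧ (∀ s t, ω t = ω₀ → H (s, t) = ω₀) ∧
      ∀ (t : unitInterval) (s : Set.Ico (0 : ℝ) 1), ∃ hts : a (t, s) ∉ gelfandIdeal (ω t),
        H (⟨s.1, s.2.1, s.2.2.le⟩, t) = actOnState (a (t, s)) (ω t) hts := by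
  obtain ⟨W, hW0, hPW, hWP, hW⟩ := exists_sequence (T := T) ω
  -- This stretches `[0, 1)` onto `[0, ∞)`, so that step `n` takes place for `r` between `n` and `n
  -- + 1`.
  let r : Set.Ico (0 : ℝ) 1 → ℝ := fun s => s.1 / (1 - s.1)
  have hr : Continuous r := by
    refine Continuous.div (by fun_prop) (by fun_prop) fun s => ?_
    exact (sub_pos.2 s.2.2).ne'
  have hr0 : ∀ s, 0 ≤ r s := fun s => div_nonneg s.2.1 (sub_pos.2 s.2.2).le
  let a : C(unitInterval × Set.Ico (0 : ℝ) 1, A) :=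
    ⟨fun x => interpolate (fun n => W n x.1) (r x.2),
      (continuous_interpolate (W := fun n => W n) fun n => (W n).continuous).comp
        (continuous_fst.prodMk (hr.comp continuous_snd))⟩
  have ha : ∀ t s (n : ℕ), n ≤ r s → r s ≤ n + 1 →
      a (t, s) = (1 - (r s - n)) • W n t + (r s - n) • W (n + 1) t := fun t s n h0 h1 =>
    interpolate_eq (fun n => W n t) h0 h1
  have hfl : ∀ s, (⌊r s⌋₊ : ℝ) ≤ r s ∧ r s ≤ ⌊r s⌋₊ + 1 := fun s =>
    ⟨Nat.floor_le (hr0 s), (Nat.lt_floor_add_one _).le⟩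
  have hmem : ∀ t s, a (t, s) ∉ gelfandIdeal (ω t) := fun t s => by
    rw [ha t s _ (hfl s).1 (hfl s).2]
    exact hW _ t _
  have hPa : ∀ t s (n : ℕ), n ≤ r s → T.P n * a (t, s) = a (t, s) := fun t s n hn => by
    have hle : n ≤ ⌊r s⌋₊ := Nat.le_floor hn
    have h : ∀ m, n ≤ m → T.P n * W m t = W m t := fun m hm => by
      rw [← hPW m t, ← mul_assoc, T.mul_of_le hm]
    rw [ha t s _ (hfl s).1 (hfl s).2, mul_add, mul_smul_comm, mul_smul_comm, h _ hle,
      h _ (hle.trans (Nat.le_succ _))]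
  -- The interpolation involves `W m` and `W (m + 1)` with `m = ⌊r s⌋₊`; the projection of index `m
  -- + 1` is fixed by both. This makes `a (t, s)` act trivially on the base state.
  have haP : ∀ t s, a (t, s) * T.P (⌊r s⌋₊ + 1) = T.P (⌊r s⌋₊ + 1) := fun t s => by
    rw [ha t s _ (hfl s).1 (hfl s).2, add_mul, smul_mul_assoc, smul_mul_assoc, hWP,
      ← T.mul_succ, ← mul_assoc, hWP, ← add_smul, sub_add_cancel, one_smul]
  let H : unitInterval × unitInterval → StateSpace A := fun x =>
    if hs : (x.1 : ℝ) < 1 then actOnState (a (x.2, ⟨x.1, x.1.2.1, hs⟩)) (ω x.2) (hmem _ _) else ω₀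
  have hH : ∀ (x : unitInterval × unitInterval) (hs : (x.1 : ℝ) < 1),
      H x = actOnState (a (x.2, ⟨x.1, x.1.2.1, hs⟩)) (ω x.2) (hmem _ _) := fun x hs => dif_pos hs
  have hH1 : ∀ t, H (1, t) = ω₀ := fun t => dif_neg (by simp)
  have hcont : Continuous H := by
    refine StateSpace.continuous_of_dense_span T.dense_span fun d hd => ?_
    rw [continuous_iff_continuousAt]
    rintro ⟨s, t⟩
    by_cases hs : (s : ℝ) < 1
    · have hopen : IsOpen {x : unitInterval × unitInterval | (x.1 : ℝ) < 1} :=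
        isOpen_lt (by fun_prop) continuous_const
      refine ContinuousOn.continuousAt (s := {x | (x.1 : ℝ) < 1}) ?_ (hopen.mem_nhds hs)
      rw [continuousOn_iff_continuous_domRestrict]
      let y : {x : unitInterval × unitInterval | (x.1 : ℝ) < 1} → unitInterval × Set.Ico (0 : ℝ) 1 :=
        fun x => (x.1.2, ⟨x.1.1, x.1.1.2.1, x.2⟩)
      have hy : Continuous y := by
        refine Continuous.prodMk (by fun_prop) (Continuous.subtype_mk ?_ _)
        fun_prop
      have hω : Continuous fun x : {x : unitInterval × unitInterval | (x.1 : ℝ) < 1} => ω x.1.2 := by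
        fun_prop
      have hay : Continuous fun x => a (y x) := a.continuous.comp hy
      have h1 := StateSpace.continuous_apply hω
        ((hay.star.mul (continuous_const (y := d))).mul hay)
      have h2 := StateSpace.continuous_apply hω (hay.star.mul hay)
      refine (h1.div h2 fun x => hmem _ _).congr fun x => ?_
      change _ = (H x.1).1 d
      rw [hH x.1 x.2, actOnState_apply]
      rfl
    · have hs1 : s = 1 := le_antisymm unitInterval.le_one' (not_lt.1 hs)
      subst hs1
      obtain ⟨N, c, hc⟩ := T.compress d hd
      -- The bound `1 - 1 / (N + 1) < s` says that `r s > N`; from there on the state is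
      -- concentrated on `P N`.
      have hval : ∀ x : unitInterval × unitInterval, 1 - 1 / ((N : ℝ) + 1) < x.1 →
          (H x).1 d = c := by
        intro x hx
        refine apply_eq_of_compress (n := N) ?_ (hc N le_rfl)
        by_cases hx1 : (x.1 : ℝ) < 1
        · rw [hH x hx1]
          refine actOnState_apply_proj _ (hPa _ _ N ?_)
          change (N : ℝ) ≤ x.1 / (1 - x.1)
          rw [le_div_iff₀ (sub_pos.2 hx1)]
          have hN : (0 : ℝ) < N + 1 := by positivity
          rw [sub_lt_comm, lt_div_iff₀ hN] at hx
          nlinarith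
        · have : x = (1, x.2) := Prod.ext (le_antisymm unitInterval.le_one' (not_lt.1 hx1)) rfl
          rw [this, hH1]
          exact hω₀ N
      have hnhds : {x : unitInterval × unitInterval | 1 - 1 / ((N : ℝ) + 1) < x.1} ∈
          nhds ((1 : unitInterval), t) :=
        (isOpen_lt continuous_const (by fun_prop)).mem_nhds (by
          change 1 - 1 / ((N : ℝ) + 1) < ((1 : unitInterval) : ℝ)
          have : (0 : ℝ) < 1 / (N + 1) := by positivity
          simpa using this)
      refine (continuousAt_const (y := c)).congr ?_
      filter_upwards [hnhds] with x hx
      exact (hval x hx).symm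
  refine ⟨a, ⟨H, hcont⟩, fun t => ?_, hH1, fun s t ht => ?_, fun t s => ⟨hmem t s, ?_⟩⟩
  · change H (0, t) = ω t
    have h01 : ((0 : unitInterval) : ℝ) < 1 := zero_lt_one
    have hr00 : r ⟨0, le_rfl, h01⟩ = 0 := by simp [r]
    rw [hH (0, t) h01]
    have h1 : a (t, ⟨0, le_rfl, h01⟩) = 1 := by
      rw [ha t _ 0 (by rw [hr00, Nat.cast_zero]) (by rw [hr00]; simp), hr00, hW0]
      simp
    have : ∀ (b : A) (hb : b ∉ gelfandIdeal (ω t)), b = 1 → actOnState b (ω t) hb = ω t := by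
      rintro b hb rfl
      exact actOnState_one _ _
    exact this _ _ h1
  · change H (s, t) = ω₀
    by_cases hs : (s : ℝ) < 1
    · rw [hH (s, t) hs]
      have h := actOnState_eq_self (hmem t ⟨s, s.2.1, hs⟩) (T.isStarProjection _)
        (by rw [ht]; exact hω₀ _) (haP t _)
      exact h.trans ht
    · have : s = 1 := le_antisymm unitInterval.le_one' (not_lt.1 hs)
      rw [this, hH1]
  · exact hH (_, t) s.2.2

/-- Loops of states at the base state contract by acting with elements of the algebra. -/
theorem exists_homotopy {ω₀ : StateSpace A} (hω₀ : T.IsBase ω₀) (ω : Path ω₀ ω₀) :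
    ∃ (a : C(unitInterval × Set.Ico (0 : ℝ) 1, A)) (h : ω.Homotopy (Path.refl ω₀)),
      ∀ (t : unitInterval) (s : Set.Ico (0 : ℝ) 1),
        ∃ hts : a (t, s) ∉ gelfandIdeal (ω t),
          h (⟨s.1, s.2.1, s.2.2.le⟩, t) = actOnState (a (t, s)) (ω t) hts := by
  obtain ⟨a, H, h0, h1, hfix, hact⟩ := exists_deformation hω₀ ω.toContinuousMap
  refine ⟨a, ⟨⟨H, h0, fun t => by simpa using h1 t⟩, ?_⟩, hact⟩
  rintro s t (rfl | ht)
  · exact (hfix s 0 ω.source).trans ω.source.symm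
  · rw [Set.mem_singleton_iff] at ht
    subst ht
    exact (hfix s 1 ω.target).trans ω.target.symm

theorem exists_deformation_pure {ω₀ : PureStateSpace A} (hω₀ : T.IsBase ω₀.1)
    (ω : C(unitInterval, PureStateSpace A)) :
    ∃ H : C(unitInterval × unitInterval, PureStateSpace A),
      (∀ t, H (0, t) = ω t) ∧ (∀ t, H (1, t) = ω₀) ∧ ∀ s t, ω t = ω₀ → H (s, t) = ω₀ := by
  obtain ⟨a, H, h0, h1, hfix, hact⟩ :=
    exists_deformation hω₀ ⟨fun t => (ω t).1, by fun_prop⟩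
  have hpure : ∀ x, IsPureState (H x) := by
    rintro ⟨s, t⟩
    by_cases hs : (s : ℝ) < 1
    · obtain ⟨hts, he⟩ := hact t ⟨s, s.2.1, hs⟩
      have : H (s, t) = _ := he
      rw [this]
      exact (ω t).2.actOnState _ _
    · have : s = 1 := le_antisymm unitInterval.le_one' (not_lt.1 hs)
      rw [this, h1]
      exact ω₀.2
  exact ⟨⟨fun x => ⟨H x, hpure x⟩, by fun_prop⟩, fun t => Subtype.ext (h0 t),
    fun t => Subtype.ext (h1 t), fun s t ht => Subtype.ext (hfix s t (congrArg Subtype.val ht))⟩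

theorem homotopic_refl {ω₀ : PureStateSpace A} (hω₀ : T.IsBase ω₀.1) (ω : Path ω₀ ω₀) :
    ω.Homotopic (Path.refl ω₀) := by
  obtain ⟨H, h0, h1, hfix⟩ := exists_deformation_pure hω₀ ω.toContinuousMap
  refine ⟨⟨⟨H, h0, fun t => by simpa using h1 t⟩, ?_⟩⟩
  rintro s t (rfl | ht)
  · exact (hfix s 0 ω.source).trans ω.source.symm
  · rw [Set.mem_singleton_iff] at ht
    subst ht
    exact (hfix s 1 ω.target).trans ω.target.symm

theorem joined {ω₀ : PureStateSpace A} (hω₀ : T.IsBase ω₀.1) (ω : PureStateSpace A) :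
    Joined ω ω₀ := by
  -- The deformation of the constant path at `ω`, followed in the variable `s`, joins `ω` to `ω₀`.
  obtain ⟨H, h0, h1, -⟩ := exists_deformation_pure hω₀ (.const _ ω)
  exact ⟨⟨⟨fun s => H (s, 0), by fun_prop⟩, h0 0, h1 0⟩⟩

end ProjectionTower

end Deformation

/-- A path connected space whose loops at one base point contract is simply connected. -/
theorem simplyConnectedSpace_of_loops {X : Type*} [TopologicalSpace X] (x₀ : X)
    (hj : ∀ x, Joined x x₀) (hl : ∀ γ : Path x₀ x₀, γ.Homotopic (Path.refl x₀)) :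
    SimplyConnectedSpace X := by
  refine simply_connected_iff_loops_nullhomotopic.2
    ⟨⟨⟨x₀⟩, fun x y => (hj x).trans (hj y).symm⟩, fun x γ => ?_⟩
  obtain ⟨p⟩ := hj x
  -- Conjugation by a path to `x₀` turns a loop at `x` into one that contracts.
  have h := hl (p.symm.trans (γ.trans p))
  rw [← Path.Homotopic.Quotient.eq] at h ⊢
  simp only [Path.Homotopic.Quotient.mk_trans, Path.Homotopic.Quotient.mk_symm,
    Path.Homotopic.Quotient.mk_refl] at h ⊢
  open Path.Homotopic.Quotient in
  calc mk γ = trans (trans (mk p) (trans (symm (mk p)) (trans (mk γ) (mk p)))) (symm (mk p)) := by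
        simp [trans_assoc]
        simp [← trans_assoc]
    _ = refl x := by rw [h]; simp

theorem ProjectionTower.simplyConnectedSpace {A : Type*} [CStarAlgebra A] [Nontrivial A]
    (T : ProjectionTower A) : SimplyConnectedSpace (PureStateSpace A) := by
  obtain ⟨ω₀, hω₀⟩ := T.exists_isBase
  exact simplyConnectedSpace_of_loops ⟨ω₀, hω₀.isPureState⟩
    (fun ω => joined (ω₀ := ⟨ω₀, hω₀.isPureState⟩) hω₀ ω)
    (fun γ => homotopic_refl (ω₀ := ⟨ω₀, hω₀.isPureState⟩) hω₀ γ)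

/-! ### Tensor factorizations -/

section Factorization

variable {A : Type*} [CStarAlgebra A]

namespace TensorFactorization

variable (F : TensorFactorization A)

/-- The elementary tensor `a₀ ⊗ ⋯ ⊗ aₙ₋₁`. -/
def tens (n : ℕ) (a : ∀ i, Matrix (Fin (F.k i)) (Fin (F.k i)) ℂ) : A :=
  ((List.range n).map fun i => F.ι i (a i)).prod

theorem tens_zero (a : ∀ i, Matrix (Fin (F.k i)) (Fin (F.k i)) ℂ) : F.tens 0 a = 1 := rfl

theorem tens_succ (n : ℕ) (a : ∀ i, Matrix (Fin (F.k i)) (Fin (F.k i)) ℂ) :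
    F.tens (n + 1) a = F.tens n a * F.ι n (a n) := by
  simp [tens, List.range_succ]

theorem tens_congr {n : ℕ} {a b : ∀ i, Matrix (Fin (F.k i)) (Fin (F.k i)) ℂ}
    (h : ∀ i < n, a i = b i) : F.tens n a = F.tens n b := by
  rw [tens, tens]
  congr 1
  exact List.map_congr_left fun i hi => by rw [h i (List.mem_range.1 hi)]

theorem commute_tens {n j : ℕ} (h : n ≤ j) (a : ∀ i, Matrix (Fin (F.k i)) (Fin (F.k i)) ℂ)
    (b : Matrix (Fin (F.k j)) (Fin (F.k j)) ℂ) : Commute (F.tens n a) (F.ι j b) := by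
  induction n with
  | zero => rw [tens_zero]; exact Commute.one_left _
  | succ n ih =>
    rw [tens_succ]
    exact (ih (by omega)).mul_left (F.commute n j (by omega) _ _)

theorem tens_mul (n : ℕ) (a b : ∀ i, Matrix (Fin (F.k i)) (Fin (F.k i)) ℂ) :
    F.tens n a * F.tens n b = F.tens n (a * b) := by
  induction n with
  | zero => simp [tens_zero]
  | succ n ih =>
    rw [tens_succ, tens_succ, tens_succ, ← ih, mul_assoc, ← mul_assoc (F.ι n _),
      ← (F.commute_tens le_rfl b (a n)).eq, Pi.mul_apply, map_mul]
    simp only [mul_assoc]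

theorem star_tens (n : ℕ) (a : ∀ i, Matrix (Fin (F.k i)) (Fin (F.k i)) ℂ) :
    star (F.tens n a) = F.tens n (star a) := by
  induction n with
  | zero => simp [tens_zero]
  | succ n ih =>
    rw [tens_succ, tens_succ, star_mul, ih, ← map_star, (F.commute_tens le_rfl _ _).eq,
      Pi.star_apply]

theorem tens_one (n : ℕ) : F.tens n 1 = 1 := by
  induction n with
  | zero => rfl
  | succ n ih => rw [tens_succ, ih, Pi.one_apply, map_one, one_mul]

theorem tens_smul (n : ℕ) (c : ℕ → ℂ) (a : ∀ i, Matrix (Fin (F.k i)) (Fin (F.k i)) ℂ) :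
    F.tens n (fun i => c i • a i) = ((List.range n).map c).prod • F.tens n a := by
  induction n with
  | zero => simp [tens_zero]
  | succ n ih =>
    rw [tens_succ, tens_succ, ih, map_smul, smul_mul_smul_comm, List.range_succ]
    simp

theorem exists_tens_eq {n m : ℕ} (h : n ≤ m) (a : ∀ i, Matrix (Fin (F.k i)) (Fin (F.k i)) ℂ) :
    ∃ b, F.tens m b = F.tens n a := by
  refine ⟨fun i => if i < n then a i else 1, ?_⟩
  induction m, h using Nat.le_induction with
  | base => exact F.tens_congr fun i hi => if_pos hi
  | succ m hm ih => rw [tens_succ, ih, if_neg (by omega), map_one, mul_one]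

theorem exists_tens_eq_ι (j : ℕ) (x : Matrix (Fin (F.k j)) (Fin (F.k j)) ℂ) :
    ∃ b, F.tens (j + 1) b = F.ι j x := by
  refine ⟨Function.update 1 j x, ?_⟩
  rw [tens_succ, F.tens_congr (b := 1) fun i hi => Function.update_of_ne hi.ne _ _, tens_one,
    Function.update_self, one_mul]

/-- The set of elementary tensors. -/
def tensors : Set A := {x | ∃ n a, F.tens n a = x}

theorem mul_mem_tensors {x y : A} (hx : x ∈ F.tensors) (hy : y ∈ F.tensors) :
    x * y ∈ F.tensors := by
  obtain ⟨n, a, rfl⟩ := hx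
  obtain ⟨m, b, rfl⟩ := hy
  obtain ⟨a', ha⟩ := F.exists_tens_eq (le_max_left n m) a
  obtain ⟨b', hb⟩ := F.exists_tens_eq (le_max_right n m) b
  exact ⟨max n m, a' * b', by rw [← tens_mul, ha, hb]⟩

theorem star_mem_tensors {x : A} (hx : x ∈ F.tensors) : star x ∈ F.tensors := by
  obtain ⟨n, a, rfl⟩ := hx
  exact ⟨n, star a, (F.star_tens n a).symm⟩

end TensorFactorization

/-- The span of a ⋆-closed multiplicative set containing `1`, as a ⋆-subalgebra. -/
def spanStarSubalgebra (D : Set A) (h1 : 1 ∈ D) (hmul : ∀ x ∈ D, ∀ y ∈ D, x * y ∈ D)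
    (hstar : ∀ x ∈ D, star x ∈ D) : StarSubalgebra ℂ A where
  carrier := Submodule.span ℂ D
  mul_mem' {x y} hx hy := by
    have := Submodule.mul_mem_mul hx hy
    rw [Submodule.span_mul_span] at this
    refine Submodule.span_mono ?_ this
    rintro _ ⟨a, ha, b, hb, rfl⟩
    exact hmul a ha b hb
  add_mem' := Submodule.add_mem _
  algebraMap_mem' c := by
    rw [Algebra.algebraMap_eq_smul_one]
    exact Submodule.smul_mem _ _ (Submodule.subset_span h1)
  star_mem' {x} hx := by
    change x ∈ Submodule.span ℂ D at hx
    change star x ∈ Submodule.span ℂ D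
    induction hx using Submodule.span_induction with
    | mem x hx => exact Submodule.subset_span (hstar x hx)
    | zero => rw [star_zero]; exact Submodule.zero_mem _
    | add x y _ _ hx hy => rw [star_add]; exact Submodule.add_mem _ hx hy
    | smul c x _ hx => rw [star_smul]; exact Submodule.smul_mem _ _ hx

namespace TensorFactorization

variable (F : TensorFactorization A)

theorem dense_span_tensors : Dense (Submodule.span ℂ F.tensors : Set A) := by
  refine F.dense.mono ?_
  have : StarAlgebra.adjoin ℂ (⋃ i, Set.range (F.ι i)) ≤ spanStarSubalgebra F.tensors
      ⟨0, 1, rfl⟩ (fun x hx y hy => F.mul_mem_tensors hx hy) (fun x hx => F.star_mem_tensors hx) := by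
    refine StarAlgebra.adjoin_le ?_
    intro x hx
    obtain ⟨i, y, rfl⟩ := Set.mem_iUnion.1 hx
    exact Submodule.subset_span ⟨i + 1, F.exists_tens_eq_ι i y⟩
  exact this

/-- The minimal projection onto the first basis vector. -/
def corner (i : ℕ) : Matrix (Fin (F.k i)) (Fin (F.k i)) ℂ :=
  Matrix.single ⟨0, F.k_pos i⟩ ⟨0, F.k_pos i⟩ 1

theorem corner_mul_self (i : ℕ) : F.corner i * F.corner i = F.corner i := by
  simp [corner]

theorem star_corner (i : ℕ) : star (F.corner i) = F.corner i := by
  rw [Matrix.star_eq_conjTranspose, corner, Matrix.conjTranspose_single, star_one]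

theorem corner_conj (i : ℕ) (a : Matrix (Fin (F.k i)) (Fin (F.k i)) ℂ) :
    F.corner i * a * F.corner i = a ⟨0, F.k_pos i⟩ ⟨0, F.k_pos i⟩ • F.corner i := by
  rw [corner, Matrix.single_mul_mul_single, one_mul, mul_one, Matrix.smul_single, smul_eq_mul,
    mul_one]

theorem tens_corner_conj (n : ℕ) (a : ∀ i, Matrix (Fin (F.k i)) (Fin (F.k i)) ℂ) :
    F.tens n F.corner * F.tens n a * F.tens n F.corner =
      ((List.range n).map fun i => a i ⟨0, F.k_pos i⟩ ⟨0, F.k_pos i⟩).prod • F.tens n F.corner := by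
  rw [tens_mul, tens_mul, ← F.tens_smul n fun i => a i ⟨0, F.k_pos i⟩ ⟨0, F.k_pos i⟩]
  exact F.tens_congr fun i _ => F.corner_conj i (a i)

theorem isStarProjection_tens_corner (n : ℕ) : IsStarProjection (F.tens n F.corner) := by
  refine ⟨?_, ?_⟩
  · rw [IsIdempotentElem, tens_mul]
    exact F.tens_congr fun i _ => F.corner_mul_self i
  · rw [IsSelfAdjoint, star_tens]
    exact F.tens_congr fun i _ => F.star_corner i

theorem tens_corner_mul_succ (n : ℕ) :
    F.tens n F.corner * F.tens (n + 1) F.corner = F.tens (n + 1) F.corner := by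
  rw [tens_succ, ← mul_assoc, (F.isStarProjection_tens_corner n).isIdempotentElem.eq]

theorem tens_corner_mul_of_le {m n : ℕ} (h : m ≤ n) :
    F.tens m F.corner * F.tens n F.corner = F.tens n F.corner := by
  induction n, h using Nat.le_induction with
  | base => exact (F.isStarProjection_tens_corner m).isIdempotentElem.eq
  | succ n _ ih => rw [← F.tens_corner_mul_succ n, ← mul_assoc, ih]

theorem tens_corner_mul_of_le' {m n : ℕ} (h : m ≤ n) :
    F.tens n F.corner * F.tens m F.corner = F.tens n F.corner := by
  have := congrArg star (F.tens_corner_mul_of_le h)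
  rwa [star_mul, (F.isStarProjection_tens_corner _).isSelfAdjoint.star_eq,
    (F.isStarProjection_tens_corner _).isSelfAdjoint.star_eq] at this

/-- The tower of the projections `e ⊗ ⋯ ⊗ e` onto the first basis vectors. -/
noncomputable def tower : ProjectionTower A where
  P n := F.tens n F.corner
  isStarProjection := F.isStarProjection_tens_corner
  P_zero := rfl
  mul_succ := F.tens_corner_mul_succ
  J := F.k
  -- In the factor `n` this is the matrix unit sending `e_j` to `e₁`, cut down to the complement of
  -- `e₁`; it vanishes for the first index, so all of `Fin (F.k n)` can be used. Summing `z⋆ z`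
  -- gives `1 - corner` in that factor.
  z n j := F.tens n F.corner * F.ι n (Matrix.single ⟨0, F.k_pos n⟩ j 1 * (1 - F.corner n))
  mul_z n j := by
    rw [tens_succ, mul_assoc, ← mul_assoc (F.ι n _), ← (F.commute_tens le_rfl _ _).eq, mul_assoc,
      ← mul_assoc (F.tens n _), (F.isStarProjection_tens_corner n).isIdempotentElem.eq, ← map_mul,
      ← mul_assoc (F.corner n)]
    simp [corner]
  z_mul_succ n j := by
    rw [tens_succ, (F.commute_tens le_rfl _ _).eq, mul_assoc, ← mul_assoc (F.tens n _),
      (F.isStarProjection_tens_corner n).isIdempotentElem.eq, (F.commute_tens le_rfl _ _).eq,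
      ← mul_assoc, ← map_mul, mul_assoc (Matrix.single _ _ _), sub_mul, one_mul, corner_mul_self,
      sub_self, mul_zero, map_zero, zero_mul]
  sum_z n := by
    have h : ∀ j, star (F.tens n F.corner * F.ι n (Matrix.single ⟨0, F.k_pos n⟩ j 1 *
        (1 - F.corner n))) * (F.tens n F.corner * F.ι n (Matrix.single ⟨0, F.k_pos n⟩ j 1 *
        (1 - F.corner n))) =
        F.tens n F.corner * F.ι n ((1 - F.corner n) * Matrix.single j j 1 * (1 - F.corner n)) := by
      intro j
      rw [star_mul, (F.isStarProjection_tens_corner n).isSelfAdjoint.star_eq, mul_assoc,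
        ← mul_assoc (F.tens n _), (F.isStarProjection_tens_corner n).isIdempotentElem.eq,
        ← mul_assoc, ← map_star, ← (F.commute_tens le_rfl _ _).eq, mul_assoc, ← map_mul, star_mul,
        star_sub, star_one, star_corner, Matrix.star_eq_conjTranspose,
        Matrix.conjTranspose_single, star_one, mul_assoc, ← mul_assoc (Matrix.single j _ _),
        Matrix.single_mul_single_same, one_mul, mul_assoc]
    rw [Finset.sum_congr rfl fun j _ => h j, ← Finset.mul_sum, ← map_sum, ← Finset.sum_mul,
      ← Finset.mul_sum, Matrix.sum_single_one, mul_one, tens_succ, mul_sub, mul_one, sub_mul,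
      one_mul, corner_mul_self, sub_self, sub_zero, map_sub, map_one, mul_sub, mul_one]
  D := F.tensors
  dense_span := F.dense_span_tensors
  compress := by
    rintro _ ⟨n, a, rfl⟩
    refine ⟨n, ((List.range n).map fun i => a i ⟨0, F.k_pos i⟩ ⟨0, F.k_pos i⟩).prod, fun m hm => ?_⟩
    rw [← F.tens_corner_mul_of_le' hm,
      show F.tens m F.corner * F.tens n F.corner * F.tens n a *
        (F.tens m F.corner * F.tens n F.corner) = F.tens m F.corner * (F.tens n F.corner *
        F.tens n a * F.tens n F.corner) * F.tens m F.corner by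
        rw [F.tens_corner_mul_of_le' hm]
        nth_rw 2 [← F.tens_corner_mul_of_le hm]
        simp only [mul_assoc]
        rw [← mul_assoc (F.tens m F.corner) (F.tens n F.corner), F.tens_corner_mul_of_le' hm],
      tens_corner_conj, mul_smul_comm, smul_mul_assoc, F.tens_corner_mul_of_le' hm,
      (F.isStarProjection_tens_corner m).isIdempotentElem.eq]

theorem isProductState_of_isBase {ω : StateSpace A} (h : F.tower.IsBase ω) :
    F.IsProductState ω := fun n a =>
  ProjectionTower.apply_eq_of_compress (h n) (F.tens_corner_conj n a)

end TensorFactorization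

end Factorization

/-! ### Factorizations of UHF algebras -/

section MatrixAlgebra

open Matrix

/-- A projection matrix has the form `V Vᴴ` with `Vᴴ V = 1`. -/
theorem Matrix.exists_isometry_of_projection {l : ℕ} {p : Matrix (Fin l) (Fin l) ℂ}
    (hsa : pᴴ = p) (hid : p * p = p) :
    ∃ (m : ℕ) (V : Matrix (Fin l) (Fin m) ℂ), V * Vᴴ = p ∧ Vᴴ * V = 1 := by
  have hp : p.IsHermitian := hsa
  let U : Matrix (Fin l) (Fin l) ℂ := hp.eigenvectorUnitary
  have hU1 : U * Uᴴ = 1 := Unitary.mul_star_self_of_mem hp.eigenvectorUnitary.2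
  have hU2 : Uᴴ * U = 1 := Unitary.star_mul_self_of_mem hp.eigenvectorUnitary.2
  let d : Fin l → ℂ := fun i => hp.eigenvalues i
  have hd : p = U * diagonal d * Uᴴ := by
    have := hp.spectral_theorem
    rw [Unitary.conjStarAlgAut_apply] at this
    exact this
  have hdiag : diagonal d = Uᴴ * p * U := by
    rw [hd, show Uᴴ * (U * diagonal d * Uᴴ) * U = (Uᴴ * U) * diagonal d * (Uᴴ * U) by
      simp only [Matrix.mul_assoc], hU2, Matrix.one_mul, Matrix.mul_one]
  have hdd : diagonal d * diagonal d = diagonal d := by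
    rw [hdiag, show Uᴴ * p * U * (Uᴴ * p * U) = Uᴴ * (p * ((U * Uᴴ) * p)) * U by
      simp only [Matrix.mul_assoc], hU1, Matrix.one_mul, hid]
  have hd01 : ∀ i, d i * d i = d i := fun i => by
    have := congrFun (congrFun hdd i) i
    simpa using this
  let S := {i // d i = 1}
  let e : Fin (Fintype.card S) ≃ S := (Fintype.equivFin S).symm
  -- The columns of `V` are the eigenvectors of eigenvalue one; the other eigenvalues are zero as
  -- `p` is idempotent.
  refine ⟨Fintype.card S, U.submatrix id fun j => (e j).1, ?_, ?_⟩
  · rw [hd]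
    ext i j
    rw [Matrix.mul_apply, Matrix.mul_apply]
    simp only [submatrix_apply, id, conjTranspose_apply, Matrix.mul_diagonal]
    refine (e.sum_comp fun x : S => U i x.1 * star (U j x.1)).trans ?_
    refine (Finset.sum_subtype (Finset.univ.filter fun i => d i = 1) (p := fun i => d i = 1)
      (by simp) fun x => U i x * star (U j x)).symm.trans ?_
    rw [Finset.sum_filter]
    refine Finset.sum_congr rfl fun x _ => ?_
    split_ifs with h
    · rw [h, mul_one]
    · have h0 : d x = 0 := (mul_right_eq_self₀.1 (hd01 x)).resolve_left h
      rw [h0, mul_zero, zero_mul]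
  · ext i j
    have := congrFun (congrFun hU2 (e i).1) (e j).1
    rw [Matrix.mul_apply] at this ⊢
    simp only [submatrix_apply, id, conjTranspose_apply] at this ⊢
    rw [this]
    simp [Matrix.one_apply, Subtype.ext_iff.symm]

/-- The commutant of a unital matrix subalgebra of a matrix algebra is a matrix algebra, and the two
generate. -/
theorem Matrix.exists_commutant {k l : ℕ} (hk : 0 < k) (hl : 0 < l)
    (θ : Matrix (Fin k) (Fin k) ℂ →⋆ₐ[ℂ] Matrix (Fin l) (Fin l) ℂ) :
    ∃ m, 0 < m ∧ ∃ χ : Matrix (Fin m) (Fin m) ℂ →⋆ₐ[ℂ] Matrix (Fin l) (Fin l) ℂ,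
      (∀ x y, Commute (θ x) (χ y)) ∧
      ∀ b, b ∈ StarAlgebra.adjoin ℂ (Set.range θ ∪ Set.range χ) := by
  let o : Fin k := ⟨0, hk⟩
  -- The images of the matrix units cut the space into `k` copies of the range of `E o o`, which `V`
  -- identifies with `ℂ^m`. The commutant consists of one `m × m` matrix repeated on all copies.
  let E : Fin k → Fin k → Matrix (Fin l) (Fin l) ℂ := fun i j => θ (single i j 1)
  have hE : ∀ i j i', E i j * E j i' = E i i' := fun i j i' => by
    simp only [E, ← map_mul, single_mul_single_same, one_mul]
  have hE0 : ∀ i j j' i', j ≠ j' → E i j * E j' i' = 0 := fun i j j' i' h => by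
    simp only [E, ← map_mul, single_mul_single_of_ne _ _ _ _ h, map_zero]
  have hEs : ∀ i j, star (E i j) = E j i := fun i j => by
    simp only [E, ← map_star, star_eq_conjTranspose, conjTranspose_single, star_one]
  have hE1 : ∑ i, E i i = 1 := by
    simp only [E, ← map_sum, sum_single_one, map_one]
  obtain ⟨m, V, hV1, hV2⟩ := exists_isometry_of_projection (p := E o o) (hEs o o) (hE o o o)
  have hVp : E o o * V = V := by rw [← hV1, Matrix.mul_assoc, hV2, Matrix.mul_one]
  have hpV : Vᴴ * E o o = Vᴴ := by rw [← hV1, ← Matrix.mul_assoc, hV2, Matrix.one_mul]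
  have hm : 0 < m := by
    rcases Nat.eq_zero_or_pos m with rfl | h
    · exfalso
      have hz : E o o = 0 := by
        rw [← hV1]
        ext i j
        simp [Matrix.mul_apply]
      have h1 : (1 : Matrix (Fin l) (Fin l) ℂ) = 0 := by
        rw [← hE1]
        refine Finset.sum_eq_zero fun i _ => ?_
        rw [← hE i o i, ← hE i o o, hz, mul_zero, zero_mul]
      have := congrFun (congrFun h1 ⟨0, hl⟩) ⟨0, hl⟩
      simp at this
    · exact h
  -- The block matrix with `X` as its `(i, j)` block and zeros elsewhere.
  let c : Fin k → Matrix (Fin m) (Fin m) ℂ → Fin k → Matrix (Fin l) (Fin l) ℂ :=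
    fun i X j => E i o * V * X * (Vᴴ * E o j)
  have hcc : ∀ i X j j' Y i', c i X j * c j' Y i' = if j = j' then c i (X * Y) i' else 0 := by
    intro i X j j' Y i'
    have : c i X j * c j' Y i' = E i o * V * X * (Vᴴ * (E o j * E j' o) * V) * Y * (Vᴴ * E o i') := by
      simp only [c, Matrix.mul_assoc]
    rw [this]
    split_ifs with h
    · rw [h, hE, hpV, hV2]
      simp only [c, Matrix.mul_assoc, Matrix.one_mul]
    · rw [hE0 _ _ _ _ h]
      simp
  have hEc : ∀ a b i X j, E a b * c i X j = if b = i then c a X j else 0 := by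
    intro a b i X j
    have : E a b * c i X j = (E a b * E i o) * V * X * (Vᴴ * E o j) := by
      simp only [c, Matrix.mul_assoc]
    rw [this]
    split_ifs with h
    · rw [h, hE]
    · rw [hE0 _ _ _ _ h]
      simp
  have hcE : ∀ a b i X j, c i X j * E a b = if j = a then c i X b else 0 := by
    intro a b i X j
    have : c i X j * E a b = E i o * V * X * (Vᴴ * (E o j * E a b)) := by
      simp only [c, Matrix.mul_assoc]
    rw [this]
    split_ifs with h
    · rw [h, hE]
    · rw [hE0 _ _ _ _ h]
      simp
  have hone : ∑ i, c i 1 i = 1 := by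
    rw [← hE1]
    refine Finset.sum_congr rfl fun i _ => ?_
    change E i o * V * 1 * (Vᴴ * E o i) = _
    rw [Matrix.mul_one, show E i o * V * (Vᴴ * E o i) = E i o * (V * Vᴴ) * E o i by
      simp only [Matrix.mul_assoc], hV1, hE, hE]
  let χ : Matrix (Fin m) (Fin m) ℂ →⋆ₐ[ℂ] Matrix (Fin l) (Fin l) ℂ :=
    { toFun := fun X => ∑ i, c i X i
      map_one' := hone
      map_mul' := fun X Y => by
        simp only [Finset.sum_mul_sum, hcc, Finset.sum_ite_eq, Finset.mem_univ, if_true]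
      map_zero' := by simp [c]
      map_add' := fun X Y => by
        simp only [c, Matrix.mul_add, Matrix.add_mul, Finset.sum_add_distrib]
      commutes' := fun r => by
        rw [Algebra.algebraMap_eq_smul_one, Algebra.algebraMap_eq_smul_one, ← hone, Finset.smul_sum]
        simp only [c, Matrix.mul_smul, Matrix.smul_mul]
      map_star' := fun X => by
        rw [star_sum]
        refine Finset.sum_congr rfl fun i _ => ?_
        simp only [c, star_eq_conjTranspose, conjTranspose_mul, conjTranspose_conjTranspose]
        rw [← star_eq_conjTranspose (E i o), ← star_eq_conjTranspose (E o i), hEs, hEs]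
        simp only [Matrix.mul_assoc] }
  have hχ : ∀ X, χ X = ∑ i, c i X i := fun X => rfl
  have hEχ : ∀ a b X, E a b * χ X = c a X b := fun a b X => by
    rw [hχ, Finset.mul_sum]
    simp only [hEc, Finset.sum_ite_eq, Finset.mem_univ, if_true]
  have hχE : ∀ a b X, χ X * E a b = c a X b := fun a b X => by
    rw [hχ, Finset.sum_mul]
    simp only [hcE, Finset.sum_ite_eq', Finset.mem_univ, if_true]
  refine ⟨m, hm, χ, fun x y => ?_, fun b => ?_⟩
  · rw [matrix_eq_sum_single x]
    simp only [map_sum]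
    refine Commute.sum_left _ _ _ fun i _ => Commute.sum_left _ _ _ fun j _ => ?_
    have : single i j (x i j) = x i j • single i j (1 : ℂ) := by
      rw [smul_single, smul_eq_mul, mul_one]
    rw [this, map_smul]
    exact Commute.smul_left ((hEχ i j y).trans (hχE i j y).symm) _
  · have hb : b = ∑ i, ∑ j, E i j * χ (Vᴴ * E o i * b * E j o * V) := by
      calc b = (∑ i, E i i) * b * ∑ j, E j j := by rw [hE1, one_mul, mul_one]
        _ = ∑ i, ∑ j, E i i * b * E j j := by
          rw [Finset.sum_mul, Finset.sum_mul_sum]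
        _ = _ := by
          refine Finset.sum_congr rfl fun i _ => Finset.sum_congr rfl fun j _ => ?_
          rw [hEχ]
          change _ = E i o * V * (Vᴴ * E o i * b * E j o * V) * (Vᴴ * E o j)
          rw [show E i o * V * (Vᴴ * E o i * b * E j o * V) * (Vᴴ * E o j) =
            E i o * (V * Vᴴ) * E o i * b * (E j o * (V * Vᴴ) * E o j) by
              simp only [Matrix.mul_assoc], hV1, hE, hE, hE, hE]
    rw [hb]
    refine sum_mem fun i _ => sum_mem fun j _ => mul_mem ?_ ?_
    · exact StarAlgebra.subset_adjoin ℂ _ (Or.inl ⟨_, rfl⟩)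
    · exact StarAlgebra.subset_adjoin ℂ _ (Or.inr ⟨_, rfl⟩)

end MatrixAlgebra

/-! ### Relative commutants in an increasing sequence of matrix algebras -/

section UHFFactorization

variable {A : Type*} [CStarAlgebra A]

/-- The relative commutant of a matrix subalgebra in a larger matrix subalgebra. -/
theorem exists_relative_commutant {k l : ℕ} (hk : 0 < k) (hl : 0 < l)
    {B C : StarSubalgebra ℂ A} (hBC : B ≤ C)
    (e : B ≃⋆ₐ[ℂ] Matrix (Fin k) (Fin k) ℂ) (f : C ≃⋆ₐ[ℂ] Matrix (Fin l) (Fin l) ℂ) :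
    ∃ m, 0 < m ∧ ∃ χ : Matrix (Fin m) (Fin m) ℂ →⋆ₐ[ℂ] A,
      (∀ x ∈ B, ∀ y, Commute x (χ y)) ∧ (∀ y, χ y ∈ C) ∧
      C ≤ StarAlgebra.adjoin ℂ ((B : Set A) ∪ Set.range χ) := by
  let θ : Matrix (Fin k) (Fin k) ℂ →⋆ₐ[ℂ] Matrix (Fin l) (Fin l) ℂ :=
    ((f : C →⋆ₐ[ℂ] _).comp (StarSubalgebra.inclusion hBC)).comp (e.symm : _ →⋆ₐ[ℂ] B)
  obtain ⟨m, hm, χ, hcomm, hgen⟩ := Matrix.exists_commutant hk hl θ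
  let ψ : Matrix (Fin l) (Fin l) ℂ →⋆ₐ[ℂ] A := C.subtype.comp (f.symm : _ →⋆ₐ[ℂ] C)
  have hψθ : ∀ x, ψ (θ x) = e.symm x := fun x => by
    change ((f.symm (f (StarSubalgebra.inclusion hBC (e.symm x)))) : A) = _
    rw [StarAlgEquiv.symm_apply_apply]
    rfl
  refine ⟨m, hm, ψ.comp χ, fun x hx y => ?_, fun y => (f.symm (χ y)).2, fun c hc => ?_⟩
  · have : x = ψ (θ (e ⟨x, hx⟩)) := by rw [hψθ, StarAlgEquiv.symm_apply_apply]
    rw [this]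
    exact (hcomm _ _).map ψ
  · have h1 : c = ψ (f ⟨c, hc⟩) := by
      change c = ((f.symm (f ⟨c, hc⟩) : C) : A)
      rw [StarAlgEquiv.symm_apply_apply]
    have h2 := (StarSubalgebra.mem_map (f := ψ)).2 ⟨_, hgen (f ⟨c, hc⟩), h1.symm⟩
    rw [StarAlgHom.map_adjoin] at h2
    refine StarAlgebra.adjoin_mono ?_ h2
    rintro _ ⟨_, ⟨x, rfl⟩ | ⟨y, rfl⟩, rfl⟩
    · exact Or.inl (by rw [hψθ]; exact (e.symm x).2)
    · exact Or.inr ⟨y, rfl⟩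

theorem IsUHF.nontrivial (h : IsUHF A) : Nontrivial A := by
  obtain ⟨B, -, hB, -⟩ := h
  obtain ⟨k, hk, ⟨e⟩⟩ := hB 0
  have : Nonempty (Fin k) := ⟨⟨0, hk⟩⟩
  have : Nontrivial (B 0) := e.toEquiv.nontrivial
  exact Subtype.val_injective.nontrivial (f := ((↑) : B 0 → A))

/-- The factors are `B 0` and the relative commutants of `B n` in `B (n + 1)`. Factor `i` lies in `B
i`, so it commutes with every later factor, and factors up to `n` generate `B n`. -/
theorem IsUHF.nonempty_tensorFactorization (h : IsUHF A) : Nonempty (TensorFactorization A) := by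
  obtain ⟨B, hmono, hB, hdense⟩ := h
  choose k hk e using hB
  have hstep := fun n => exists_relative_commutant (hk n) (hk (n + 1)) (hmono n.le_succ)
    (e n).some (e (n + 1)).some
  choose m hm χ hcomm hmem hgen using hstep
  let fac : ℕ → Σ m : ℕ, (Matrix (Fin m) (Fin m) ℂ →⋆ₐ[ℂ] A) := fun n =>
    Nat.casesOn n ⟨k 0, (B 0).subtype.comp ((e 0).some.symm : _ →⋆ₐ[ℂ] B 0)⟩ fun n => ⟨m n, χ n⟩
  have hfac : ∀ i y, (fac i).2 y ∈ B i := fun i => by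
    cases i with
    | zero => exact fun y => ((e 0).some.symm y).2
    | succ n => exact hmem n
  have hlt : ∀ i j, i < j → ∀ a b, Commute ((fac i).2 a) ((fac j).2 b) := fun i j hij => by
    cases j with
    | zero => exact absurd hij (Nat.not_lt_zero _)
    | succ n => exact fun a b => hcomm n _ (hmono (Nat.le_of_lt_succ hij) (hfac i a)) b
  refine ⟨⟨fun i => (fac i).1, fun i => ?_, fun i => (fac i).2, fun i j hij a b => ?_, ?_⟩⟩
  · cases i with
    | zero => exact hk 0
    | succ n => exact hm n
  · rcases lt_or_gt_of_ne hij with h | h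
    · exact hlt i j h a b
    · exact (hlt j i h b a).symm
  · refine hdense.mono (Set.iUnion_subset fun n => ?_)
    induction n with
    | zero =>
      intro x hx
      refine StarAlgebra.subset_adjoin ℂ _ (Set.mem_iUnion.2 ⟨0, (e 0).some ⟨x, hx⟩, ?_⟩)
      change (((e 0).some.symm ((e 0).some ⟨x, hx⟩) : B 0) : A) = x
      rw [StarAlgEquiv.symm_apply_apply]
    | succ n ih =>
      refine (hgen n).trans (StarAlgebra.adjoin_le (Set.union_subset ih ?_))
      exact fun x hx => StarAlgebra.subset_adjoin ℂ _ (Set.mem_iUnion.2 ⟨n + 1, hx⟩)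

end UHFFactorization

/-! ### Products over sites -/

section SiteProducts

variable {Γ M R : Type*} [Ring M] [StarRing M] [Algebra ℂ M] [Ring R] [StarRing R] [Algebra ℂ R]

/-- The product of the operators `B v` placed at the sites `v ∈ Λ`. -/
def siteProd (ι : Γ → M →⋆ₐ[ℂ] R) (Λ : List Γ) (B : Γ → M) : R :=
  (Λ.map fun v => ι v (B v)).prod

/-- The copies at different sites commute. -/
def SitesCommute (ι : Γ → M →⋆ₐ[ℂ] R) : Prop :=
  ∀ v w, v ≠ w → ∀ a b, Commute (ι v a) (ι w b)

variable {ι : Γ → M →⋆ₐ[ℂ] R}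

theorem siteProd_nil (B : Γ → M) : siteProd ι [] B = 1 := rfl

theorem siteProd_cons (v : Γ) (Λ : List Γ) (B : Γ → M) :
    siteProd ι (v :: Λ) B = ι v (B v) * siteProd ι Λ B := by
  simp [siteProd]

theorem siteProd_congr {Λ : List Γ} {B C : Γ → M} (h : ∀ v ∈ Λ, B v = C v) :
    siteProd ι Λ B = siteProd ι Λ C := by
  rw [siteProd, siteProd, List.map_congr_left fun v hv => by rw [h v hv]]

theorem siteProd_append (Λ Λ' : List Γ) (B : Γ → M) :
    siteProd ι (Λ ++ Λ') B = siteProd ι Λ B * siteProd ι Λ' B := by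
  simp [siteProd]

theorem siteProd_eq_one {Λ : List Γ} {B : Γ → M} (h : ∀ v ∈ Λ, B v = 1) : siteProd ι Λ B = 1 := by
  refine List.prod_eq_one fun x hx => ?_
  obtain ⟨v, hv, rfl⟩ := List.mem_map.1 hx
  rw [h v hv, map_one]

theorem SitesCommute.commute_siteProd (hι : SitesCommute ι) {v : Γ} {Λ : List Γ} (hv : v ∉ Λ)
    (a : M) (B : Γ → M) : Commute (ι v a) (siteProd ι Λ B) := by
  refine Commute.list_prod_right _ _ fun x hx => ?_
  obtain ⟨w, hw, rfl⟩ := List.mem_map.1 hx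
  exact hι v w (fun h => hv (h ▸ hw)) _ _

theorem SitesCommute.siteProd_mul (hι : SitesCommute ι) {Λ : List Γ} (hΛ : Λ.Nodup)
    (B C : Γ → M) : siteProd ι Λ B * siteProd ι Λ C = siteProd ι Λ fun v => B v * C v := by
  induction Λ with
  | nil => simp [siteProd_nil]
  | cons v Λ ih =>
    rw [List.nodup_cons] at hΛ
    rw [siteProd_cons, siteProd_cons, siteProd_cons, ← ih hΛ.2, mul_assoc,
      ← mul_assoc (siteProd ι Λ B), ← (hι.commute_siteProd hΛ.1 (C v) B).eq, map_mul]
    simp only [mul_assoc]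

theorem SitesCommute.star_siteProd (hι : SitesCommute ι) {Λ : List Γ} (hΛ : Λ.Nodup)
    (B : Γ → M) : star (siteProd ι Λ B) = siteProd ι Λ fun v => star (B v) := by
  induction Λ with
  | nil => simp [siteProd_nil]
  | cons v Λ ih =>
    rw [List.nodup_cons] at hΛ
    rw [siteProd_cons, siteProd_cons, star_mul, ih hΛ.2, ← map_star,
      (hι.commute_siteProd hΛ.1 _ _).eq]

theorem SitesCommute.siteProd_perm (hι : SitesCommute ι) {Λ Λ' : List Γ} (hΛ : Λ.Nodup)
    (h : Λ.Perm Λ') (B : Γ → M) : siteProd ι Λ B = siteProd ι Λ' B := by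
  refine (h.map fun v => ι v (B v)).prod_eq' ?_
  rw [List.pairwise_map]
  exact hΛ.imp fun hvw => hι _ _ hvw _ _

open Classical in
theorem SitesCommute.siteProd_extend (hι : SitesCommute ι) {Λ Λ' : List Γ} (hΛ : Λ.Nodup)
    (hΛ' : Λ'.Nodup) (h : Λ ⊆ Λ') (B : Γ → M) :
    siteProd ι Λ' (fun v => if v ∈ Λ then B v else 1) = siteProd ι Λ B := by
  -- Up to order, `Λ'` is `Λ` followed by sites that carry the unit. Such padding brings products
  -- over different lists to a common list.
  obtain ⟨Λ₁, hperm, hsub⟩ := hΛ.subperm h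
  obtain ⟨l, hl'⟩ := hsub.exists_perm_append
  have hl : Λ'.Perm (Λ ++ l) := hl'.trans (hperm.append_right l)
  have hnd : (Λ ++ l).Nodup := hl.nodup_iff.1 hΛ'
  rw [hι.siteProd_perm hΛ' hl, siteProd_append, siteProd_eq_one (Λ := l), mul_one]
  · exact siteProd_congr fun v hv => if_pos hv
  · exact fun v hv => if_neg fun hv' => List.disjoint_of_nodup_append hnd hv' hv

theorem SitesCommute.isStarProjection_siteProd (hι : SitesCommute ι) {Λ : List Γ} (hΛ : Λ.Nodup)
    {q : M} (hq : IsStarProjection q) : IsStarProjection (siteProd ι Λ fun _ => q) := by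
  refine ⟨?_, ?_⟩
  · rw [IsIdempotentElem, hι.siteProd_mul hΛ, hq.isIdempotentElem.eq]
  · rw [IsSelfAdjoint, hι.star_siteProd hΛ, hq.isSelfAdjoint.star_eq]

/-- The product of copies of a full element is nonzero. -/
theorem SitesCommute.siteProd_ne_zero [Nontrivial R] (hι : SitesCommute ι) {Λ : List Γ}
    (hΛ : Λ.Nodup) {p : M} {J : Type*} [Fintype J] {c d : J → M} (hp : ∑ j, c j * p * d j = 1) :
    siteProd ι Λ (fun _ => p) ≠ 0 := by
  induction Λ with
  | nil => rw [siteProd_nil]; exact one_ne_zero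
  | cons v Λ ih =>
    rw [List.nodup_cons] at hΛ
    intro h
    refine ih hΛ.2 ?_
    rw [siteProd_cons] at h
    -- Fullness is used at the site `v` alone: `1 = ∑ c p d` there, and `d` commutes past the other
    -- sites, so each summand contains the vanishing product.
    rw [← one_mul (siteProd ι Λ fun _ => p), ← map_one (ι v), ← hp, map_sum, Finset.sum_mul]
    refine Finset.sum_eq_zero fun j _ => ?_
    rw [map_mul, mul_assoc, (hι.commute_siteProd hΛ.1 _ _).eq, map_mul, mul_assoc,
      ← mul_assoc (ι v p), h, zero_mul, mul_zero]

/-- The set of products over finite sets of sites. -/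
def siteProds (ι : Γ → M →⋆ₐ[ℂ] R) : Set R := {x | ∃ Λ : List Γ, Λ.Nodup ∧ ∃ B, siteProd ι Λ B = x}

end SiteProducts

section SiteProductsDense

variable {Γ M A : Type*} [Ring M] [StarRing M] [Algebra ℂ M] [CStarAlgebra A]
  {ι : Γ → M →⋆ₐ[ℂ] A}

theorem SitesCommute.dense_span_siteProds (hι : SitesCommute ι)
    (hdense : Dense (StarAlgebra.adjoin ℂ (⋃ v, Set.range (ι v)) : Set A)) :
    Dense (Submodule.span ℂ (siteProds ι) : Set A) := by
  classical
  refine hdense.mono ?_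
  have hmul : ∀ x ∈ siteProds ι, ∀ y ∈ siteProds ι, x * y ∈ siteProds ι := by
    rintro _ ⟨Λ, hΛ, B, rfl⟩ _ ⟨Λ', hΛ', C, rfl⟩
    have hU : (Λ ∪ Λ').Nodup := hΛ'.union Λ
    rw [← hι.siteProd_extend hΛ hU (fun _ hv => List.mem_union_left hv _),
      ← hι.siteProd_extend hΛ' hU (fun _ hv => List.mem_union_right _ hv), hι.siteProd_mul hU]
    exact ⟨Λ ∪ Λ', hU, _, rfl⟩
  have hstar : ∀ x ∈ siteProds ι, star x ∈ siteProds ι := by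
    rintro _ ⟨Λ, hΛ, B, rfl⟩
    exact ⟨Λ, hΛ, _, (hι.star_siteProd hΛ B).symm⟩
  have : StarAlgebra.adjoin ℂ (⋃ v, Set.range (ι v)) ≤ spanStarSubalgebra (siteProds ι)
      ⟨[], List.nodup_nil, 1, rfl⟩ hmul hstar := by
    refine StarAlgebra.adjoin_le fun x hx => ?_
    obtain ⟨v, b, rfl⟩ := Set.mem_iUnion.1 hx
    refine Submodule.subset_span ⟨[v], List.nodup_singleton v, fun _ => b, ?_⟩
    rw [siteProd_cons, siteProd_nil, mul_one]
  exact this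

end SiteProductsDense

/-! ### Tensor products of positive functionals -/

section TensorFunctional

variable {A A' : Type*} [CStarAlgebra A'] [CStarAlgebra A]

/-- The functional `φ ⊗ ψ` on the algebraic tensor product. -/
noncomputable def tensorFunctional (φ : WeakDual ℂ A) (ψ : WeakDual ℂ A') : A ⊗[ℂ] A' →ₗ[ℂ] ℂ :=
  LinearMap.mul' ℂ ℂ ∘ₗ TensorProduct.map (WeakDual.toStrongDual φ).toLinearMap
    (WeakDual.toStrongDual ψ).toLinearMap

theorem tensorFunctional_tmul (φ : WeakDual ℂ A) (ψ : WeakDual ℂ A') (a : A) (b : A') :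
    tensorFunctional φ ψ (a ⊗ₜ b) = φ a * ψ b := rfl

/-- The quadratic form at `x` is `φ (y⋆ y)` with `y = ∑ x i • a i`. -/
theorem IsPositiveFunctional.posSemidef_gram {φ : WeakDual ℂ A} (hφ : IsPositiveFunctional φ)
    {n : ℕ} (a : Fin n → A) :
    (Matrix.of fun i j => φ (star (a i) * a j)).PosSemidef := by
  refine Matrix.PosSemidef.of_dotProduct_mulVec_nonneg ?_ fun x => ?_
  · ext i j
    rw [Matrix.conjTranspose_apply, Matrix.of_apply, Matrix.of_apply, ← hφ.map_star, star_mul,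
      star_star]
  · have h := hφ (∑ i, x i • a i)
    convert! h using 1
    rw [star_sum, Finset.sum_mul_sum]
    simp only [star_smul, map_sum, smul_mul_smul_comm, map_smul,
      dotProduct, Matrix.mulVec, Matrix.of_apply, Finset.mul_sum, Pi.star_apply, smul_eq_mul]
    refine Finset.sum_congr rfl fun i _ => Finset.sum_congr rfl fun j _ => ?_
    ring

/-- For `z = ∑ a i ⊗ b i` the value is the sum of all entries of the Hadamard product of two Gram
matrices, which is nonnegative by the Schur product theorem. No C⋆-norm on the tensor product is
needed. -/
theorem tensorFunctional_nonneg {φ : WeakDual ℂ A} {ψ : WeakDual ℂ A'}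
    (hφ : IsPositiveFunctional φ) (hψ : IsPositiveFunctional ψ) (z : A ⊗[ℂ] A') :
    0 ≤ tensorFunctional φ ψ (star z * z) := by
  obtain ⟨n, a, b, rfl⟩ := TensorProduct.exists_sum_tmul_eq z
  have h := ((hφ.posSemidef_gram a).hadamard (hψ.posSemidef_gram b)).dotProduct_mulVec_nonneg 1
  convert! h using 1
  rw [star_sum, Finset.sum_mul_sum]
  simp only [map_sum, TensorProduct.star_tmul,
    Algebra.TensorProduct.tmul_mul_tmul, tensorFunctional_tmul, dotProduct, Matrix.mulVec,
    Matrix.hadamard_apply, Matrix.of_apply, Finset.mul_sum, Pi.star_apply, Pi.one_apply, star_one,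
    one_mul, mul_one]

theorem continuous_tensorFunctional (φ : WeakDual ℂ A) (ψ : WeakDual ℂ A') (z w : A ⊗[ℂ] A') :
    Continuous fun b : A' => tensorFunctional φ ψ (z * (1 ⊗ₜ b) * w) := by
  induction z using TensorProduct.induction_on with
  | zero => simpa using continuous_const
  | add z z' hz hz' =>
    simp only [add_mul, map_add]
    exact hz.add hz'
  | tmul x y =>
    induction w using TensorProduct.induction_on with
    | zero => simpa using continuous_const
    | add w w' hw hw' =>
      simp only [mul_add, map_add]
      exact hw.add hw'
    | tmul x' y' =>
      simp only [Algebra.TensorProduct.tmul_mul_tmul, tensorFunctional_tmul]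
      have hψ : Continuous ψ := (WeakDual.toStrongDual ψ).continuous
      fun_prop

/-- The functional `b ↦ (φ ⊗ ψ)(X⋆ (1 ⊗ b) X)`. -/
noncomputable def transferFunctional (φ : WeakDual ℂ A) (ψ : WeakDual ℂ A') (X : A ⊗[ℂ] A') :
    WeakDual ℂ A' :=
  StrongDual.toWeakDual
    { toFun := fun b => tensorFunctional φ ψ (star X * (1 ⊗ₜ b) * X)
      map_add' := fun b c => by simp only [TensorProduct.tmul_add, mul_add, add_mul, map_add]
      map_smul' := fun r b => by
        simp only [TensorProduct.tmul_smul, mul_smul_comm, smul_mul_assoc, map_smul,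
          RingHom.id_apply]
      cont := continuous_tensorFunctional φ ψ (star X) X }

theorem transferFunctional_apply (φ : WeakDual ℂ A) (ψ : WeakDual ℂ A') (X : A ⊗[ℂ] A') (b : A') :
    transferFunctional φ ψ X b = tensorFunctional φ ψ (star X * (1 ⊗ₜ b) * X) := rfl

theorem isPositiveFunctional_transferFunctional {φ : WeakDual ℂ A} {ψ : WeakDual ℂ A'}
    (hφ : IsPositiveFunctional φ) (hψ : IsPositiveFunctional ψ) (X : A ⊗[ℂ] A') :
    IsPositiveFunctional (transferFunctional φ ψ X) := by
  intro b
  have h := tensorFunctional_nonneg hφ hψ ((1 ⊗ₜ b) * X)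
  rw [star_mul, TensorProduct.star_tmul, star_one] at h
  rw [transferFunctional_apply]
  convert! h using 2
  simp only [mul_assoc]
  rw [← mul_assoc (1 ⊗ₜ[ℂ] star b), Algebra.TensorProduct.tmul_mul_tmul, one_mul]

end TensorFunctional

/-! ### Transfer of states between quasi-local algebras -/

section Transfer

/-- A map `E : M' → M` implemented on `M ⊗ M'` by an element `x` and a full projection `p` of `M'`,
by `x⋆ (1 ⊗ B) x = E B ⊗ p`. -/
structure Transfer (M M' : Type*) [Ring M] [StarRing M] [Algebra ℂ M] [StarModule ℂ M]
    [Ring M'] [StarRing M'] [Algebra ℂ M'] [StarModule ℂ M'] where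
  E : M' → M
  x : M ⊗[ℂ] M'
  p : M'
  star_mul_mul : ∀ B, star x * (1 ⊗ₜ B) * x = E B ⊗ₜ p
  isStarProjection_p : IsStarProjection p
  full : ∃ (n : ℕ) (c d : Fin n → M'), ∑ j, c j * p * d j = 1
  isStarProjection_E_one : IsStarProjection (E 1)
  E_mul : ∀ B, E B * E 1 = E B

variable {Γ M M' : Type*} [Ring M] [StarRing M] [Algebra ℂ M]
    [Ring M'] [StarRing M'] [Algebra ℂ M']

section TensorSites

variable [StarModule ℂ M] [StarModule ℂ M'] {R R' : Type*} [Ring R] [StarRing R] [Algebra ℂ R]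
    [Ring R'] [StarRing R'] [Algebra ℂ R'] [StarModule ℂ R'] [StarModule ℂ R]

/-- The tensor product of two ⋆-homomorphisms. -/
noncomputable def tensorStarHom (f : M →⋆ₐ[ℂ] R) (g : M' →⋆ₐ[ℂ] R') :
    M ⊗[ℂ] M' →⋆ₐ[ℂ] R ⊗[ℂ] R' where
  __ := Algebra.TensorProduct.map f.toAlgHom g.toAlgHom
  map_star' z := by
    change Algebra.TensorProduct.map f.toAlgHom g.toAlgHom (star z) =
      star (Algebra.TensorProduct.map f.toAlgHom g.toAlgHom z)
    induction z using TensorProduct.induction_on with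
    | zero => simp
    | add z w hz hw => rw [star_add, map_add, hz, hw, map_add, star_add]
    | tmul a b =>
      rw [TensorProduct.star_tmul, Algebra.TensorProduct.map_tmul, Algebra.TensorProduct.map_tmul,
        TensorProduct.star_tmul]
      congr 1
      · exact map_star f a
      · exact map_star g b

theorem tensorStarHom_tmul (f : M →⋆ₐ[ℂ] R) (g : M' →⋆ₐ[ℂ] R') (a : M) (b : M') :
    tensorStarHom f g (a ⊗ₜ b) = f a ⊗ₜ g b := rfl

theorem SitesCommute.tensor {ι : Γ → M →⋆ₐ[ℂ] R} {ι' : Γ → M' →⋆ₐ[ℂ] R'} (hι : SitesCommute ι)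
    (hι' : SitesCommute ι') : SitesCommute fun v => tensorStarHom (ι v) (ι' v) := by
  intro v w hvw z y
  induction z using TensorProduct.induction_on with
  | zero => rw [map_zero]; exact Commute.zero_left _
  | add z z' hz hz' => rw [map_add]; exact hz.add_left hz'
  | tmul a b =>
    induction y using TensorProduct.induction_on with
    | zero => rw [map_zero]; exact Commute.zero_right _
    | add y y' hy hy' => rw [map_add]; exact hy.add_right hy'
    | tmul a' b' =>
      rw [tensorStarHom_tmul, tensorStarHom_tmul, Commute, SemiconjBy,
        Algebra.TensorProduct.tmul_mul_tmul, Algebra.TensorProduct.tmul_mul_tmul,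
        (hι v w hvw a a').eq, (hι' v w hvw b b').eq]

theorem siteProd_tensor {ι : Γ → M →⋆ₐ[ℂ] R} {ι' : Γ → M' →⋆ₐ[ℂ] R'} (Λ : List Γ) (B : Γ → M)
    (C : Γ → M') : siteProd (fun v => tensorStarHom (ι v) (ι' v)) Λ (fun v => B v ⊗ₜ C v) =
      siteProd ι Λ B ⊗ₜ siteProd ι' Λ C := by
  induction Λ with
  | nil => rfl
  | cons v Λ ih =>
    rw [siteProd_cons, siteProd_cons, siteProd_cons, ih, tensorStarHom_tmul,
      Algebra.TensorProduct.tmul_mul_tmul]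

end TensorSites

variable {A A' : Type*} [CStarAlgebra A] [CStarAlgebra A']
  {ι' : Γ → M' →⋆ₐ[ℂ] A'} {ι : Γ → M →⋆ₐ[ℂ] A}

/-- `φ'` takes the values of `φ` after applying `E` at all sites. -/
def IsTransferred (ι : Γ → M →⋆ₐ[ℂ] A) (ι' : Γ → M' →⋆ₐ[ℂ] A') (E : M' → M) (φ : WeakDual ℂ A)
    (φ' : WeakDual ℂ A') : Prop :=
  ∀ Λ : List Γ, Λ.Nodup → ∀ B : Γ → M', φ' (siteProd ι' Λ B) = φ (siteProd ι Λ fun v => E (B v))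

/-- `φ` is supported on the projection `q` at all sites. -/
def IsSupported (ι : Γ → M →⋆ₐ[ℂ] A) (q : M) (φ : WeakDual ℂ A) : Prop :=
  ∀ Λ : List Γ, Λ.Nodup → φ (siteProd ι Λ fun _ => q) = φ 1

theorem IsSupported.apply_conj (hι : SitesCommute ι) {q : M} (hq : IsStarProjection q)
    {φ : WeakDual ℂ A} (hφ : IsPositiveFunctional φ) (hs : IsSupported ι q φ) {Λ : List Γ}
    (hΛ : Λ.Nodup) (B : Γ → M) :
    φ (siteProd ι Λ fun v => q * B v * q) = φ (siteProd ι Λ B) := by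
  have hp := hι.isStarProjection_siteProd hΛ hq
  rw [← hι.siteProd_mul hΛ, ← hι.siteProd_mul hΛ, hφ.apply_mul_proj hp (hs Λ hΛ),
    hφ.apply_proj_mul hp (hs Λ hΛ)]

theorem isSupported_one (φ : WeakDual ℂ A) : IsSupported ι 1 φ := fun Λ _ => by
  rw [siteProd_eq_one fun _ _ => rfl]

theorem continuous_of_isTransferred {X : Type*} [TopologicalSpace X] {E : M' → M}
    (hd' : Dense (Submodule.span ℂ (siteProds ι') : Set A'))
    {f : X → StateSpace A} {g : X → StateSpace A'} (hf : Continuous f)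
    (h : ∀ x, IsTransferred ι ι' E (f x).1 (g x).1) : Continuous g := by
  refine StateSpace.continuous_of_dense_span hd' ?_
  rintro _ ⟨Λ, hΛ, B, rfl⟩
  simp only [fun x => h x Λ hΛ B]
  exact StateSpace.continuous_apply hf continuous_const

variable [StarModule ℂ M] [StarModule ℂ M']

/-- With `X` the product of the elements `x` over the sites of `Λ`, and `ω₁` a state with value one
on the product of the `p`, the functional `b ↦ (ω ⊗ ω₁) (X⋆ (1 ⊗ b) X)` has the required values on
`Λ`. The support condition on `ω` normalizes it. -/
theorem Transfer.exists_state_of_list [Nontrivial A'] (T : Transfer M M') (hι : SitesCommute ι)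
    (hι' : SitesCommute ι') (ω : StateSpace A) (hω : IsSupported ι (T.E 1) ω.1) {Λ : List Γ}
    (hΛ : Λ.Nodup) :
    ∃ ω' : StateSpace A', ∀ B : Γ → M',
      ω'.1 (siteProd ι' Λ B) = ω.1 (siteProd ι Λ fun v => T.E (B v)) := by
  obtain ⟨n, c, d, hcd⟩ := T.full
  obtain ⟨ω₁, hω₁⟩ := StateSpace.exists_apply_eq_one
    (hι'.isStarProjection_siteProd hΛ T.isStarProjection_p) (hι'.siteProd_ne_zero hΛ hcd)
  let X := siteProd (fun v => tensorStarHom (ι v) (ι' v)) Λ fun _ => T.x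
  have hval : ∀ B : Γ → M', transferFunctional ω.1 ω₁.1 X (siteProd ι' Λ B) =
      ω.1 (siteProd ι Λ fun v => T.E (B v)) := by
    intro B
    have h1 : (1 : A) ⊗ₜ[ℂ] siteProd ι' Λ B =
        siteProd (fun v => tensorStarHom (ι v) (ι' v)) Λ fun v => 1 ⊗ₜ B v := by
      rw [siteProd_tensor, siteProd_eq_one fun _ _ => rfl]
    have hc := hι.tensor hι'
    rw [transferFunctional_apply, h1, hc.star_siteProd hΛ, hc.siteProd_mul hΛ, hc.siteProd_mul hΛ,
      siteProd_congr (C := fun v => T.E (B v) ⊗ₜ T.p) fun v _ => T.star_mul_mul (B v),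
      siteProd_tensor, tensorFunctional_tmul, hω₁, mul_one]
  refine ⟨⟨transferFunctional ω.1 ω₁.1 X,
    isPositiveFunctional_transferFunctional ω.2.1 ω₁.2.1 X, ?_⟩, hval⟩
  have h := hval fun _ => 1
  rw [siteProd_eq_one fun _ _ => rfl] at h
  rw [h]
  exact (hω Λ hΛ).trans ω.2.2

/-- Compactness passes from finite lists to all sites at once. The sets `C Λ` shrink as `Λ` grows:
padding by `1` inserts factors `E 1`, which the support of `ω` absorbs. -/
theorem Transfer.exists_state [Nontrivial A'] (T : Transfer M M') (hι : SitesCommute ι)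
    (hι' : SitesCommute ι') (ω : StateSpace A) (hω : IsSupported ι (T.E 1) ω.1) :
    ∃ ω' : StateSpace A', IsTransferred ι ι' T.E ω.1 ω'.1 := by
  classical
  let C : {Λ : List Γ // Λ.Nodup} → Set (StateSpace A') := fun Λ =>
    {ω' | ∀ B : Γ → M', ω'.1 (siteProd ι' Λ B) = ω.1 (siteProd ι Λ fun v => T.E (B v))}
  have hcl : ∀ Λ, IsClosed (C Λ) := by
    intro Λ
    have : C Λ = ⋂ B : Γ → M', {ω' : StateSpace A' |
        ω'.1 (siteProd ι' Λ B) = ω.1 (siteProd ι Λ fun v => T.E (B v))} := by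
      ext ω'
      simp [C]
    rw [this]
    exact isClosed_iInter fun B => isClosed_eq
      (StateSpace.continuous_apply continuous_id continuous_const) continuous_const
  have hmono : ∀ Λ Λ' : {Λ : List Γ // Λ.Nodup}, Λ.1 ⊆ Λ'.1 → C Λ' ⊆ C Λ := by
    rintro ⟨Λ, hΛ⟩ ⟨Λ', hΛ'⟩ h ω' hω' B
    have hq := hι.isStarProjection_siteProd hΛ' T.isStarProjection_E_one
    change ω'.1 (siteProd ι' Λ B) = ω.1 (siteProd ι Λ fun v => T.E (B v))
    rw [← hι'.siteProd_extend hΛ hΛ' h, ← hι.siteProd_extend hΛ hΛ' h, hω']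
    refine Eq.trans ?_ (ω.2.1.apply_mul_proj hq (hω Λ' hΛ') _)
    rw [hι.siteProd_mul hΛ']
    congr 1
    refine siteProd_congr fun v _ => ?_
    split_ifs
    · exact (T.E_mul _).symm
    · exact (one_mul _).symm
  have : Nonempty {Λ : List Γ // Λ.Nodup} := ⟨⟨[], List.nodup_nil⟩⟩
  obtain ⟨ω', hω'⟩ := IsCompact.nonempty_iInter_of_directed_nonempty_isCompact_isClosed C
    (fun Λ Λ' => ⟨⟨Λ.1 ∪ Λ'.1, Λ'.2.union Λ.1⟩, hmono _ _ (fun _ hv => List.mem_union_left hv _),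
      hmono _ _ (fun _ hv => List.mem_union_right _ hv)⟩)
    (fun Λ => T.exists_state_of_list hι hι' ω hω Λ.2) (fun Λ => (hcl Λ).isCompact) hcl
  exact ⟨ω', fun Λ hΛ => Set.mem_iInter.1 hω' ⟨Λ, hΛ⟩⟩

theorem Transfer.exists_positiveFunctional [Nontrivial A'] (T : Transfer M M')
    (hι : SitesCommute ι) (hι' : SitesCommute ι') {φ : WeakDual ℂ A} (hφ : IsPositiveFunctional φ)
    (hs : IsSupported ι (T.E 1) φ) :
    ∃ φ' : WeakDual ℂ A', IsPositiveFunctional φ' ∧ IsTransferred ι ι' T.E φ φ' := by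
  by_cases h0 : φ 1 = 0
  · refine ⟨0, fun a => le_rfl, fun Λ _ B => ?_⟩
    rw [hφ.eq_zero h0]
    rfl
  · let ω : StateSpace A := ⟨(φ 1)⁻¹ • φ, fun a => mul_nonneg (inv_nonneg.2 hφ.map_one_nonneg)
      (hφ a), inv_mul_cancel₀ h0⟩
    have hωφ : ∀ a, ω.1 a = (φ 1)⁻¹ * φ a := fun a => rfl
    obtain ⟨ω', hω'⟩ := T.exists_state hι hι' ω fun Λ hΛ => by rw [hωφ, hs Λ hΛ, ← hωφ]
    refine ⟨φ 1 • ω'.1, fun a => mul_nonneg hφ.map_one_nonneg (ω'.2.1 a), fun Λ hΛ B => ?_⟩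
    change φ 1 * ω'.1 _ = _
    rw [hω' Λ hΛ B, hωφ, mul_inv_cancel_left₀ h0]

theorem IsTransferred.isSupported {T : Transfer M M'} {T' : Transfer M' M}
    (hTT' : ∀ a, T.E (T'.E a) = T.E 1 * a * T.E 1) {ω : StateSpace A} {ω' : StateSpace A'}
    (hs : IsSupported ι (T.E 1) ω.1) (hω' : IsTransferred ι ι' T.E ω.1 ω'.1) :
    IsSupported ι' (T'.E 1) ω'.1 := fun Λ hΛ => by
  rw [hω' Λ hΛ]
  simp only [hTT', mul_one, T.isStarProjection_E_one.isIdempotentElem.eq]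
  have h1 : 1 = ω'.1 1 := ω'.2.2.symm
  exact (hs Λ hΛ).trans (ω.2.2.trans h1)

/-- Transfer preserves purity if it is undone by a transfer in the other direction. -/
theorem Transfer.isPureState [Nontrivial A] (T : Transfer M M') (T' : Transfer M' M)
    (hTT' : ∀ a, T.E (T'.E a) = T.E 1 * a * T.E 1) (hT'T : ∀ B, T'.E (T.E B) = T'.E 1 * B * T'.E 1)
    (hι : SitesCommute ι) (hι' : SitesCommute ι')
    (hd : Dense (Submodule.span ℂ (siteProds ι) : Set A))
    (hd' : Dense (Submodule.span ℂ (siteProds ι') : Set A'))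
    {ω : StateSpace A} {ω' : StateSpace A'} (hs : IsSupported ι (T.E 1) ω.1)
    (hω' : IsTransferred ι ι' T.E ω.1 ω'.1) (hpure : IsPureState ω) : IsPureState ω' := by
  intro φ hφ hle
  have hs' : IsSupported ι' (T'.E 1) ω'.1 := hω'.isSupported hTT' hs
  have hφ2 : IsPositiveFunctional (ω'.1 - φ) := fun a => sub_nonneg.2 (hle a)
  have hsum : ∀ Λ : List Γ, Λ.Nodup → φ (siteProd ι' Λ fun _ => T'.E 1) = φ 1 := by
    intro Λ hΛ
    have hp := (hι'.isStarProjection_siteProd hΛ T'.isStarProjection_E_one).one_sub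
    have h1 := hle (1 - siteProd ι' Λ fun _ => T'.E 1)
    have h0 := hφ (1 - siteProd ι' Λ fun _ => T'.E 1)
    rw [hp.isSelfAdjoint.star_eq, hp.isIdempotentElem.eq] at h0 h1
    rw [map_sub ω'.1, hs' Λ hΛ, sub_self] at h1
    have := le_antisymm h1 h0
    rw [map_sub, sub_eq_zero] at this
    exact this.symm
  -- Both `φ` and `ω' - φ` inherit the support of `ω'`, so both transfer back. The results add up to
  -- `ω`; purity of `ω` makes the first a multiple of `ω`, and transferring forward returns `φ`.
  obtain ⟨ψ, hψ, hψφ⟩ := T'.exists_positiveFunctional hι' hι hφ hsum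
  obtain ⟨ψ₂, hψ₂, hψφ₂⟩ := T'.exists_positiveFunctional hι' hι hφ2 fun Λ hΛ => by
    change ω'.1 _ - φ _ = ω'.1 1 - φ 1
    rw [hs' Λ hΛ, hsum Λ hΛ]
  have hadd : ψ + ψ₂ = ω.1 := by
    refine weakDual_ext_of_dense_span hd ?_
    rintro _ ⟨Λ, hΛ, B, rfl⟩
    change ψ _ + ψ₂ _ = _
    rw [hψφ Λ hΛ, hψφ₂ Λ hΛ]
    change φ _ + (ω'.1 _ - φ _) = _
    rw [add_sub_cancel, hω' Λ hΛ]
    simp only [hTT']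
    exact hs.apply_conj hι T.isStarProjection_E_one ω.2.1 hΛ B
  obtain ⟨t, ht0, ht1, ht⟩ := hpure ψ hψ fun a => by
    rw [← hadd]
    exact le_add_of_nonneg_right (hψ₂ a)
  refine ⟨t, ht0, ht1, weakDual_ext_of_dense_span hd' ?_⟩
  rintro _ ⟨Λ, hΛ, B, rfl⟩
  change _ = (t : ℂ) * ω'.1 _
  rw [hω' Λ hΛ, ← IsSupported.apply_conj hι' T'.isStarProjection_E_one hφ hsum hΛ]
  simp only [← hT'T]
  rw [← hψφ Λ hΛ, ht]
  rfl

/-- Transfer along a unital map `E` embeds the pure states as the closed subspace of the pure states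
supported on a projection. -/
theorem Transfer.exists_isClosedEmbedding [Nontrivial A] [Nontrivial A'] (T : Transfer M M')
    (T' : Transfer M' M) (h1 : T.E 1 = 1) (hTT' : ∀ a, T.E (T'.E a) = a)
    (hT'T : ∀ B, T'.E (T.E B) = T'.E 1 * B * T'.E 1)
    (hι : SitesCommute ι) (hι' : SitesCommute ι')
    (hd : Dense (Submodule.span ℂ (siteProds ι) : Set A))
    (hd' : Dense (Submodule.span ℂ (siteProds ι') : Set A')) :
    ∃ Φ : PureStateSpace A → PureStateSpace A', Topology.IsClosedEmbedding Φ ∧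
      ∀ ω, IsTransferred ι ι' T.E ω.1.1 (Φ ω).1.1 := by
  have hTT'' : ∀ a, T.E (T'.E a) = T.E 1 * a * T.E 1 := fun a => by rw [hTT', h1, one_mul, mul_one]
  have hsup : ∀ ω : StateSpace A, IsSupported ι (T.E 1) ω.1 := fun ω => by
    rw [h1]; exact isSupported_one _
  have hpush : ∀ ω : PureStateSpace A, ∃ ω' : PureStateSpace A',
      IsTransferred ι ι' T.E ω.1.1 ω'.1.1 := fun ω => by
    obtain ⟨ω', hω'⟩ := T.exists_state hι hι' ω.1 (hsup ω.1)
    exact ⟨⟨ω', T.isPureState T' hTT'' hT'T hι hι' hd hd' (hsup ω.1) hω' ω.2⟩, hω'⟩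
  choose Φ hΦ using hpush
  refine ⟨Φ, ?_, hΦ⟩
  -- The image of `Φ` is the closed set `S`, and the transfer by `T'` is the continuous inverse on
  -- it.
  let S : Set (PureStateSpace A') := {ω' | IsSupported ι' (T'.E 1) ω'.1.1}
  have hS : IsClosed S := by
    have : S = ⋂ (Λ : List Γ) (_ : Λ.Nodup), {ω' : PureStateSpace A' |
        ω'.1.1 (siteProd ι' Λ fun _ => T'.E 1) = ω'.1.1 1} := by
      ext ω'
      simp [S, IsSupported]
    rw [this]
    exact isClosed_iInter fun Λ => isClosed_iInter fun hΛ => isClosed_eq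
      (StateSpace.continuous_apply continuous_subtype_val continuous_const)
      (StateSpace.continuous_apply continuous_subtype_val continuous_const)
  have hΦS : ∀ ω, Φ ω ∈ S := fun ω => IsTransferred.isSupported hTT'' (hsup ω.1) (hΦ ω)
  have hpull : ∀ ω' : S, ∃ ω : PureStateSpace A, IsTransferred ι' ι T'.E ω'.1.1.1 ω.1.1 := by
    rintro ⟨ω', hω'⟩
    obtain ⟨ω, hω⟩ := T'.exists_state hι' hι ω'.1 hω'
    exact ⟨⟨ω, T'.isPureState T hT'T hTT'' hι' hι hd' hd hω' hω ω'.2⟩, hω⟩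
  choose Ψ hΨ using hpull
  let e : PureStateSpace A ≃ₜ S :=
    { toFun := fun ω => ⟨Φ ω, hΦS ω⟩
      invFun := Ψ
      left_inv := fun ω => by
        refine Subtype.ext (Subtype.ext (weakDual_ext_of_dense_span hd ?_))
        rintro _ ⟨Λ, hΛ, B, rfl⟩
        rw [hΨ _ Λ hΛ, hΦ ω Λ hΛ]
        simp only [hTT']
      right_inv := fun ω' => by
        refine Subtype.ext (Subtype.ext (Subtype.ext (weakDual_ext_of_dense_span hd' ?_)))
        rintro _ ⟨Λ, hΛ, B, rfl⟩
        change (Φ (Ψ ω')).1.1 _ = _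
        rw [hΦ _ Λ hΛ, hΨ _ Λ hΛ]
        simp only [hT'T]
        exact IsSupported.apply_conj hι' T'.isStarProjection_E_one ω'.1.1.2.1 ω'.2 hΛ B
      continuous_toFun := Continuous.subtype_mk (Continuous.subtype_mk
        (continuous_of_isTransferred hd' continuous_subtype_val hΦ) _) _
      continuous_invFun := Continuous.subtype_mk
        (continuous_of_isTransferred hd (continuous_subtype_val.comp continuous_subtype_val) hΨ) _ }
  exact hS.isClosedEmbedding_subtypeVal.comp e.isClosedEmbedding

end Transfer

/-! ### Sequential colimits of closed embeddings -/

section SequentialColimit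

namespace SeqColimit

variable {X : ℕ → Type*} (f : ∀ i, X i → X (i + 1))

/-- The canonical map of a stage to the colimit. -/
def mk (i : ℕ) (x : X i) : SeqColimit f := Quot.mk _ ⟨i, x⟩

/-- The composite map `X i → X j` for `i ≤ j`. -/
def up {i j : ℕ} (h : i ≤ j) : X i → X j := Nat.leRecOn h (fun {k} => f k)

theorem up_self {i : ℕ} (x : X i) : up f le_rfl x = x := Nat.leRecOn_self x

theorem up_succ {i j : ℕ} (h : i ≤ j) (x : X i) :
    up f (h.trans j.le_succ) x = f j (up f h x) := Nat.leRecOn_succ h x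

theorem up_up {i j l : ℕ} (h : i ≤ j) (h' : j ≤ l) (x : X i) :
    up f h' (up f h x) = up f (h.trans h') x := by
  induction l, h' using Nat.le_induction with
  | base => rw [up_self]
  | succ l hl ih => rw [up_succ f hl, ih, ← up_succ f (h.trans hl)]

theorem mk_f (i : ℕ) (x : X i) : mk f (i + 1) (f i x) = mk f i x :=
  (Quot.sound (SeqColimitRel.step i x)).symm

theorem mk_up {i j : ℕ} (h : i ≤ j) (x : X i) : mk f j (up f h x) = mk f i x := by
  induction j, h using Nat.le_induction with
  | base => rw [up_self]
  | succ j hj ih => rw [up_succ f hj, mk_f, ih]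

theorem exists_mk_eq (c : SeqColimit f) : ∃ i x, mk f i x = c := by
  induction c using Quot.ind with
  | mk c => exact ⟨c.1, c.2, rfl⟩

variable {f}

/-- The property of agreeing with `x` at some later stage is invariant under the one-step relation,
so it descends to the quotient and can be read off at the class of `y`. -/
theorem exists_up_eq {i j : ℕ} {x : X i} {y : X j} (h : mk f i x = mk f j y) :
    ∃ (N : ℕ) (hi : i ≤ N) (hj : j ≤ N), up f hi x = up f hj y := by
  let r : (Σ i, X i) → Prop := fun c =>
    ∃ (N : ℕ) (hi : i ≤ N) (hj : c.1 ≤ N), up f hi x = up f hj c.2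
  have hr : ∀ c d, SeqColimitRel f c d → r c = r d := by
    rintro _ _ ⟨j, y⟩
    refine propext ⟨?_, ?_⟩
    · rintro ⟨N, hi, hj, h⟩
      refine ⟨N + 1, hi.trans N.le_succ, Nat.succ_le_succ hj, ?_⟩
      rw [up_succ f hi, h, ← up_succ f hj]
      change _ = up f _ (f j y)
      have h2 := up_succ f (le_refl j) y
      rw [up_self] at h2
      rw [← h2, up_up]
    · rintro ⟨N, hi, hj, h⟩
      have hj' : j + 1 ≤ N := hj
      refine ⟨N, hi, (Nat.le_succ j).trans hj', ?_⟩
      rw [h]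
      change up f hj' (f j y) = _
      have h2 := up_succ f (le_refl j) y
      rw [up_self] at h2
      rw [← h2, up_up]
  have h1 : Quot.lift r hr (mk f i x) := ⟨i, le_rfl, le_rfl, rfl⟩
  rw [h] at h1
  exact h1

theorem mk_injective (hf : ∀ i, Function.Injective (f i)) (i : ℕ) :
    Function.Injective (mk f i) := by
  intro x y h
  obtain ⟨N, hi, hj, h⟩ := exists_up_eq h
  have : Function.Injective (up f hi) := by
    clear h
    induction N, hi using Nat.le_induction with
    | base => exact fun a b hab => by rwa [up_self, up_self] at hab
    | succ N hN ih =>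
      intro a b hab
      rw [up_succ f hN, up_succ f hN] at hab
      exact ih hN (hf N hab)
  exact this h

theorem range_mk_mono {i j : ℕ} (h : i ≤ j) : Set.range (mk f i) ⊆ Set.range (mk f j) := by
  rintro _ ⟨x, rfl⟩
  exact ⟨_, mk_up f h x⟩

section Topology

variable [∀ i, TopologicalSpace (X i)]

theorem isClosed_iff {C : Set (SeqColimit f)} : IsClosed C ↔ ∀ i, IsClosed (mk f i ⁻¹' C) := by
  have hq : Topology.IsQuotientMap (Quot.mk (SeqColimitRel f) : (Σ i, X i) → SeqColimit f) :=
    isQuotientMap_quot_mk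
  refine (hq.isClosed_preimage (s := C)).symm.trans ?_
  rw [isClosed_sigma_iff]
  rfl

theorem continuous_mk (i : ℕ) : Continuous (mk f i) :=
  continuous_iff_isClosed.2 fun _ hC => isClosed_iff.1 hC i

theorem isClosedEmbedding_up (hf : ∀ i, Topology.IsClosedEmbedding (f i)) {i j : ℕ} (h : i ≤ j) :
    Topology.IsClosedEmbedding (up f h) := by
  induction j, h using Nat.le_induction with
  | base =>
    have : up f (le_refl i) = id := funext fun x => up_self f x
    rw [this]
    exact .id
  | succ j hj ih =>
    have : up f (hj.trans j.le_succ) = f j ∘ up f hj := funext fun x => up_succ f hj x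
    rw [this]
    exact (hf j).comp ih

theorem isClosedEmbedding_mk (hf : ∀ i, Topology.IsClosedEmbedding (f i)) (i : ℕ) :
    Topology.IsClosedEmbedding (mk f i) := by
  have hinj := mk_injective fun i => (hf i).injective
  refine .of_continuous_injective_isClosedMap (continuous_mk i) (hinj i) fun C hC => ?_
  rw [isClosed_iff]
  intro j
  -- Seen in stage `j`, a closed set of stage `i` is its image under `up` if `i ≤ j` and its
  -- preimage otherwise; both are closed.
  rcases le_total i j with h | h
  · have : mk f j ⁻¹' (mk f i '' C) = up f h '' C := by
      ext y
      constructor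
      · rintro ⟨x, hx, hxy⟩
        rw [← mk_up f h] at hxy
        exact ⟨x, hx, hinj j hxy⟩
      · rintro ⟨x, hx, rfl⟩
        exact ⟨x, hx, (mk_up f h x).symm⟩
    rw [this]
    exact (isClosedEmbedding_up hf h).isClosedMap C hC
  · have : mk f j ⁻¹' (mk f i '' C) = up f h ⁻¹' C := by
      ext y
      constructor
      · rintro ⟨x, hx, hxy⟩
        rw [← mk_up f h] at hxy
        rw [Set.mem_preimage, ← hinj i hxy]
        exact hx
      · exact fun hy => ⟨_, hy, mk_up f h y⟩
    rw [this]
    exact hC.preimage (isClosedEmbedding_up hf h).continuous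

/-- A compact subset of a sequential colimit of closed embeddings lies in some stage. -/
theorem exists_subset_range [∀ i, T1Space (X i)] (hf : ∀ i, Topology.IsClosedEmbedding (f i))
    {K : Set (SeqColimit f)} (hK : IsCompact K) : ∃ N, K ⊆ Set.range (mk f N) := by
  by_contra! hcon
  simp only [Set.not_subset] at hcon
  choose x hxK hx using hcon
  obtain ⟨a, -, ha⟩ := hK.exists_mapClusterPt (u := x) (f := Filter.atTop)
    (Filter.tendsto_principal.2 (.of_forall hxK))
  obtain ⟨j, y, rfl⟩ := exists_mk_eq f a
  -- Since `x n` is outside stage `n`, every stage contains only finitely many points of `T`. So `T`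
  -- is closed, and it misses stage `j`, where the cluster point of the sequence lies.
  let T : Set (SeqColimit f) := x '' Set.Ici j
  have hT : IsClosed T := by
    refine isClosed_iff.2 fun i => Set.Finite.isClosed ?_
    refine Set.Finite.of_finite_image ?_ (isClosedEmbedding_mk hf i).injective.injOn
    refine ((Set.finite_Iio i).image x).subset ?_
    rintro _ ⟨z, ⟨n, -, hn⟩, rfl⟩
    refine ⟨n, ?_, hn⟩
    by_contra hni
    exact hx n (hn ▸ range_mk_mono (not_lt.1 hni) ⟨z, rfl⟩)
  have hmem : Tᶜ ∈ nhds (mk f j y) := hT.isOpen_compl.mem_nhds fun ⟨n, hn, hnx⟩ =>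
    hx n (hnx ▸ range_mk_mono hn ⟨y, rfl⟩)
  have h1 := ha.frequently hmem
  rw [Filter.frequently_atTop] at h1
  obtain ⟨n, hn, hnT⟩ := h1 j
  exact hnT ⟨n, hn, rfl⟩

/-- The image of a loop is compact, so the loop factors through one stage, continuously because that
stage is embedded, and contracts there. -/
theorem simplyConnectedSpace [∀ i, T1Space (X i)] [∀ i, SimplyConnectedSpace (X i)]
    (hf : ∀ i, Topology.IsClosedEmbedding (f i)) : SimplyConnectedSpace (SeqColimit f) := by
  refine simply_connected_iff_loops_nullhomotopic.2 ⟨⟨?_, fun a b => ?_⟩, fun a γ => ?_⟩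
  · exact ⟨mk f 0 (Classical.arbitrary _)⟩
  · obtain ⟨i, x, rfl⟩ := exists_mk_eq f a
    obtain ⟨j, y, rfl⟩ := exists_mk_eq f b
    have h := (PathConnectedSpace.joined (up f (le_max_left i j) x)
      (up f (le_max_right i j) y)).map (continuous_mk (f := f) (max i j))
    rwa [mk_up, mk_up] at h
  · obtain ⟨N, hN⟩ := exists_subset_range hf (isCompact_range γ.continuous)
    obtain ⟨y, rfl⟩ := hN ⟨0, γ.source⟩
    choose g hg using fun t => hN ⟨t, rfl⟩
    have hemb := isClosedEmbedding_mk hf N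
    have hgc : Continuous g := by
      rw [hemb.isInducing.continuous_iff]
      exact γ.continuous.congr fun t => (hg t).symm
    let γ' : Path y y := ⟨⟨g, hgc⟩, hemb.injective ((hg 0).trans γ.source),
      hemb.injective ((hg 1).trans γ.target)⟩
    have h := (SimplyConnectedSpace.paths_homotopic γ' (Path.refl y)).map ⟨mk f N, hemb.continuous⟩
    have e1 : γ'.map hemb.continuous = γ := by
      ext t
      exact hg t
    have e2 : (Path.refl y).map hemb.continuous = Path.refl (mk f N y) := by
      ext t
      rfl
    rw [← e1, ← e2]
    exact h

end Topology

end SeqColimit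

end SequentialColimit

/-! ### Quasi-local algebras -/

section CountableSites

theorem range_comp_starAlgEquiv_symm {M N R : Type*} [Ring M] [StarRing M] [Algebra ℂ M]
    [Ring N] [StarRing N] [Algebra ℂ N] [Ring R] [StarRing R] [Algebra ℂ R] (φ : M →⋆ₐ[ℂ] R)
    (e : M ≃⋆ₐ[ℂ] N) : Set.range (φ.comp (e.symm : N →⋆ₐ[ℂ] M)) = Set.range φ := by
  ext x
  constructor
  · rintro ⟨y, rfl⟩
    exact ⟨e.symm y, rfl⟩
  · rintro ⟨y, rfl⟩
    exact ⟨e y, congrArg φ (e.symm_apply_apply y)⟩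

variable {A : Type*} [CStarAlgebra A]

/-- The scalars as matrices of size one. -/
noncomputable def scalarMatrixHom : Matrix (Fin 1) (Fin 1) ℂ →⋆ₐ[ℂ] A where
  toFun X := algebraMap ℂ A (X 0 0)
  map_one' := by simp
  map_mul' X Y := by simp [Matrix.mul_apply]
  map_zero' := by simp
  map_add' X Y := by simp
  commutes' r := by simp [Algebra.algebraMap_eq_smul_one (A := Matrix (Fin 1) (Fin 1) ℂ)]
  map_star' X := algebraMap_star_comm (X 0 0)

/-- Commuting matrix algebras of the same size at countably many sites give a factorization. -/
theorem SitesCommute.nonempty_tensorFactorization {Γ : Type*} [Countable Γ] {d : ℕ} (hd : 0 < d)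
    {ι : Γ → Matrix (Fin d) (Fin d) ℂ →⋆ₐ[ℂ] A} (hι : SitesCommute ι)
    (hdense : Dense (StarAlgebra.adjoin ℂ (⋃ v, Set.range (ι v)) : Set A)) :
    Nonempty (TensorFactorization A) := by
  classical
  obtain ⟨enc, henc⟩ := exists_injective_nat Γ
  -- Indices that enumerate no site carry the scalars `M₁(ℂ)`; this also covers finite and empty
  -- `Γ`.
  let fac : ℕ → Σ m : ℕ, (Matrix (Fin m) (Fin m) ℂ →⋆ₐ[ℂ] A) := fun i =>
    if h : ∃ v, enc v = i then ⟨d, ι h.choose⟩ else ⟨1, scalarMatrixHom⟩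
  have hpos : ∀ i v, enc v = i → fac i = ⟨d, ι v⟩ := by
    rintro _ v rfl
    have h : ∃ w, enc w = enc v := ⟨v, rfl⟩
    have : fac (enc v) = ⟨d, ι h.choose⟩ := dif_pos h
    rw [this, henc h.choose_spec]
  have hneg : ∀ i, (¬ ∃ v, enc v = i) → fac i = ⟨1, scalarMatrixHom⟩ := fun i h => dif_neg h
  have hscal : ∀ i, (¬ ∃ v, enc v = i) → ∀ a x, Commute ((fac i).2 a) x := fun i h => by
    rw [hneg i h]
    exact fun a x => Algebra.commutes _ _
  refine ⟨⟨fun i => (fac i).1, fun i => ?_, fun i => (fac i).2, fun i j hij => ?_,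
    hdense.mono (StarAlgebra.adjoin_mono (Set.iUnion_subset fun v => ?_))⟩⟩
  · by_cases h : ∃ v, enc v = i
    · obtain ⟨v, hv⟩ := h
      rw [hpos i v hv]
      exact hd
    · rw [hneg i h]
      exact one_pos
  · by_cases hi : ∃ v, enc v = i
    · by_cases hj : ∃ w, enc w = j
      · obtain ⟨v, hv⟩ := hi
        obtain ⟨w, hw⟩ := hj
        rw [hpos i v hv, hpos j w hw]
        exact hι v w fun h => hij (by rw [← hv, ← hw, h])
      · exact fun a b => (hscal j hj b _).symm
    · exact fun a b => hscal i hi a _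
  · refine Set.Subset.trans ?_ (Set.subset_iUnion _ (enc v))
    rw [hpos _ v rfl]

end CountableSites

/-! ### Density, nontriviality and factorization of the quasi-local algebra -/

section QuasiLocalAlgebra

variable (Γ : Type*) (H : Type*) [NormedAddCommGroup H] [InnerProductSpace ℂ H]
  [FiniteDimensional ℂ H]

variable {H} in
/-- The copy of `ℬ(H)` at the site `v`. -/
noncomputable def siteHom (v : Γ) : (H →ₗ[ℂ] H) →⋆ₐ[ℂ] QuasiLocalAlgebra Γ H where
  toFun := siteElement v
  map_one' := Subtype.ext (map_one (siteRep Γ H v))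
  map_mul' a b := Subtype.ext (map_mul (siteRep Γ H v) a b)
  map_zero' := Subtype.ext (map_zero (siteRep Γ H v))
  map_add' a b := Subtype.ext (map_add (siteRep Γ H v) a b)
  commutes' r := Subtype.ext (AlgHomClass.commutes (siteRep Γ H v) r)
  map_star' a := Subtype.ext (map_star (siteRep Γ H v) a)

theorem sitesCommute_siteHom : SitesCommute (siteHom Γ (H := H)) := fun _ _ hvw _ _ =>
  Subtype.ext (siteMatrix_commute hvw _ _).eq

/-- The inclusion of the quasi-local algebra in the bounded operators. -/
noncomputable def quasiLocalInclusion : QuasiLocalAlgebra Γ H →⋆ₐ[ℂ]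
    (ConfigSpace Γ (Fin (Module.finrank ℂ H)) →L[ℂ] ConfigSpace Γ (Fin (Module.finrank ℂ H))) :=
  (quasiLocalSubalgebra Γ H).subtype

theorem dense_adjoin_siteHom :
    Dense (StarAlgebra.adjoin ℂ (⋃ v : Γ, Set.range (siteHom Γ (H := H) v)) :
      Set (QuasiLocalAlgebra Γ H)) := by
  intro x
  -- Density is checked among the bounded operators, where the algebra is by definition the closure
  -- of the local operators.
  have hind : Topology.IsInducing (quasiLocalInclusion Γ H) := Topology.IsInducing.subtypeVal
  rw [hind.closure_eq_preimage_closure_image, Set.mem_preimage]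
  have hmap := StarAlgHom.map_adjoin (quasiLocalInclusion Γ H)
    (⋃ v : Γ, Set.range (siteHom Γ (H := H) v))
  have himg : quasiLocalInclusion Γ H '' (⋃ v : Γ, Set.range (siteHom Γ (H := H) v)) =
      ⋃ v : Γ, Set.range (siteRep Γ H v) := by
    rw [Set.image_iUnion]
    refine Set.iUnion_congr fun v => ?_
    rw [← Set.range_comp]
    rfl
  rw [himg] at hmap
  have h2 : quasiLocalInclusion Γ H '' (StarAlgebra.adjoin ℂ
      (⋃ v : Γ, Set.range (siteHom Γ (H := H) v)) : Set (QuasiLocalAlgebra Γ H)) =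
      (StarAlgebra.adjoin ℂ (⋃ v : Γ, Set.range (siteRep Γ H v)) : Set _) := by
    rw [← hmap]
    rfl
  rw [h2]
  exact x.2

theorem dense_span_siteProds_siteHom :
    Dense (Submodule.span ℂ (siteProds (siteHom Γ (H := H))) : Set (QuasiLocalAlgebra Γ H)) :=
  (sitesCommute_siteHom Γ H).dense_span_siteProds (dense_adjoin_siteHom Γ H)

instance [Nontrivial H] : Nontrivial (QuasiLocalAlgebra Γ H) := by
  have hpos : 0 < Module.finrank ℂ H := Module.finrank_pos
  let σ : Γ → Fin (Module.finrank ℂ H) := fun _ => ⟨0, hpos⟩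
  refine ⟨⟨0, 1, fun h => ?_⟩⟩
  have h1 := congrArg (quasiLocalInclusion Γ H) h
  rw [map_zero, map_one] at h1
  classical
  have h2 := DFunLike.congr_fun h1 (lp.single 2 σ (1 : ℂ))
  have h3 := congrArg (fun g : ConfigSpace Γ (Fin (Module.finrank ℂ H)) => g σ) h2
  simp at h3

theorem nonempty_tensorFactorization_quasiLocal [Countable Γ] [Nontrivial H] :
    Nonempty (TensorFactorization (QuasiLocalAlgebra Γ H)) := by
  let e := LinearMap.toMatrixOrthonormal (stdOrthonormalBasis ℂ H)
  refine SitesCommute.nonempty_tensorFactorization (Γ := Γ) (d := Module.finrank ℂ H)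
    Module.finrank_pos (ι := fun v => (siteHom Γ v).comp (e.symm : Matrix _ _ ℂ →⋆ₐ[ℂ] (H →ₗ[ℂ] H)))
    (fun v w hvw a b => sitesCommute_siteHom Γ H v w hvw _ _) ?_
  simp only [range_comp_starAlgEquiv_symm]
  exact dense_adjoin_siteHom Γ H

theorem simplyConnectedSpace_latticePureStates [Countable Γ] [Nontrivial H] :
    SimplyConnectedSpace (LatticePureStates Γ H) := by
  obtain ⟨F⟩ := nonempty_tensorFactorization_quasiLocal Γ H
  exact F.tower.simplyConnectedSpace

end QuasiLocalAlgebra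

/-! ### Transfer along isometries -/

section Isometries

variable {E H H₁ H₂ : Type*} [NormedAddCommGroup E] [InnerProductSpace ℂ E] [FiniteDimensional ℂ E]
  [NormedAddCommGroup H] [InnerProductSpace ℂ H] [FiniteDimensional ℂ H]
  [NormedAddCommGroup H₁] [InnerProductSpace ℂ H₁] [FiniteDimensional ℂ H₁]
  [NormedAddCommGroup H₂] [InnerProductSpace ℂ H₂] [FiniteDimensional ℂ H₂]

section RankOne

variable {E : Type*} [NormedAddCommGroup E] [InnerProductSpace ℂ E]

/-- The operator `z ↦ ⟨y, z⟩ x`. -/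
noncomputable def rankOneEnd (x y : E) : E →ₗ[ℂ] E :=
  (InnerProductSpace.rankOne ℂ x y).toLinearMap

theorem rankOneEnd_apply (x y z : E) : rankOneEnd x y z = inner ℂ y z • x :=
  InnerProductSpace.rankOne_apply x y z

theorem mul_rankOneEnd (B : E →ₗ[ℂ] E) (x y : E) : B * rankOneEnd x y = rankOneEnd (B x) y := by
  ext z
  simp [rankOneEnd_apply]

theorem rankOneEnd_mul_rankOneEnd (x y z w : E) :
    rankOneEnd x y * rankOneEnd z w = inner ℂ y z • rankOneEnd x w := by
  ext v
  simp [rankOneEnd_apply, smul_smul, mul_comm]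

theorem sum_rankOneEnd {n : Type*} [Fintype n] (b : OrthonormalBasis n ℂ E) :
    ∑ j, rankOneEnd (b j) (b j) = 1 := by
  ext z
  simp only [LinearMap.sum_apply, rankOneEnd_apply, Module.End.one_apply]
  exact b.sum_repr' z

end RankOne

theorem star_rankOneEnd (x y : E) : star (rankOneEnd x y) = rankOneEnd y x := by
  rw [LinearMap.star_eq_adjoint]
  refine ((LinearMap.eq_adjoint_iff _ _).2 fun z w => ?_).symm
  rw [rankOneEnd_apply, rankOneEnd_apply, inner_smul_left, inner_smul_right, inner_conj_symm,
    mul_comm]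

theorem isStarProjection_rankOneEnd {k : E} (hk : ‖k‖ = 1) : IsStarProjection (rankOneEnd k k) := by
  refine ⟨?_, star_rankOneEnd k k⟩
  rw [IsIdempotentElem, rankOneEnd_mul_rankOneEnd, inner_self_eq_norm_sq_to_K, hk]
  simp

theorem LinearIsometry.adjoint_comp_self_linear (g : H →ₗᵢ[ℂ] H₁) :
    LinearMap.adjoint g.toLinearMap ∘ₗ g.toLinearMap = LinearMap.id := by
  ext x
  refine ext_inner_right ℂ fun y => ?_
  rw [LinearMap.comp_apply, LinearMap.adjoint_inner_left]
  exact g.inner_map_map x y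

theorem LinearIsometry.adjoint_apply_self (g : H →ₗᵢ[ℂ] H₁) (x : H) :
    LinearMap.adjoint g.toLinearMap (g x) = x :=
  LinearMap.congr_fun g.adjoint_comp_self_linear x

/-- The matrix expansion of `g C g⋆`. -/
theorem sum_inner_smul_rankOneEnd {n : Type*} [Fintype n] (b : OrthonormalBasis n ℂ H)
    (g : H →ₗ[ℂ] H₁) (C : H →ₗ[ℂ] H) :
    ∑ i, ∑ j, inner ℂ (b i) (C (b j)) • rankOneEnd (g (b i)) (g (b j)) =
      g ∘ₗ C ∘ₗ LinearMap.adjoint g := by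
  ext z
  simp only [LinearMap.sum_apply, LinearMap.smul_apply, rankOneEnd_apply, LinearMap.comp_apply]
  rw [Finset.sum_comm]
  have h : ∀ j, ∑ i, inner ℂ (b i) (C (b j)) • inner ℂ (g (b j)) z • g (b i) =
      inner ℂ (b j) (LinearMap.adjoint g z) • g (C (b j)) := fun j => by
    conv_rhs => rw [← b.sum_repr' (C (b j)), map_sum, Finset.smul_sum]
    refine Finset.sum_congr rfl fun i _ => ?_
    rw [LinearMap.adjoint_inner_right, map_smul, smul_comm]
  rw [Finset.sum_congr rfl fun j _ => h j]
  conv_rhs => rw [← b.sum_repr' (LinearMap.adjoint g z), map_sum, map_sum]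
  simp only [map_smul]

/-- The transfer `B ↦ g g'⋆ B g' g⋆` along isometries `g`, `g'` with the same domain. -/
noncomputable def Transfer.ofIsometries (g : H →ₗᵢ[ℂ] H₁) (g' : H →ₗᵢ[ℂ] H₂) (h : H₁) (k : H₂)
    (hh : ‖h‖ = 1) (hk : ‖k‖ = 1) : Transfer (H₁ →ₗ[ℂ] H₁) (H₂ →ₗ[ℂ] H₂) where
  E B := g.toLinearMap ∘ₗ (LinearMap.adjoint g'.toLinearMap ∘ₗ B ∘ₗ g'.toLinearMap) ∘ₗ
    LinearMap.adjoint g.toLinearMap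
  -- In bra-ket notation `x = ∑ |h⟩⟨g e_j| ⊗ |g' e_j⟩⟨k|`. The unit vectors `h` contract in `x⋆ (1 ⊗
  -- B) x`, the second factor produces the matrix entries of `g'⋆ B g'` times `|k⟩⟨k|`, and the
  -- first reassembles them along `g`.
  x := ∑ j, rankOneEnd h (g (stdOrthonormalBasis ℂ H j)) ⊗ₜ
    rankOneEnd (g' (stdOrthonormalBasis ℂ H j)) k
  p := rankOneEnd k k
  star_mul_mul B := by
    rw [← sum_inner_smul_rankOneEnd (stdOrthonormalBasis ℂ H), star_sum, Finset.sum_mul,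
      Finset.sum_mul_sum]
    simp only [TensorProduct.sum_tmul]
    refine Finset.sum_congr rfl fun i _ => Finset.sum_congr rfl fun j _ => ?_
    rw [TensorProduct.star_tmul, Algebra.TensorProduct.tmul_mul_tmul,
      Algebra.TensorProduct.tmul_mul_tmul, mul_one, star_rankOneEnd, star_rankOneEnd,
      rankOneEnd_mul_rankOneEnd, mul_assoc, mul_rankOneEnd, rankOneEnd_mul_rankOneEnd,
      inner_self_eq_norm_sq_to_K, hh, TensorProduct.tmul_smul, TensorProduct.smul_tmul',
      LinearMap.comp_apply, LinearMap.adjoint_inner_right]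
    simp
  isStarProjection_p := isStarProjection_rankOneEnd hk
  full := ⟨_, fun j => rankOneEnd (stdOrthonormalBasis ℂ H₂ j) k,
    fun j => rankOneEnd k (stdOrthonormalBasis ℂ H₂ j), by
      rw [← sum_rankOneEnd (stdOrthonormalBasis ℂ H₂)]
      refine Finset.sum_congr rfl fun j _ => ?_
      rw [rankOneEnd_mul_rankOneEnd, smul_mul_assoc, rankOneEnd_mul_rankOneEnd,
        inner_self_eq_norm_sq_to_K, hk]
      simp⟩
  isStarProjection_E_one := by
    refine ⟨?_, ?_⟩
    · ext z
      simp [LinearIsometry.adjoint_apply_self]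
    · rw [IsSelfAdjoint, LinearMap.star_eq_adjoint]
      simp only [LinearMap.adjoint_comp, LinearMap.adjoint_adjoint, ← LinearMap.star_eq_adjoint (1 : H₂ →ₗ[ℂ] H₂), star_one]
      rfl
  E_mul B := by
    ext z
    simp [LinearIsometry.adjoint_apply_self]

theorem Transfer.ofIsometries_E_apply (g : H →ₗᵢ[ℂ] H₁) (g' : H →ₗᵢ[ℂ] H₂) (h : H₁) (k : H₂)
    (hh : ‖h‖ = 1) (hk : ‖k‖ = 1) (B : H₂ →ₗ[ℂ] H₂) (z : H₁) :
    (Transfer.ofIsometries g g' h k hh hk).E B z =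
      g (LinearMap.adjoint g'.toLinearMap (B (g' (LinearMap.adjoint g.toLinearMap z)))) := rfl

end Isometries

/-! ### Pushforward of pure states along an isometry -/

section Pushforward

/-- An isometry induces a closed embedding of the pure state spaces of the quasi-local algebras. -/
theorem exists_pushforward (Γ : Type*) {H K : Type*} [NormedAddCommGroup H] [InnerProductSpace ℂ H]
    [FiniteDimensional ℂ H] [NormedAddCommGroup K] [InnerProductSpace ℂ K]
    [FiniteDimensional ℂ K] [Nontrivial H] [Nontrivial K] (f : H →ₗᵢ[ℂ] K) :
    ∃ Φ : LatticePureStates Γ H → LatticePureStates Γ K, Topology.IsClosedEmbedding Φ ∧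
      ∀ ω, IsPushforwardState f ω (Φ ω) := by
  obtain ⟨h, hh⟩ := exists_norm_eq H zero_le_one
  obtain ⟨k, hk⟩ := exists_norm_eq K zero_le_one
  -- Here `T.E B = f⋆ B f` and `T'.E a = f a f⋆`, so `T.E ∘ T'.E` is the identity and `T'.E ∘ T.E`
  -- is compression by the range projection `f f⋆`.
  let T := Transfer.ofIsometries (LinearIsometry.id (E := H) (R := ℂ)) f h k hh hk
  let T' := Transfer.ofIsometries f (LinearIsometry.id (E := H) (R := ℂ)) k h hk hh
  have hid : LinearMap.adjoint (LinearIsometry.id (E := H) (R := ℂ)).toLinearMap = LinearMap.id := by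
    ext x
    exact LinearIsometry.adjoint_apply_self LinearIsometry.id x
  have hT : ∀ B z, T.E B z = LinearMap.adjoint f.toLinearMap (B (f z)) := fun B z => by
    rw [Transfer.ofIsometries_E_apply, hid]
    rfl
  have hT' : ∀ a z, T'.E a z = f (a (LinearMap.adjoint f.toLinearMap z)) := fun a z => by
    rw [Transfer.ofIsometries_E_apply, hid]
    rfl
  obtain ⟨Φ, hΦ, hΦt⟩ := T.exists_isClosedEmbedding T'
    (LinearMap.ext fun z => by rw [hT]; exact f.adjoint_apply_self z)
    (fun a => LinearMap.ext fun z => by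
      rw [hT, hT', f.adjoint_apply_self, f.adjoint_apply_self])
    (fun B => LinearMap.ext fun z => by
      rw [hT', hT, Module.End.mul_apply, Module.End.mul_apply, hT', hT']
      rfl)
    (sitesCommute_siteHom Γ H) (sitesCommute_siteHom Γ K) (dense_span_siteProds_siteHom Γ H)
    (dense_span_siteProds_siteHom Γ K)
  refine ⟨Φ, hΦ, fun ω Λ hΛ B => ?_⟩
  have hE : ∀ B, T.E B = LinearMap.adjoint f.toLinearMap ∘ₗ B ∘ₗ f.toLinearMap := fun B =>
    LinearMap.ext fun z => hT B z
  have := hΦt ω Λ hΛ B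
  simp only [hE] at this
  exact this

theorem nontrivial_tensorPower {H : Type*} [NormedAddCommGroup H] [InnerProductSpace ℂ H]
    [FiniteDimensional ℂ H] (u : H) (hu : ‖u‖ = 1) (i : ℕ) :
    Nontrivial (tensorPower H i).carrier := by
  induction i with
  | zero => exact inferInstanceAs (Nontrivial (EuclideanSpace ℂ PUnit))
  | succ i ih => exact (tensorRight u hu i).injective.nontrivial

end Pushforward

/-! ### The main theorem -/

theorem mainTheorem1 :
    -- loops of states, and pure states, on an arbitrary UHF algebra
    (∀ (A : Type*) [CStarAlgebra A], IsUHF A →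
      Nonempty (TensorFactorization A) ∧
      (∀ F : TensorFactorization A, ∃ ω₀ : PureStateSpace A, F.IsProductState ω₀.1 ∧
        (∀ ω : Path ω₀.1 ω₀.1,
          ∃ (a : C(unitInterval × Set.Ico (0 : ℝ) 1, A)) (h : ω.Homotopy (Path.refl ω₀.1)),
            ∀ (t : unitInterval) (s : Set.Ico (0 : ℝ) 1),
              ∃ hts : a (t, s) ∉ gelfandIdeal (ω t),
                h (⟨s.1, s.2.1, s.2.2.le⟩, t) = actOnState (a (t, s)) (ω t) hts) ∧
        Subsingleton (FundamentalGroup (PureStateSpace A) ω₀)) ∧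
      SimplyConnectedSpace (PureStateSpace A)) ∧
    -- the space `𝒫_Γ(H)`
    (∀ (Γ : Type*) [Countable Γ] (H : Type*) [NormedAddCommGroup H] [InnerProductSpace ℂ H]
      [FiniteDimensional ℂ H] [Nontrivial H],
      SimplyConnectedSpace (LatticePureStates Γ H)) ∧
    -- the space `𝒫_Γ(H^{⊗∞})`, the colimit along `𝒫_Γ(x ↦ x ⊗ u)`
    (∀ (Γ : Type*) [Countable Γ] (H : Type*) [NormedAddCommGroup H] [InnerProductSpace ℂ H]
      [FiniteDimensional ℂ H] [Nontrivial H] (u : H) (hu : ‖u‖ = 1),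
      ∃ Φ : ∀ i, LatticePureStates Γ (tensorPower H i).carrier →
          LatticePureStates Γ (tensorPower H (i + 1)).carrier,
        (∀ i ω, IsPushforwardState (tensorRight u hu i) ω (Φ i ω)) ∧
        SimplyConnectedSpace (SeqColimit Φ)) := by
  refine ⟨fun A _ hA => ?_, fun Γ _ H _ _ _ _ => simplyConnectedSpace_latticePureStates Γ H,
    fun Γ _ H _ _ _ _ u hu => ?_⟩
  · have := hA.nontrivial
    have hF := hA.nonempty_tensorFactorization
    obtain ⟨F₀⟩ := hF
    have hsc : SimplyConnectedSpace (PureStateSpace A) := F₀.tower.simplyConnectedSpace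
    refine ⟨⟨F₀⟩, fun F => ?_, hsc⟩
    obtain ⟨ω₀, hω₀⟩ := F.tower.exists_isBase
    exact ⟨⟨ω₀, hω₀.isPureState⟩, F.isProductState_of_isBase hω₀,
      ProjectionTower.exists_homotopy hω₀, inferInstance⟩
  · have := nontrivial_tensorPower u hu
    have hsc := fun i => simplyConnectedSpace_latticePureStates Γ (tensorPower H i).carrier
    choose Φ hΦ hpush using fun i => exists_pushforward Γ (tensorRight u hu i)
    exact ⟨Φ, hpush, SeqColimit.simplyConnectedSpace hΦ⟩
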